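/- **Setting.** Let $S$ be a geodesic metric space. For $A\subset S$ and $x\in S$ let $\pi_A(x)$ be the set of closest points to $x$ in $A$. For $q\ge1$, a map $f$ from an interval $I\subset\mathbf R$ to a metric space $(Y,\mathrm d)$ is a *$q$-quasiisometric embedding* if $\frac1q|s-t|-q\le \mathrm d(f(s),f(t))\le q|s-t|+q$ for all $s,t\in I$. A *$q$-quasigeodesic* in $S$ is a $q$-quasiisometric embedding $\alpha:I\to S$ such that every point of $S$ has a closest point in the image of $\alpha$ (so that the image is closed). A subset $A\subset S$ (in particular, the image of a quasigeodesic) is *$D$-strongly contracting* if $\operatorname{diam}\bigcup_{x\in B}\pi_A(x)<D$ for every ball $B\subset S$ disjoint from $A$. **Curtains.** Let $\gamma$ be a $D$-strongly contracting geodesic of length $20D$, where $D\ge1$, and let $I\subset\gamma$ be a closed subgeodesic of length $10D$ containing no endpoint of $\gamma$. The *curtain* dual to $\gamma$ at $I$ is $\mathfrak h=\{x\in S:\pi_\gamma(x)\subset I\}$; its halfspaces $\mathfrak h^-,\mathfrak h^+$ are the sets of points $x$ such that $\pi_\gamma(x)$ meets the first, respectively second, component of $\gamma\smallsetminus I$ (reversing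 $\gamma$ exchanges them). For a natural number $R\ge 1$, let $\mathfrak h,\mathfrak k$ be disjoint curtains, oriented so that $\mathfrak h\subset\mathfrak k^-$ and $\mathfrak k\subset\mathfrak h^+$. They are *$R$-ball-separated* if there is a ball $B\subset\mathfrak h^+\cap\mathfrak k^-$ of radius at most $R$ that meets every geodesic from $\mathfrak h^-$ to $\mathfrak k^+$. An *$R$-chain* is a sequence $(\mathfrak h_i)$ of oriented curtains, indexed by an interval of $\mathbf Z$, such that for all $i<j$ one has $\mathfrak h_i\subset\mathfrak h_j^-$, $\mathfrak h_j\subset\mathfrak h_i^+$, and $\mathfrak h_i,\mathfrak h_j$ are $R$-ball-separated. **The space $X$.** Each curtain $\mathfrak h$ induces two bipartitions (*walls*) of $S$, namely $\{\mathfrak h^-\cup\mathfrak h,\ \mathfrak h^+\}$ and $\{\mathfrak h^-,\ \mathfrak h\cup\mathfrak h^+\}$. Let $P$ be the set of all walls induced by curtains. Let $\mathcal C_R$ be the set of all chains $\{h_i\}\subset P$ (i.e. the halfspaces $h_i^-$ are nested increasingly) such that the $h_i$ are induced by the members $\mathfrak h_i$ of some $R$-chain. An *ultrafilter* on $P$ is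 a choice of a halfspace $x(h)\in h$ for each $h\in P$ such that if $x(h_1)\subset A$ for a halfspace $A$ of $h_2$, then $x(h_2)=A$. Each $s\in S$ defines the ultrafilter $\phi_s$ choosing the halfspaces that contain $s$. For ultrafilters $x,y$ let $$\mathrm d_R(x,y)=\sup\{|c|:c\in\mathcal C_R,\ x(h)\ne y(h)\text{ for all }h\in c\}.$$ Fix any sequence of numbers $\lambda_R>0$ $(R\ge1)$ with $\sum_R R\lambda_R<\infty$, and set $\mathrm D(x,y)=\sum_{R=1}^\infty\lambda_R\,\mathrm d_R(x,y)$. Let $X$ be the set of ultrafilters $x$ on $P$ with $\mathrm D(\phi_s,x)<\infty$ for all $s\in S$. Then $(X,\mathrm D)$ is a metric space containing every $\phi_s$. **Theorem.** 1. $(X,\mathrm D)$ is a roughly geodesic hyperbolic space: it satisfies Gromov's four-point condition for some $\delta$, and there is $k$ such that any $x,y\in X$ are the endpoints of a map $c:[0,\mathrm D(x,y)]\to X$ with $\big|\mathrm D(c(s),c(t))-|s-t|\big|\le k$ for all $s,t$. 2. The action of $\operatorname{Isom}S$ on $P$ induces an isometric action of $\operatorname{Isom}S$ on $X$, given by $(gx)(gh)=g(x(h))$,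 and the map $S\to X$, $s\mapsto\phi_s$, is $\operatorname{Isom}S$-equivariant. 3. The map $S\to X$ is coarsely Lipschitz: there is $K$ with $\mathrm D(\phi_s,\phi_t)\le K\,\mathrm d(s,t)+K$ for all $s,t\in S$. 4. For each $q\ge 1$ and $D$ there exists $\nu\ge1$ such that if $\alpha:I\to S$ is a $D$-strongly contracting $q$-quasigeodesic, then $I\to X$, $t\mapsto\phi_{\alpha(t)}$, is a $\nu$-quasiisometric embedding. 5. Conversely, for each $q,\nu\ge1$ there exists $D$ such that if $\alpha:I\to S$ is a $q$-quasigeodesic for which $I\to X$, $t\mapsto\phi_{\alpha(t)}$, is a $\nu$-quasiisometric embedding, then $\alpha$ is $D$-strongly contracting. -/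

import Mathlib

open Set Metric
open scoped ENNReal NNReal

namespace CurtainDual

/-! ### Geodesics, quasigeodesics, hyperbolicity -/

/-- `γ` restricted to `[0, ℓ]` is a geodesic of length `ℓ`, parametrised by arc length. -/
def IsGeodesicSegment {S : Type*} [MetricSpace S] (γ : ℝ → S) (ℓ : ℝ) : Prop :=
  0 ≤ ℓ ∧ ∀ s ∈ Icc 0 ℓ, ∀ t ∈ Icc 0 ℓ, dist (γ s) (γ t) = |s - t|

/-- A geodesic metric space: any two points are the endpoints of a geodesic. -/
class GeodesicSpace (S : Type*) [MetricSpace S] : Prop where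
  exists_geodesic : ∀ x y : S, ∃ (γ : ℝ → S) (ℓ : ℝ),
    IsGeodesicSegment γ ℓ ∧ γ 0 = x ∧ γ ℓ = y

/-- The four-point condition of Gromov, for some constant `δ`. -/
def IsFourPointHyperbolic (Y : Type*) [MetricSpace Y] : Prop :=
  ∃ δ : ℝ, ∀ x₁ x₂ x₃ x₄ : Y,
    dist x₁ x₂ + dist x₃ x₄ ≤
      δ + max (dist x₁ x₃ + dist x₂ x₄) (dist x₁ x₄ + dist x₂ x₃)

/-- For some constant `k`, any two points are joined by a `(1, k)`-quasiisometrically embedded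
interval. -/
def IsRoughlyGeodesic (Y : Type*) [MetricSpace Y] : Prop :=
  ∃ k : ℝ, ∀ x y : Y, ∃ γ : ℝ → Y, γ 0 = x ∧ γ (dist x y) = y ∧
    ∀ s ∈ Icc 0 (dist x y), ∀ t ∈ Icc 0 (dist x y), abs (dist (γ s) (γ t) - |s - t|) ≤ k

/-- `f` restricted to `I ⊆ ℝ` is a `q`-quasiisometric embedding. -/
def IsQIEmbeddingOn {Y : Type*} [MetricSpace Y] (q : ℝ) (I : Set ℝ) (f : ℝ → Y) : Prop :=
  ∀ s ∈ I, ∀ t ∈ I,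
    |s - t| / q - q ≤ dist (f s) (f t) ∧ dist (f s) (f t) ≤ q * |s - t| + q

/-- The set `π_A(x)` of closest points to `x` in `A`. -/
def closestPoints {S : Type*} [MetricSpace S] (A : Set S) (x : S) : Set S :=
  {p | p ∈ A ∧ ∀ p' ∈ A, dist x p ≤ dist x p'}

/-- `α`, restricted to the interval `I`, is a `q`-quasigeodesic. As usual when one projects to
quasigeodesics, every point of `S` is required to have a closest point in the image; in particular
the image is closed. -/
structure IsQuasigeodesic {S : Type*} [MetricSpace S] (q : ℝ) (I : Set ℝ) (α : ℝ → S) :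
    Prop where
  interval : I.OrdConnected
  qi : IsQIEmbeddingOn q I α
  closest : ∀ x : S, (closestPoints (α '' I) x).Nonempty

/-- `A` is `D`-strongly contracting: every ball disjoint from `A` has closest-point projection of
diameter less than `D`. (A closed ball disjoint from a set that contains closest points lies in an
open ball disjoint from it, so that open balls are enough.) -/
def IsStronglyContracting {S : Type*} [MetricSpace S] (D : ℝ) (A : Set S) : Prop :=
  ∀ (x : S) (r : ℝ), Disjoint (ball x r) A →
    ediam (⋃ y ∈ ball x r, closestPoints A y) < ENNReal.ofReal D

/-! ### Curtains -/

/-- The data of a curtain with a choice of orientation: a `D`-strongly contracting geodesic `γ` of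
length `20D`, where `D ≥ 1`, and a subgeodesic `γ [a, a + 10D]` that contains no endpoint of `γ`.
Reversing `γ` reverses the orientation. -/
structure Curtain (S : Type*) [MetricSpace S] where
  D : ℝ
  one_le_D : 1 ≤ D
  γ : ℝ → S
  geodesic : IsGeodesicSegment γ (20 * D)
  contracting : IsStronglyContracting D (γ '' Icc 0 (20 * D))
  a : ℝ
  a_pos : 0 < a
  a_lt : a < 10 * D

namespace Curtain

variable {S : Type*} [MetricSpace S]

/-- The geodesic to which the curtain is dual. -/
def axis (c : Curtain S) : Set S := c.γ '' Icc 0 (20 * c.D)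

/-- The curtain itself, as a subset of `S`. -/
def body (c : Curtain S) : Set S :=
  {x | closestPoints c.axis x ⊆ c.γ '' Icc c.a (c.a + 10 * c.D)}

/-- The negative halfspace of the curtain. -/
def neg (c : Curtain S) : Set S :=
  {x | (closestPoints c.axis x ∩ c.γ '' Ico 0 c.a).Nonempty}

/-- The positive halfspace of the curtain. -/
def pos (c : Curtain S) : Set S :=
  {x | (closestPoints c.axis x ∩ c.γ '' Ioc (c.a + 10 * c.D) (20 * c.D)).Nonempty}

/-- `h` and `k` are disjoint curtains, oriented such that `h` lies on the negative side of `k` and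
`k` on the positive side of `h`, and they are `R`-ball-separated. -/
def BallSeparated (R : ℕ) (h k : Curtain S) : Prop :=
  h.body ⊆ k.neg ∧ k.body ⊆ h.pos ∧
    ∃ (z : S) (r : ℝ), 0 ≤ r ∧ r ≤ R ∧ closedBall z r ⊆ h.pos ∩ k.neg ∧
      ∀ (β : ℝ → S) (ℓ : ℝ), IsGeodesicSegment β ℓ → β 0 ∈ h.neg → β ℓ ∈ k.pos →
        ∃ t ∈ Icc 0 ℓ, β t ∈ closedBall z r

end Curtain

/-! ### Walls, ultrafilters, dual distances -/

/-- A wall: an unordered bipartition `{A, Aᶜ}` of `S`, whose elements are its halfspaces. -/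
def Wall (S : Type*) : Type _ := {h : Set (Set S) // ∃ A : Set S, h = {A, Aᶜ}}

/-- The wall with halfspaces `A` and `Aᶜ`. -/
def Wall.of {S : Type*} (A : Set S) : Wall S := ⟨{A, Aᶜ}, A, rfl⟩

/-- An ultrafilter on a set `P` of walls: a consistent choice of halfspaces. -/
@[ext]
structure WallUltrafilter {S : Type*} (P : Set (Wall S)) where
  half : P → Set S
  half_mem : ∀ h : P, half h ∈ h.1.1
  consistent : ∀ (h₁ h₂ : P) (A : Set S), A ∈ h₂.1.1 → half h₁ ⊆ A → half h₂ = A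

/-- The ultrafilter `φ_s`, which chooses the halfspaces that contain `s`. -/
def principal {S : Type*} (P : Set (Wall S)) (s : S) : WallUltrafilter P where
  half h := ⋃₀ {A | A ∈ h.1.1 ∧ s ∈ A}
  half_mem := by
    rintro ⟨⟨_, A, rfl⟩, _⟩
    by_cases hs : s ∈ A
    · have : {B : Set S | B ∈ ({A, Aᶜ} : Set (Set S)) ∧ s ∈ B} = {A} := by
        ext B; constructor
        · rintro ⟨rfl | rfl, hB⟩
          · rfl
          · exact absurd hs hB
        · rintro rfl; exact ⟨Or.inl rfl, hs⟩
      simp only [this, sUnion_singleton]; exact Or.inl rfl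
    · have : {B : Set S | B ∈ ({A, Aᶜ} : Set (Set S)) ∧ s ∈ B} = {Aᶜ} := by
        ext B; constructor
        · rintro ⟨rfl | rfl, hB⟩
          · exact absurd hB hs
          · rfl
        · rintro rfl; exact ⟨Or.inr rfl, hs⟩
      simp only [this, sUnion_singleton]; exact Or.inr rfl
  consistent := by
    rintro ⟨⟨_, A₁, rfl⟩, _⟩ ⟨⟨_, A₂, rfl⟩, _⟩ A hA hsub
    have hs : s ∈ A := by
      apply hsub
      by_cases h : s ∈ A₁
      · exact ⟨A₁, ⟨Or.inl rfl, h⟩, h⟩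
      · exact ⟨A₁ᶜ, ⟨Or.inr rfl, h⟩, h⟩
    have : {B : Set S | B ∈ ({A₂, A₂ᶜ} : Set (Set S)) ∧ s ∈ B} = {A} := by
      ext B; constructor
      · rintro ⟨hB, hsB⟩
        rcases hA with rfl | rfl <;> rcases hB with rfl | rfl
        · rfl
        · exact absurd hs hsB
        · exact absurd hsB hs
        · rfl
      · rintro rfl; exact ⟨hA, hs⟩
    simp only [this, sUnion_singleton]

theorem mem_principal_half {S : Type*} (P : Set (Wall S)) (s : S) (h : P) :
    s ∈ (principal P s).half h := by
  obtain ⟨⟨_, A, rfl⟩, _⟩ := h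
  by_cases hs : s ∈ A
  · exact ⟨A, ⟨Or.inl rfl, hs⟩, hs⟩
  · exact ⟨Aᶜ, ⟨Or.inr rfl, hs⟩, hs⟩

/-- The extended distance `d_𝒞(x, y)`: the supremum of the cardinalities of the elements `c` of `𝒞`
all of whose walls separate `x` from `y`. -/
noncomputable def wallDist {S : Type*} {P : Set (Wall S)} (𝒞 : Set (Set P))
    (x y : WallUltrafilter P) : ℕ∞ :=
  ⨆ c ∈ {c ∈ 𝒞 | ∀ h ∈ c, x.half h ≠ y.half h}, c.encard

/-- The extended distance `∑_{R ≥ 1} λ_R d_{𝒞_R}(x, y)`. -/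
noncomputable def gradedEDist {S : Type*} {P : Set (Wall S)} (𝒞 : ℕ+ → Set (Set P))
    (lam : ℕ+ → ℝ≥0) (x y : WallUltrafilter P) : ℝ≥0∞ :=
  ∑' R : ℕ+, (lam R : ℝ≥0∞) * (wallDist (𝒞 R) x y : ℝ≥0∞)

section generic

variable {S : Type*} {P : Set (Wall S)}

theorem wallDist_self (𝒞 : Set (Set P)) (x : WallUltrafilter P) : wallDist 𝒞 x x = 0 := by
  rw [wallDist, ← nonpos_iff_eq_zero]
  refine iSup₂_le fun c hc => ?_
  have : c = ∅ := by
    ext h; simp only [mem_empty_iff_false, iff_false]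
    exact fun hh => hc.2 h hh rfl
  simp [this]

theorem wallDist_comm (𝒞 : Set (Set P)) (x y : WallUltrafilter P) :
    wallDist 𝒞 x y = wallDist 𝒞 y x := by
  simp only [wallDist, ne_comm]

theorem wallDist_triangle {𝒞 : Set (Set P)} (h𝒞 : ∀ c ∈ 𝒞, ∀ b ⊆ c, b ∈ 𝒞)
    (x y z : WallUltrafilter P) : wallDist 𝒞 x z ≤ wallDist 𝒞 x y + wallDist 𝒞 y z := by
  conv_lhs => rw [wallDist]
  refine iSup₂_le fun c hc => ?_
  have hsub : c ⊆ {h ∈ c | x.half h ≠ y.half h} ∪ {h ∈ c | y.half h ≠ z.half h} := by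
    intro h hh
    by_cases hxy : x.half h = y.half h
    · exact Or.inr ⟨hh, fun hyz => hc.2 h hh (hxy.trans hyz)⟩
    · exact Or.inl ⟨hh, hxy⟩
  refine (encard_le_encard hsub).trans ((encard_union_le _ _).trans (add_le_add ?_ ?_))
  · exact le_iSup₂_of_le (f := fun (c : Set P) (_ : c ∈ {c ∈ 𝒞 | ∀ h ∈ c, x.half h ≠ y.half h}) =>
      c.encard) _ ⟨h𝒞 c hc.1 _ (sep_subset _ _), fun h hh => hh.2⟩ le_rfl
  · exact le_iSup₂_of_le (f := fun (c : Set P) (_ : c ∈ {c ∈ 𝒞 | ∀ h ∈ c, y.half h ≠ z.half h}) =>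
      c.encard) _ ⟨h𝒞 c hc.1 _ (sep_subset _ _), fun h hh => hh.2⟩ le_rfl

theorem wallDist_ne_zero {𝒞 : Set (Set P)} (h𝒞 : ∀ h : P, {h} ∈ 𝒞)
    {x y : WallUltrafilter P} (hxy : wallDist 𝒞 x y = 0) : x = y := by
  ext1
  funext h
  by_contra hne
  have : ({h} : Set P).encard ≤ wallDist 𝒞 x y :=
    le_iSup₂_of_le (f := fun (c : Set P) (_ : c ∈ {c ∈ 𝒞 | ∀ h ∈ c, x.half h ≠ y.half h}) =>
      c.encard) {h} ⟨h𝒞 h, fun h' hh' => by rw [mem_singleton_iff.1 hh']; exact hne⟩ le_rfl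
  simp [hxy] at this

end generic

/-! ### The universal space -/

section universal

variable (S : Type*) [MetricSpace S]

/-- The set `P` of walls induced by curtains: the curtain `h` induces `{h⁻, h ∪ h⁺}` and
`{h⁻ ∪ h, h⁺}`. -/
def curtainWalls : Set (Wall S) :=
  {h | ∃ c : Curtain S, h = Wall.of c.neg ∨ h = Wall.of (c.neg ∪ c.body)}

/-- The system `𝒞_R`: all chains of walls that are induced, wall by wall, by a chain of pairwise
`R`-ball-separated curtains. The negative halfspace of the `i`-th wall is `m i`. Chains are indexed
by subsets of `ℤ`; every such subset is order isomorphic to an interval of `ℤ`. -/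
def ballSystem (R : ℕ) : Set (Set (curtainWalls S)) :=
  {c | ∃ (J : Set ℤ) (h : J → Curtain S) (m : J → Set S),
    (∀ i, m i = (h i).neg ∨ m i = (h i).neg ∪ (h i).body) ∧
    (∀ i j, i < j → m i ⊆ m j) ∧
    (∀ i j, i < j → Curtain.BallSeparated R (h i) (h j)) ∧
    Subtype.val '' c = range fun i => Wall.of (m i)}

end universal

/-- A sequence `(λ_R)` of positive weights with `∑ R λ_R < ∞`. -/
structure Weights where
  lam : ℕ+ → ℝ≥0
  lam_pos : ∀ R, 0 < lam R
  summable : Summable fun R : ℕ+ => lam R * ((R : ℕ) : ℝ≥0)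

/-- The graded dual of `S` as a set: the ultrafilters at finite distance from all of `S`. -/
def GradedDual (S : Type*) [MetricSpace S] (w : Weights) : Type _ :=
  {x : WallUltrafilter (curtainWalls S) //
    ∀ s : S, gradedEDist (fun R => ballSystem S R) w.lam (principal _ s) x < ⊤}

/-! The rest of this section equips the graded dual with its metric and constructs the natural map
from `S`. -/

section facts

variable {S : Type*} [MetricSpace S]

theorem ballSystem_subset {R : ℕ} {c : Set (curtainWalls S)} (hc : c ∈ ballSystem S R)
    {b : Set (curtainWalls S)} (hb : b ⊆ c) : b ∈ ballSystem S R := by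
  obtain ⟨J, h, m, hm, hch, hsep, hr⟩ := hc
  have hJ : ∀ i : {n : ℤ | ∃ hn : n ∈ J, Wall.of (m ⟨n, hn⟩) ∈ Subtype.val '' b}, i.1 ∈ J :=
    fun i => i.2.choose
  refine ⟨{n : ℤ | ∃ hn : n ∈ J, Wall.of (m ⟨n, hn⟩) ∈ Subtype.val '' b},
    fun i => h ⟨i.1, hJ i⟩, fun i => m ⟨i.1, hJ i⟩, fun i => hm _,
    fun i j hij => hch _ _ hij, fun i j hij => hsep _ _ hij, ?_⟩
  ext k
  constructor
  · intro hk
    have : k ∈ Subtype.val '' c := image_mono hb hk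
    rw [hr] at this
    obtain ⟨i, rfl⟩ := this
    exact ⟨⟨i.1, i.2, hk⟩, rfl⟩
  · rintro ⟨⟨n, hn, hk⟩, rfl⟩
    exact hk

theorem singleton_mem_ballSystem (R : ℕ) (k : curtainWalls S) : {k} ∈ ballSystem S R := by
  obtain ⟨k, c, hk⟩ := k
  have hsub : ∀ i j : ({0} : Set ℤ), ¬ i < j := by
    rintro ⟨i, rfl⟩ ⟨j, rfl⟩ h
    exact lt_irrefl _ h
  have : ∃ m : Set S, (m = c.neg ∨ m = c.neg ∪ c.body) ∧ k = Wall.of m := by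
    rcases hk with hk | hk
    · exact ⟨_, Or.inl rfl, hk⟩
    · exact ⟨_, Or.inr rfl, hk⟩
  obtain ⟨m, hm, rfl⟩ := this
  refine ⟨{0}, fun _ => c, fun _ => m, fun _ => hm, fun i j hij => absurd hij (hsub i j),
    fun i j hij => absurd hij (hsub i j), ?_⟩
  simp

theorem gradedEDist_self (w : Weights) (x : WallUltrafilter (curtainWalls S)) :
    gradedEDist (fun R => ballSystem S R) w.lam x x = 0 := by
  simp [gradedEDist, wallDist_self]

theorem gradedEDist_comm (w : Weights) (x y : WallUltrafilter (curtainWalls S)) :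
    gradedEDist (fun R => ballSystem S R) w.lam x y =
      gradedEDist (fun R => ballSystem S R) w.lam y x := by
  simp only [gradedEDist, wallDist_comm]

theorem gradedEDist_triangle (w : Weights) (x y z : WallUltrafilter (curtainWalls S)) :
    gradedEDist (fun R => ballSystem S R) w.lam x z ≤
      gradedEDist (fun R => ballSystem S R) w.lam x y +
        gradedEDist (fun R => ballSystem S R) w.lam y z := by
  rw [gradedEDist, gradedEDist, gradedEDist, ← ENNReal.tsum_add]
  refine ENNReal.tsum_le_tsum fun R => ?_
  rw [← mul_add, ← ENat.toENNReal_add]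
  gcongr
  exact wallDist_triangle (fun c hc b hb => ballSystem_subset hc hb) x y z

theorem eq_of_gradedEDist_eq_zero (w : Weights) {x y : WallUltrafilter (curtainWalls S)}
    (h : gradedEDist (fun R => ballSystem S R) w.lam x y = 0) : x = y := by
  rw [gradedEDist, ENNReal.tsum_eq_zero] at h
  rcases mul_eq_zero.1 (h 1) with h | h
  · exact absurd h (by simpa using (w.lam_pos 1).ne')
  · exact wallDist_ne_zero (singleton_mem_ballSystem _) (by simpa using h)

theorem gradedEDist_ne_top (w : Weights) (x y : GradedDual S w) :
    gradedEDist (fun R => ballSystem S R) w.lam x.1 y.1 ≠ ⊤ := by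
  rcases isEmpty_or_nonempty S with hS | ⟨⟨s⟩⟩
  · have : x.1 = y.1 := by
      ext1
      funext ⟨k, c, _⟩
      exact hS.elim (c.γ 0)
    rw [this, gradedEDist_self]
    exact ENNReal.zero_ne_top
  · refine ne_top_of_le_ne_top ?_ (gradedEDist_triangle w x.1 (principal _ s) y.1)
    rw [gradedEDist_comm w x.1]
    exact ENNReal.add_ne_top.2 ⟨(x.2 s).ne, (y.2 s).ne⟩

/-- The metric `∑ λ_R d_{𝒞_R}` on the graded dual. -/
noncomputable instance (w : Weights) : MetricSpace (GradedDual S w) :=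
  letI : EMetricSpace (GradedDual S w) :=
    { edist := fun x y => gradedEDist (fun R => ballSystem S R) w.lam x.1 y.1
      edist_self := fun x => gradedEDist_self w x.1
      edist_comm := fun x y => gradedEDist_comm w x.1 y.1
      edist_triangle := fun x y z => gradedEDist_triangle w x.1 y.1 z.1
      eq_of_edist_eq_zero := fun h => Subtype.ext (eq_of_gradedEDist_eq_zero w h) }
  EMetricSpace.toMetricSpace (gradedEDist_ne_top w)

theorem dist_gradedDual (w : Weights) (x y : GradedDual S w) :
    dist x y = (gradedEDist (fun R => ballSystem S R) w.lam x.1 y.1).toReal := rfl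

theorem Curtain.one_le_dist (c : Curtain S) {x y : S} (hx : x ∈ c.neg) (hy : y ∈ c.pos) :
    1 ≤ dist x y := by
  obtain ⟨p, hp, tp, htp, rfl⟩ := hx
  obtain ⟨q, hq, tq, htq, rfl⟩ := hy
  have hD := c.one_le_D
  have ha := c.a_pos
  have ha' := c.a_lt
  have hpq : 10 * c.D ≤ dist (c.γ tp) (c.γ tq) := by
    rw [c.geodesic.2 tp ⟨htp.1, by linarith [htp.2]⟩ tq ⟨by linarith [htq.1], htq.2⟩,
      abs_sub_comm]
    exact le_trans (by linarith [htp.2, htq.1]) (le_abs_self _)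
  have key : ∀ (u v : S) (tu tv : ℝ), c.γ tu ∈ closestPoints c.axis u →
      c.γ tv ∈ closestPoints c.axis v → 10 * c.D ≤ dist (c.γ tu) (c.γ tv) →
      dist u (c.γ tu) ≤ dist u v := by
    intro u v tu tv hu hv huv
    by_contra! hlt
    have hdisj : Disjoint (ball u (dist u (c.γ tu))) (c.γ '' Icc 0 (20 * c.D)) := by
      rw [Set.disjoint_left]
      intro z hz hz'
      exact absurd (hu.2 z hz') (by rw [mem_ball'] at hz; exact not_le.2 hz)
    have h1 := c.contracting u _ hdisj
    have hmem : ∀ v' ∈ ball u (dist u (c.γ tu)), ∀ z ∈ closestPoints c.axis v',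
        z ∈ ⋃ y ∈ ball u (dist u (c.γ tu)), closestPoints (c.γ '' Icc 0 (20 * c.D)) y :=
      fun v' hv' z hz => mem_iUnion₂.2 ⟨v', hv', hz⟩
    have h2 := edist_le_ediam_of_mem
      (hmem u (mem_ball_self (dist_nonneg.trans_lt hlt)) _ hu)
      (hmem v (mem_ball'.2 hlt) _ hv)
    have h3 := h2.trans_lt h1
    rw [edist_dist, ENNReal.ofReal_lt_ofReal_iff (by linarith)] at h3
    linarith
  have k1 := key x y tp tq hp hq hpq
  have k2 := key y x tq tp hq hp (by rwa [dist_comm])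
  have := dist_triangle4 (c.γ tp) x y (c.γ tq)
  rw [dist_comm (c.γ tp) x] at this
  rw [dist_comm y x] at k2
  linarith

theorem Curtain.not_mem_neg (c : Curtain S) {x : S} (hx : x ∈ c.body) : x ∉ c.neg := by
  rintro ⟨p, hp, t, ht, rfl⟩
  obtain ⟨t', ht', he⟩ := hx hp
  have hD := c.one_le_D
  have ha' := c.a_lt
  have ha := c.a_pos
  have := c.geodesic.2 t' ⟨by linarith [ht'.1], by linarith [ht'.2]⟩ t
    ⟨ht.1, by linarith [ht.2]⟩
  rw [he, dist_self, eq_comm, abs_eq_zero] at this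
  linarith [ht.2, ht'.1]

theorem Curtain.not_mem_pos (c : Curtain S) {x : S} (hx : x ∈ c.body) : x ∉ c.pos := by
  rintro ⟨p, hp, t, ht, rfl⟩
  obtain ⟨t', ht', he⟩ := hx hp
  have hD := c.one_le_D
  have ha' := c.a_lt
  have ha := c.a_pos
  have := c.geodesic.2 t' ⟨by linarith [ht'.1], by linarith [ht'.2]⟩ t
    ⟨by linarith [ht.1], ht.2⟩
  rw [he, dist_self, eq_comm, abs_eq_zero] at this
  linarith [ht.1, ht'.2]

theorem Curtain.cover (c : Curtain S) (x : S) : x ∈ c.neg ∨ x ∈ c.body ∨ x ∈ c.pos := by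
  by_cases hb : x ∈ c.body
  · exact Or.inr (Or.inl hb)
  · obtain ⟨p, hp, hpI⟩ := not_subset.1 hb
    obtain ⟨t, ht, rfl⟩ := hp.1
    by_cases h1 : t < c.a
    · exact Or.inl ⟨_, hp, t, ⟨ht.1, h1⟩, rfl⟩
    · refine Or.inr (Or.inr ⟨_, hp, t, ⟨?_, ht.2⟩, rfl⟩)
      by_contra! h2
      exact hpI ⟨t, ⟨not_lt.1 h1, h2⟩, rfl⟩

/-- A geodesic from the negative to the positive halfspace of a curtain meets the curtain. -/
theorem Curtain.exists_mem_body (c : Curtain S) {β : ℝ → S} {ℓ : ℝ}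
    (hβ : IsGeodesicSegment β ℓ) (h0 : β 0 ∈ c.neg) (h1 : β ℓ ∈ c.pos) :
    ∃ t ∈ Icc 0 ℓ, β t ∈ c.body := by
  set U : Set ℝ := {t | t ∈ Icc 0 ℓ ∧ β t ∈ c.neg} with hU
  have hne : U.Nonempty := ⟨0, ⟨le_rfl, hβ.1⟩, h0⟩
  have hbdd : BddAbove U := ⟨ℓ, fun t ht => ht.1.2⟩
  obtain ⟨u, hu, hlt⟩ := exists_lt_of_lt_csSup hne (show sSup U - 1 / 4 < sSup U by linarith)
  have hule : u ≤ sSup U := le_csSup hbdd hu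
  have hl := c.one_le_dist hu.2 h1
  rw [hβ.2 u hu.1 ℓ ⟨hβ.1, le_rfl⟩, abs_sub_comm, abs_of_nonneg (by linarith [hu.1.2])] at hl
  have htI : u + 1 / 2 ∈ Icc 0 ℓ := ⟨by linarith [hu.1.1], by linarith⟩
  refine ⟨u + 1 / 2, htI, ?_⟩
  rcases c.cover (β (u + 1 / 2)) with h | h | h
  · have := le_csSup hbdd (show u + 1 / 2 ∈ U from ⟨htI, h⟩)
    linarith
  · exact h
  · have := c.one_le_dist hu.2 h
    rw [hβ.2 u hu.1 _ htI, abs_sub_comm, abs_of_nonneg (by linarith)] at this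
    linarith

theorem card_le_of_separating [GeodesicSpace S] {R : ℕ} {J : Set ℤ} {h : J → Curtain S}
    (hsep : ∀ i j, i < j → Curtain.BallSeparated R (h i) (h j)) (s t : S) (F : Finset J)
    (hs : ∀ i ∈ F, s ∈ (h i).neg) (ht : ∀ i ∈ F, t ∈ (h i).pos) :
    ∃ ℓ : ℝ, 0 ≤ ℓ ∧ ℓ = dist s t ∧ F.card ≤ 2 * (⌊ℓ⌋₊ + 1) := by
  classical
  obtain ⟨β, ℓ, hβ, rfl, rfl⟩ := GeodesicSpace.exists_geodesic s t
  refine ⟨ℓ, hβ.1, ?_, ?_⟩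
  · rw [hβ.2 0 ⟨le_rfl, hβ.1⟩ ℓ ⟨hβ.1, le_rfl⟩, zero_sub, abs_neg, abs_of_nonneg hβ.1]
  have hτ : ∀ i : J, ∃ τ, i ∈ F → τ ∈ Icc 0 ℓ ∧ β τ ∈ (h i).body := by
    intro i
    by_cases hi : i ∈ F
    · obtain ⟨τ, h1, h2⟩ := (h i).exists_mem_body hβ (hs i hi) (ht i hi)
      exact ⟨τ, fun _ => ⟨h1, h2⟩⟩
    · exact ⟨0, fun h => absurd h hi⟩
  choose τ hτ using hτ
  have hfib : ∀ b ∈ F.image (fun i => ⌊τ i⌋₊), (F.filter fun i => ⌊τ i⌋₊ = b).card ≤ 2 := by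
    intro b _
    by_contra! hcard
    set G := F.filter fun i => ⌊τ i⌋₊ = b with hG
    have hmono := (G.orderEmbOfFin rfl).strictMono
    have hmem : ∀ k : Fin G.card, G.orderEmbOfFin rfl k ∈ G := fun k =>
      Finset.orderEmbOfFin_mem _ _ _
    set i := G.orderEmbOfFin rfl ⟨0, by omega⟩ with hi
    set j := G.orderEmbOfFin rfl ⟨1, by omega⟩ with hj
    set k := G.orderEmbOfFin rfl ⟨2, by omega⟩ with hk
    have hij : i < j := hmono (by simp)
    have hjk : j < k := hmono (by simp)
    have hiG := Finset.mem_filter.1 (hmem ⟨0, by omega⟩)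
    have hkG := Finset.mem_filter.1 (hmem ⟨2, by omega⟩)
    rw [← hi] at hiG
    rw [← hk] at hkG
    have hi' := hτ i hiG.1
    have hk' := hτ k hkG.1
    have h1 : β (τ i) ∈ (h j).neg := (hsep i j hij).1 hi'.2
    have h2 : β (τ k) ∈ (h j).pos := (hsep j k hjk).2.1 hk'.2
    have h3 := (h j).one_le_dist h1 h2
    rw [hβ.2 _ hi'.1 _ hk'.1] at h3
    have e1 := (Nat.floor_eq_iff hi'.1.1).1 hiG.2
    have e2 := (Nat.floor_eq_iff hk'.1.1).1 hkG.2
    have : |τ i - τ k| < 1 := by rw [abs_lt]; constructor <;> linarith [e1.1, e1.2, e2.1, e2.2]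
    linarith
  refine (Finset.card_le_mul_card_image F 2 hfib).trans (Nat.mul_le_mul_left 2 ?_)
  have : F.image (fun i => ⌊τ i⌋₊) ⊆ Finset.range (⌊ℓ⌋₊ + 1) := by
    intro b hb
    obtain ⟨i, hi, rfl⟩ := Finset.mem_image.1 hb
    rw [Finset.mem_range, Nat.lt_succ_iff]
    exact Nat.floor_le_floor (hτ i hi).1.2
  simpa using Finset.card_le_card this

/-- An oriented version of the finiteness of `d_{𝒞_R}` on `S`. -/
theorem card_le_of_chain [GeodesicSpace S] {R : ℕ} {J : Set ℤ} {h : J → Curtain S}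
    {m : J → Set S} (hm : ∀ i, m i = (h i).neg ∨ m i = (h i).neg ∪ (h i).body)
    (hsep : ∀ i j, i < j → Curtain.BallSeparated R (h i) (h j)) (s t : S) (F : Finset J)
    (hs : ∀ i ∈ F, s ∈ m i) (ht : ∀ i ∈ F, t ∉ m i) :
    F.card ≤ 2 * (⌊dist s t⌋₊ + 1) + 2 := by
  classical
  have hdisj : ∀ (x : S) (i j : J), x ∈ (h i).body → x ∈ (h j).body → i = j := by
    intro x i j hi hj
    by_contra hne
    rcases lt_or_gt_of_ne hne with hij | hij
    · exact (h j).not_mem_neg hj ((hsep i j hij).1 hi)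
    · exact (h i).not_mem_neg hi ((hsep j i hij).1 hj)
  have hb : ∀ x : S, (F.filter fun i => x ∈ (h i).body).card ≤ 1 := by
    intro x
    rw [Finset.card_le_one]
    intro i hi j hj
    exact hdisj x i j (Finset.mem_filter.1 hi).2 (Finset.mem_filter.1 hj).2
  set G := F.filter fun i => s ∈ (h i).neg ∧ t ∈ (h i).pos with hG
  have hF : F ⊆ G ∪ ((F.filter fun i => s ∈ (h i).body) ∪ F.filter fun i => t ∈ (h i).body) := by
    intro i hi
    simp only [Finset.mem_union, Finset.mem_filter, hG, hi, true_and]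
    have h1 : s ∈ (h i).neg ∨ s ∈ (h i).body := by
      have := hs i hi
      rcases hm i with e | e <;> rw [e] at this
      · exact Or.inl this
      · exact this
    have h2 : t ∈ (h i).body ∨ t ∈ (h i).pos := by
      have := ht i hi
      rcases (h i).cover t with h' | h'
      · exact absurd (show t ∈ m i by rcases hm i with e | e <;> rw [e] <;> simp [h']) this
      · exact h'
    tauto
  obtain ⟨ℓ, -, rfl, hcard⟩ := card_le_of_separating hsep s t G
    (fun i hi => (Finset.mem_filter.1 hi).2.1) (fun i hi => (Finset.mem_filter.1 hi).2.2)
  have h1 := Finset.card_le_card hF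
  have h2 := Finset.card_union_le G
    ((F.filter fun i => s ∈ (h i).body) ∪ F.filter fun i => t ∈ (h i).body)
  have h3 := Finset.card_union_le (F.filter fun i => s ∈ (h i).body)
    (F.filter fun i => t ∈ (h i).body)
  have h4 := hb s
  have h5 := hb t
  omega

theorem mem_iff_of_principal_half_ne {S : Type*} {P : Set (Wall S)} {s t : S} {k : P} {A : Set S}
    (hk : k.1 = Wall.of A) (hne : (principal P s).half k ≠ (principal P t).half k) :
    (s ∈ A ∧ t ∉ A) ∨ (s ∉ A ∧ t ∈ A) := by
  have hs := mem_principal_half P s k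
  have ht := mem_principal_half P t k
  have hs' := (principal P s).half_mem k
  have ht' := (principal P t).half_mem k
  rw [hk] at hs' ht'
  rcases hs' with e | e <;> rcases ht' with e' | e'
  · exact absurd (e.trans e'.symm) hne
  · rw [e] at hs; rw [e'] at ht; exact Or.inl ⟨hs, ht⟩
  · rw [e] at hs; rw [e'] at ht; exact Or.inr ⟨hs, ht⟩
  · exact absurd (e.trans e'.symm) hne

theorem wallDist_principal_le [GeodesicSpace S] (R : ℕ) (s t : S) :
    wallDist (ballSystem S R) (principal _ s) (principal _ t) ≤
      ((2 * (⌊dist s t⌋₊ + 1) + 2 : ℕ) : ℕ∞) := by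
  classical
  refine iSup₂_le fun c hc => ?_
  obtain ⟨⟨J, h, m, hm, hch, hsep, hr⟩, hc⟩ := hc
  by_contra! hlt
  obtain ⟨c', hc', hcard⟩ := exists_subset_encard_eq (Order.add_one_le_of_lt hlt)
  have hidx : ∀ k : c', ∃ i : J, Wall.of (m i) = k.1.1 := by
    rintro ⟨k, hk⟩
    have : k.1 ∈ range fun i => Wall.of (m i) := hr ▸ ⟨k, hc' hk, rfl⟩
    exact this
  choose σ hσ using hidx
  have hσinj : Function.Injective σ := by
    intro k k' hkk
    apply Subtype.ext
    apply Subtype.ext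
    rw [← hσ, ← hσ, hkk]
  have hfin : c'.Finite := by
    rw [← encard_lt_top_iff, hcard]
    exact_mod_cast ENat.natCast_lt_top _
  have := hfin.fintype
  set F : Finset J := Finset.univ.image σ with hF
  have hFcard : F.card = 2 * (⌊dist s t⌋₊ + 1) + 2 + 1 := by
    rw [hF, Finset.card_image_of_injective _ hσinj, Finset.card_univ]
    have : (Fintype.card c' : ℕ∞) = c'.encard := by
      rw [← Set.toFinset_card, Set.encard_eq_coe_toFinset_card]
    rw [hcard] at this
    exact_mod_cast this
  have hsepF : ∀ i ∈ F, (s ∈ m i ∧ t ∉ m i) ∨ (s ∉ m i ∧ t ∈ m i) := by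
    intro i hi
    obtain ⟨k, -, rfl⟩ := Finset.mem_image.1 hi
    exact mem_iff_of_principal_half_ne (hσ k).symm (hc k.1 (hc' k.2))
  have hcons : ∀ i ∈ F, ∀ j ∈ F, s ∈ m i → t ∉ m i → ¬ (s ∉ m j ∧ t ∈ m j) := by
    rintro i hi j hj hsi hti ⟨hsj, htj⟩
    rcases lt_trichotomy i j with hij | rfl | hij
    · exact hsj (hch i j hij hsi)
    · exact hsj hsi
    · exact hti (hch j i hij htj)
  by_cases hall : ∀ i ∈ F, s ∈ m i ∧ t ∉ m i
  · have := card_le_of_chain hm hsep s t F (fun i hi => (hall i hi).1) fun i hi => (hall i hi).2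
    omega
  · push Not at hall
    obtain ⟨j, hj, hj'⟩ := hall
    have hj2 : s ∉ m j ∧ t ∈ m j := by
      rcases hsepF j hj with h' | h'
      · exact absurd (hj' h'.1) h'.2
      · exact h'
    have hall : ∀ i ∈ F, s ∉ m i ∧ t ∈ m i := by
      intro i hi
      rcases hsepF i hi with h' | h'
      · exact absurd hj2 (hcons i hi j hj h'.1 h'.2)
      · exact h'
    have := card_le_of_chain hm hsep t s F (fun i hi => (hall i hi).2) fun i hi => (hall i hi).1
    rw [dist_comm] at this
    omega

theorem gradedEDist_principal_lt_top [GeodesicSpace S] (w : Weights) (s t : S) :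
    gradedEDist (fun R => ballSystem S R) w.lam (principal _ s) (principal _ t) < ⊤ := by
  have h1 : Summable w.lam := by
    refine NNReal.summable_of_le (fun R => ?_) w.summable
    have : (1 : ℝ≥0) ≤ ((R : ℕ) : ℝ≥0) := by exact_mod_cast R.pos
    exact le_mul_of_one_le_right zero_le this
  have h2 : gradedEDist (fun R => ballSystem S R) w.lam (principal _ s) (principal _ t) ≤
      ∑' R : ℕ+, (w.lam R : ℝ≥0∞) * ((2 * (⌊dist s t⌋₊ + 1) + 2 : ℕ) : ℝ≥0∞) := by
    refine ENNReal.tsum_le_tsum fun R => ?_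
    gcongr
    have := ENat.toENNReal_le.2 (wallDist_principal_le R s t)
    simpa using this
  refine h2.trans_lt ?_
  rw [ENNReal.tsum_mul_right]
  exact ENNReal.mul_lt_top (ENNReal.tsum_coe_ne_top_iff_summable.2 h1).lt_top
    (ENNReal.natCast_lt_top _)

end facts

/-- The natural map `S → X`, `s ↦ φ_s`. -/
def toGradedDual {S : Type*} [MetricSpace S] [GeodesicSpace S] (w : Weights) (s : S) :
    GradedDual S w :=
  ⟨principal _ s, fun t => gradedEDist_principal_lt_top w t s⟩

end CurtainDual

open CurtainDual

namespace CurtainDual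

variable {S : Type*} [MetricSpace S]

/-! ### Geodesic segments -/

/-! Two facts about chains of curtains in `S` carry the argument. A chain of `n` curtains forces
distance at least `n`, because geodesics meet its gaps one after the other
(`IsCurtainChain.le_dist`). And long chains cannot cross a ball-separated pair
(`IsCurtainChain.le_of_quadrants`): if all four quadrants formed by an `R'`-ball-separated pair and
an `R`-chain are inhabited, then geodesics on both sides of the chain pass through one ball of
radius `R'`, which bounds the length of the chain linearly in `R` and `R'`. Any two halfspaces
chosen by an ultrafilter intersect, so ultrafilters inhabit quadrants just as points do, and both
facts apply to `X`.

Hyperbolicity. Let `overlap x y z` be the weighted size of the chains that separate `x` from both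
`y` and `z`. By the crossing bound, a chain separating `x` from `{y, z}` and one separating `y` from
`{x, z}` become nested once O(R) curtains are discarded, and then concatenate
(`chainSize_sepBoth_add_le`). So overlaps are Gromov products up to an error ∑ λ_R O(R), which is
where ∑ R λ_R < ∞ enters. The crossing bound also shows that only one of two transverse partitions
`{x, v} | {y, z}` and `{x, y} | {v, z}` can have long chains (`chainSize_sepPair_le`); this is
Gromov's inequality for overlaps.

Rough geodesics. The gates of `x` in the balls of radius `n` about `t ∈ S` start at φ_t, move by
bounded steps, come boundedly close to `x`, and lie between φ_t and `x` in the sense of walls. By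
the gluing estimate they trace a rough geodesic; hyperbolicity then joins arbitrary pairs of points.

Contracting quasigeodesics embed. A geodesic between two points of a contracting quasigeodesic has
uniformly contracting subsegments (`IsTrackedBy.isStronglyContracting_image`). Curtains dual to
evenly spaced subsegments form an `R`-chain for a uniform `R`, and the single weight λ_R gives the
lower bound; the upper bound is the coarse Lipschitz property.

Conversely, the tail of ∑ λ_R is small, so linear growth in `X` must be visible at one scale `R`. If
closest points `α i`, `α j` of `x`, `y` are far apart, the chain separating them has many more
curtains than a path along `α` with long steps has steps. Some step then crosses two consecutive
curtains at once, which pins their separating ball near `α`. Geodesics crossing there must come near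
`α`, whence `d(x, α i) ≤ d(x, y)` (`IsCurtainChain.dist_le_of_path`). -/

theorem IsGeodesicSegment.dist_endpoints {γ : ℝ → S} {ℓ : ℝ} (h : IsGeodesicSegment γ ℓ) :
    dist (γ 0) (γ ℓ) = ℓ := by
  rw [h.2 0 ⟨le_rfl, h.1⟩ ℓ ⟨h.1, le_rfl⟩, zero_sub, abs_neg, abs_of_nonneg h.1]

theorem IsGeodesicSegment.dist_eq {γ : ℝ → S} {ℓ s t : ℝ} (h : IsGeodesicSegment γ ℓ)
    (hs : 0 ≤ s) (hst : s ≤ t) (ht : t ≤ ℓ) : dist (γ s) (γ t) = t - s := by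
  rw [h.2 s ⟨hs, hst.trans ht⟩ t ⟨hs.trans hst, ht⟩, abs_sub_comm, abs_of_nonneg (by linarith)]

theorem IsGeodesicSegment.reverse {γ : ℝ → S} {ℓ : ℝ} (h : IsGeodesicSegment γ ℓ) :
    IsGeodesicSegment (fun t => γ (ℓ - t)) ℓ := by
  refine ⟨h.1, fun s hs t ht => ?_⟩
  rw [h.2 _ ⟨by linarith [hs.2], by linarith [hs.1]⟩ _ ⟨by linarith [ht.2], by linarith [ht.1]⟩,
    abs_sub_comm]
  congr 1
  ring

theorem IsGeodesicSegment.subsegment {γ : ℝ → S} {ℓ a b : ℝ} (h : IsGeodesicSegment γ ℓ)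
    (ha : 0 ≤ a) (hab : a ≤ b) (hb : b ≤ ℓ) : IsGeodesicSegment (fun t => γ (a + t)) (b - a) := by
  refine ⟨by linarith, fun s hs t ht => ?_⟩
  rw [h.2 _ ⟨by linarith [hs.1], by linarith [hs.2]⟩ _ ⟨by linarith [ht.1], by linarith [ht.2]⟩]
  congr 1
  ring

theorem IsGeodesicSegment.continuousOn {γ : ℝ → S} {ℓ : ℝ} (h : IsGeodesicSegment γ ℓ) :
    ContinuousOn γ (Icc 0 ℓ) := by
  refine LipschitzOnWith.continuousOn (K := 1) (LipschitzOnWith.of_dist_le_mul fun s hs t ht => ?_)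
  rw [h.2 s hs t ht, Real.dist_eq]
  simp

theorem IsGeodesicSegment.isCompact_image {γ : ℝ → S} {ℓ a b : ℝ} (h : IsGeodesicSegment γ ℓ)
    (ha : 0 ≤ a) (hb : b ≤ ℓ) : IsCompact (γ '' Icc a b) :=
  isCompact_Icc.image_of_continuousOn (h.continuousOn.mono (Icc_subset_Icc ha hb))

theorem closestPoints_nonempty {A : Set S} (hA : IsCompact A) (hne : A.Nonempty) (x : S) :
    (closestPoints A x).Nonempty := by
  obtain ⟨p, hp, hmin⟩ := hA.exists_isMinOn hne (f := fun p => dist x p)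
    (by fun_prop)
  exact ⟨p, hp, fun p' hp' => hmin hp'⟩

theorem closestPoints_self {A : Set S} {x : S} (hx : x ∈ A) : closestPoints A x = {x} := by
  ext p
  constructor
  · rintro ⟨-, h⟩
    have := h x hx
    rw [dist_self] at this
    exact (dist_le_zero.1 this).symm
  · rintro rfl
    exact ⟨hx, fun p' _ => by rw [dist_self]; exact dist_nonneg⟩

/-- Closest points to two points that are closer to each other than to a strongly contracting
set. -/
theorem IsStronglyContracting.dist_lt {A : Set S} {D : ℝ} (hA : IsStronglyContracting D A)
    {x y p q : S} (hp : p ∈ closestPoints A x) (hq : q ∈ closestPoints A y)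
    (hxy : dist x y < dist x p) : dist p q < D := by
  have hdisj : Disjoint (ball x (dist x p)) A := by
    rw [Set.disjoint_left]
    intro z hz hz'
    exact absurd (hp.2 z hz') (by rw [mem_ball'] at hz; exact not_le.2 hz)
  have h1 := hA x _ hdisj
  have h2 := edist_le_ediam_of_mem
    (mem_iUnion₂.2 ⟨x, mem_ball_self (dist_nonneg.trans_lt hxy), hp⟩ :
      p ∈ ⋃ y ∈ ball x (dist x p), closestPoints A y)
    (mem_iUnion₂.2 ⟨y, mem_ball'.2 hxy, hq⟩)
  have h3 := h2.trans_lt h1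
  rw [edist_dist] at h3
  exact (ENNReal.ofReal_lt_ofReal_iff_of_nonneg dist_nonneg).1 h3

/-- It suffices to compare with a closest point of the centre of the ball: any two projections are
then within `2 * E`, and the added 1 makes the inequality strict. -/
theorem isStronglyContracting_of_dist_le {A : Set S} {E : ℝ} (hE : 0 ≤ E)
    (hne : ∀ x, (closestPoints A x).Nonempty)
    (h : ∀ x y p q : S, p ∈ closestPoints A x → q ∈ closestPoints A y → dist x y < dist x p →
      dist p q ≤ E) : IsStronglyContracting (2 * E + 1) A := by
  intro x r hdisj
  obtain ⟨p, hp⟩ := hne x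
  have hr : r ≤ dist x p := by
    by_contra! hlt
    exact Set.disjoint_left.1 hdisj (mem_ball'.2 hlt) hp.1
  refine lt_of_le_of_lt (ediam_le fun q hq q' hq' => ?_)
    (b := ENNReal.ofReal (2 * E)) ((ENNReal.ofReal_lt_ofReal_iff (by linarith)).2 (by linarith))
  obtain ⟨y, hy, hq⟩ := mem_iUnion₂.1 hq
  obtain ⟨y', hy', hq'⟩ := mem_iUnion₂.1 hq'
  have h1 := h x y p q hp hq ((mem_ball'.1 hy).trans_le hr)
  have h2 := h x y' p q' hp hq' ((mem_ball'.1 hy').trans_le hr)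
  rw [edist_dist]
  refine ENNReal.ofReal_le_ofReal ?_
  linarith [dist_triangle_left q q' p]

theorem IsStronglyContracting.mono {A : Set S} {D D' : ℝ} (h : IsStronglyContracting D A)
    (hD : D ≤ D') : IsStronglyContracting D' A :=
  fun x r hd => (h x r hd).trans_le (ENNReal.ofReal_le_ofReal hD)

theorem IsStronglyContracting.pos {A : Set S} {D : ℝ} (h : IsStronglyContracting D A)
    (x : S) : 0 < D := by
  have := h x 0 (by simp)
  rw [ball_zero] at this
  simpa using this

/-! ### Curtains -/

namespace Curtain

theorem neg_nonempty (c : Curtain S) : c.neg.Nonempty := by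
  have h0 : c.γ 0 ∈ c.axis := ⟨0, ⟨le_rfl, by linarith [c.one_le_D]⟩, rfl⟩
  exact ⟨c.γ 0, c.γ 0, by rw [closestPoints_self h0]; rfl, 0, ⟨le_rfl, c.a_pos⟩, rfl⟩

theorem body_nonempty (c : Curtain S) : c.body.Nonempty := by
  have h0 : c.γ c.a ∈ c.axis :=
    ⟨c.a, ⟨c.a_pos.le, by linarith [c.a_lt, c.one_le_D]⟩, rfl⟩
  refine ⟨c.γ c.a, ?_⟩
  rw [body, mem_ofPred_eq, closestPoints_self h0, singleton_subset_iff]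
  exact ⟨c.a, ⟨le_rfl, by linarith [c.one_le_D]⟩, rfl⟩

theorem not_mem_pos_of_mem_neg (c : Curtain S) {x : S} (hx : x ∈ c.neg) : x ∉ c.pos := by
  intro h
  have := c.one_le_dist hx h
  rw [dist_self] at this
  linarith

theorem compl_neg_union_body (c : Curtain S) : (c.neg ∪ c.body)ᶜ = c.pos := by
  ext x
  simp only [mem_compl_iff, mem_union, not_or]
  constructor
  · rintro ⟨h1, h2⟩
    have := c.cover x
    tauto
  · exact fun h => ⟨fun h' => c.not_mem_pos_of_mem_neg h' h, fun h' => c.not_mem_pos h' h⟩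

theorem compl_neg (c : Curtain S) : c.negᶜ = c.pos ∪ c.body := by
  ext x
  have := c.cover x
  have h1 := fun h => c.not_mem_pos_of_mem_neg (x := x) h
  have h2 := fun h => c.not_mem_neg (x := x) h
  simp only [mem_compl_iff, mem_union]
  tauto

/-- The same curtain with the opposite orientation. -/
def reverse (c : Curtain S) : Curtain S where
  D := c.D
  one_le_D := c.one_le_D
  γ t := c.γ (20 * c.D - t)
  geodesic := c.geodesic.reverse
  contracting := by
    have : (fun t => c.γ (20 * c.D - t)) '' Icc 0 (20 * c.D) = c.γ '' Icc 0 (20 * c.D) := by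
      rw [← Set.image_image c.γ (fun t => 20 * c.D - t), Set.image_const_sub_Icc]
      simp
    rw [this]
    exact c.contracting
  a := 10 * c.D - c.a
  a_pos := by linarith [c.a_lt]
  a_lt := by linarith [c.a_pos]

theorem reverse_axis (c : Curtain S) : c.reverse.axis = c.axis := by
  rw [axis, axis]
  change (fun t => c.γ (20 * c.D - t)) '' Icc 0 (20 * c.D) = _
  rw [← Set.image_image c.γ (fun t => 20 * c.D - t), Set.image_const_sub_Icc]
  simp

theorem reverse_neg (c : Curtain S) : c.reverse.neg = c.pos := by
  rw [neg, pos, reverse_axis]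
  change {x | (_ ∩ (fun t => c.γ (20 * c.D - t)) '' Ico 0 (10 * c.D - c.a)).Nonempty} = _
  rw [← Set.image_image c.γ (fun t => 20 * c.D - t), Set.image_const_sub_Ico]
  simp only [sub_zero]
  rw [show 20 * c.D - (10 * c.D - c.a) = c.a + 10 * c.D by ring]

theorem reverse_body (c : Curtain S) : c.reverse.body = c.body := by
  rw [body, body, reverse_axis]
  change {x | _ ⊆ (fun t => c.γ (20 * c.D - t)) ''
    Icc (10 * c.D - c.a) (10 * c.D - c.a + 10 * c.D)} = _
  rw [← Set.image_image c.γ (fun t => 20 * c.D - t), Set.image_const_sub_Icc]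
  rw [show 20 * c.D - (10 * c.D - c.a) = c.a + 10 * c.D by ring,
    show 20 * c.D - (10 * c.D - c.a + 10 * c.D) = c.a by ring]

theorem reverse_pos (c : Curtain S) : c.reverse.pos = c.neg := by
  rw [← compl_neg_union_body, reverse_neg, reverse_body, ← compl_neg, compl_compl]

/-- The order on curtains: `h` lies on the negative side of `k`, and `k` on the positive side of
`h`. -/
structure Before (h k : Curtain S) : Prop where
  body_subset : h.body ⊆ k.neg
  body_subset' : k.body ⊆ h.pos
  neg_subset : h.neg ⊆ k.neg
  pos_subset : k.pos ⊆ h.pos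

/-- If `p` were on the wrong side, a geodesic from `p` to the body of `h` would have to enter
`k.neg` through the body of `k`, which lies in `h.pos`. Before that it would cross the body of `h`,
which already lies in `k.neg`. -/
theorem neg_subset_neg [GeodesicSpace S] {h k : Curtain S} (h1 : h.body ⊆ k.neg)
    (h2 : k.body ⊆ h.pos) :
    h.neg ⊆ k.neg := by
  intro p hp
  by_contra hpk
  have hpk : p ∈ k.pos := by
    rcases k.cover p with h' | h' | h'
    · exact absurd h' hpk
    · exact absurd (h2 h') (h.not_mem_pos_of_mem_neg hp)
    · exact h'
  obtain ⟨q, hq⟩ := h.body_nonempty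
  obtain ⟨β, ℓ, hβ, rfl, rfl⟩ := GeodesicSpace.exists_geodesic p q
  set U : Set ℝ := {t | t ∈ Icc 0 ℓ ∧ β t ∈ k.neg} with hU
  have hne : U.Nonempty := ⟨ℓ, ⟨hβ.1, le_rfl⟩, h1 hq⟩
  have hbdd : BddBelow U := ⟨0, fun t ht => ht.1.1⟩
  obtain ⟨u, hu, hlt⟩ := exists_lt_of_csInf_lt hne (show sInf U < sInf U + 1 / 4 by linarith)
  have hu1 := k.one_le_dist hu.2 hpk
  rw [dist_comm, hβ.dist_eq le_rfl hu.1.1 hu.1.2] at hu1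
  -- The two halfspaces of `k` are at distance at least 1, so stepping back by 1/2 from an almost
  -- first time in `k.neg` leaves `k.neg` without reaching `k.pos`.
  have hs : β (u - 1 / 2) ∈ k.body := by
    rcases k.cover (β (u - 1 / 2)) with h' | h' | h'
    · have := csInf_le hbdd (show u - 1 / 2 ∈ U from ⟨⟨by linarith, by linarith [hu.1.2]⟩, h'⟩)
      linarith
    · exact h'
    · have := k.one_le_dist hu.2 h'
      rw [dist_comm, hβ.dist_eq (by linarith) (by linarith) hu.1.2] at this
      linarith
  have hsub : IsGeodesicSegment β (u - 1 / 2) :=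
    ⟨by linarith, fun s hs t ht => hβ.2 s ⟨hs.1, by linarith [hs.2, hu.1.2]⟩ t
      ⟨ht.1, by linarith [ht.2, hu.1.2]⟩⟩
  obtain ⟨t, ht, htb⟩ := h.exists_mem_body hsub hp (h2 hs)
  have := csInf_le hbdd (show t ∈ U from ⟨⟨ht.1, by linarith [ht.2, hu.1.2]⟩, h1 htb⟩)
  linarith [ht.2]

/-- In a geodesic space the halfspace inclusions are automatic; reversing both curtains reduces the
positive sides to the negative ones. -/
theorem Before.mk' [GeodesicSpace S] {h k : Curtain S} (h1 : h.body ⊆ k.neg) (h2 : k.body ⊆ h.pos) :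
    Before h k := by
  refine ⟨h1, h2, neg_subset_neg h1 h2, ?_⟩
  rw [← reverse_neg, ← reverse_neg]
  apply neg_subset_neg
  · rwa [reverse_body, reverse_neg]
  · rwa [reverse_body, reverse_pos]

theorem BallSeparated.before [GeodesicSpace S] {R : ℕ} {h k : Curtain S}
    (hs : BallSeparated R h k) :
    Before h k := Before.mk' hs.1 hs.2.1

theorem BallSeparated.mono {R R' : ℕ} {h k : Curtain S} (hs : BallSeparated R h k)
    (hR : R ≤ R') : BallSeparated R' h k := by
  obtain ⟨h1, h2, z, r, hr0, hr, h3⟩ := hs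
  exact ⟨h1, h2, z, r, hr0, hr.trans (by exact_mod_cast hR), h3⟩

theorem BallSeparated.reverse {R : ℕ} {h k : Curtain S} (hs : BallSeparated R h k) :
    BallSeparated R k.reverse h.reverse := by
  obtain ⟨h1, h2, z, r, hr0, hr, hb, h3⟩ := hs
  refine ⟨by rwa [reverse_body, reverse_neg], by rwa [reverse_body, reverse_pos], z, r, hr0, hr,
    by rwa [reverse_pos, reverse_neg, inter_comm], fun β ℓ hβ h0 hℓ => ?_⟩
  rw [reverse_neg] at h0
  rw [reverse_pos] at hℓ
  obtain ⟨t, ht, hz⟩ := h3 _ ℓ hβ.reverse (by simpa using hℓ) (by simpa using h0)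
  exact ⟨ℓ - t, ⟨by linarith [ht.2], by linarith [ht.1]⟩, hz⟩

theorem Before.trans {h k l : Curtain S} (hk : Before h k) (kl : Before k l) : Before h l :=
  ⟨hk.body_subset.trans kl.neg_subset, kl.body_subset'.trans hk.pos_subset,
    hk.neg_subset.trans kl.neg_subset, kl.pos_subset.trans hk.pos_subset⟩

/-- The ball between `h` and `k` also serves for `h` and `l`: it lies in `k.neg ⊆ l.neg`, and
geodesics ending in `l.pos` end in `k.pos`. -/
theorem BallSeparated.trans_before [GeodesicSpace S] {R : ℕ} {h k l : Curtain S}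
    (hs : BallSeparated R h k) (kl : Before k l) : BallSeparated R h l := by
  have hl := hs.before.trans kl
  obtain ⟨h1, h2, z, r, hr0, hr, hb, h3⟩ := hs
  exact ⟨hl.body_subset, hl.body_subset', z, r, hr0, hr,
    hb.trans (inter_subset_inter_right _ kl.neg_subset),
    fun β ℓ hβ h0 hℓ => h3 β ℓ hβ h0 (kl.pos_subset hℓ)⟩

/-- The form in which ball separation enters the estimates: the additivity says that `q` lies on a
geodesic from `s` to `t`, and all such `q` are near one point `z`. -/
theorem BallSeparated.exists_between [GeodesicSpace S] {R : ℕ} {h k : Curtain S}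
    (hs : BallSeparated R h k) : ∃ z : S, z ∈ h.pos ∩ k.neg ∧ ∀ s ∈ h.neg, ∀ t ∈ k.pos,
      ∃ q ∈ h.pos ∩ k.neg, dist q z ≤ R ∧ dist s q + dist q t = dist s t := by
  obtain ⟨-, -, z, r, hr0, hr, hb, h3⟩ := hs
  refine ⟨z, hb (mem_closedBall_self hr0), fun s hs t ht => ?_⟩
  obtain ⟨β, ℓ, hβ, rfl, rfl⟩ := GeodesicSpace.exists_geodesic s t
  obtain ⟨u, hu, hz⟩ := h3 β ℓ hβ hs ht
  refine ⟨β u, hb hz, (mem_closedBall.1 hz).trans hr, ?_⟩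
  rw [hβ.dist_eq le_rfl hu.1 hu.2, hβ.dist_eq hu.1 hu.2 le_rfl, hβ.dist_endpoints]
  ring

end Curtain

/-! ### Finite chains of ball-separated curtains -/

open Curtain

/-- The first `n` terms of the sequence `h` are pairwise `R`-ball-separated. -/
def IsCurtainChain (R n : ℕ) (h : ℕ → Curtain S) : Prop :=
  ∀ i j, i < j → j < n → BallSeparated R (h i) (h j)

namespace IsCurtainChain

variable {R n : ℕ} {h : ℕ → Curtain S}

theorem reverse (hh : IsCurtainChain R n h) :
    IsCurtainChain R n (fun i => (h (n - 1 - i)).reverse) := by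
  intro i j hij hj
  exact (hh _ _ (by omega) (by omega)).reverse

theorem shift (hh : IsCurtainChain R n h) (a : ℕ) {m : ℕ} (hm : a + m ≤ n) :
    IsCurtainChain R m (fun i => h (a + i)) :=
  fun i j hij hj => hh _ _ (by omega) (by omega)

theorem mono (hh : IsCurtainChain R n h) {m : ℕ} (hm : m ≤ n) : IsCurtainChain R m h :=
  fun i j hij hj => hh _ _ hij (by omega)

theorem neg_subset [GeodesicSpace S] (hh : IsCurtainChain R n h) {i j : ℕ} (hij : i ≤ j)
    (hj : j < n) : (h i).neg ⊆ (h j).neg := by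
  rcases hij.eq_or_lt with rfl | hij
  · rfl
  · exact (hh i j hij hj).before.neg_subset

theorem pos_subset [GeodesicSpace S] (hh : IsCurtainChain R n h) {i j : ℕ} (hij : i ≤ j)
    (hj : j < n) : (h j).pos ⊆ (h i).pos := by
  rcases hij.eq_or_lt with rfl | hij
  · rfl
  · exact (hh i j hij hj).before.pos_subset

theorem mem_neg_of_not_mem_pos (hh : IsCurtainChain R n h) [GeodesicSpace S] {i j : ℕ}
    (hij : i < j) (hj : j < n) {x : S} (hx : x ∉ (h i).pos) : x ∈ (h j).neg := by
  rcases (h i).cover x with h' | h' | h'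
  · exact (hh i j hij hj).before.neg_subset h'
  · exact (hh i j hij hj).1 h'
  · exact absurd h' hx

theorem mem_pos_of_not_mem_neg (hh : IsCurtainChain R n h) [GeodesicSpace S] {i j : ℕ}
    (hij : i < j) (hj : j < n) {x : S} (hx : x ∉ (h j).neg) : x ∈ (h i).pos := by
  by_contra h'
  exact hx (hh.mem_neg_of_not_mem_pos hij hj h')

/-- Points separated by part of a chain of curtains are at least as far apart as that part is
long. -/
theorem le_dist [GeodesicSpace S] (hh : IsCurtainChain R n h) {a b : ℕ} (hab : a ≤ b)
    (hb : b < n) {s t : S} (hs : s ∈ (h a).neg) (ht : t ∈ (h b).pos) :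
    (b : ℝ) - a + 1 ≤ dist s t := by
  induction hab using Nat.decreasingInduction generalizing s with
  | self => simpa using (h b).one_le_dist hs ht
  | of_succ a hab ih =>
    obtain ⟨z, -, hz⟩ := (hh a (a + 1) (by omega) (by omega)).exists_between
    -- The point `q` of a geodesic from `s` to `t` lies in the gap after `h a`: that curtain
    -- contributes 1 before `q`, and the others are crossed after `q`.
    obtain ⟨q, hq, -, hsum⟩ := hz s hs t (hh.pos_subset (by omega) hb ht)
    have h1 := (h a).one_le_dist hs hq.1
    have h2 := ih hq.2
    push_cast at h2
    linarith

/-- A long chain of curtains cannot cross two ball-separated curtains. -/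
theorem le_of_quadrants [GeodesicSpace S] {R' : ℕ} {h₀ h₁ : Curtain S}
    (hsep : BallSeparated R' h₀ h₁) (hh : IsCurtainChain R n h)
    (h1 : ∃ p ∈ h₀.neg, ∀ i < n, p ∈ (h i).neg) (h2 : ∃ p ∈ h₁.pos, ∀ i < n, p ∈ (h i).neg)
    (h3 : ∃ p ∈ h₀.neg, ∀ i < n, p ∈ (h i).pos) (h4 : ∃ p ∈ h₁.pos, ∀ i < n, p ∈ (h i).pos) :
    n ≤ 4 * R + 2 * R' + 4 := by
  by_contra! hn
  obtain ⟨p1, hp1, hk1⟩ := h1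
  obtain ⟨p2, hp2, hk2⟩ := h2
  obtain ⟨p3, hp3, hk3⟩ := h3
  obtain ⟨p4, hp4, hk4⟩ := h4
  -- Geodesics from `p1` to `p2` and from `p3` to `p4` pass through the same ball, at `b` and `b'`;
  -- it remains to see that most of the chain separates `b` from `b'`.
  obtain ⟨z, -, hz⟩ := hsep.exists_between
  obtain ⟨b, -, hbz, hb⟩ := hz p1 hp1 p2 hp2
  obtain ⟨b', -, hbz', hb'⟩ := hz p3 hp3 p4 hp4
  have hbb : dist b b' ≤ 2 * R' := by linarith [dist_triangle_right b b' z]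
  -- If the geodesic from `p1` to `p2` went deep into the chain at `b`, both of its halves would
  -- cross the ball between `h 0` and `h 1`, at points `u` and `v` at most `2 * R` apart, while `u`
  -- and `v` are each at least `2 * R + 1` from `b`. The same holds for `b'` at the other end of the
  -- chain.
  have hbn : b ∈ (h (2 * R + 2)).neg := by
    apply hh.mem_neg_of_not_mem_pos (i := 2 * R + 1) (by omega) (by omega)
    intro hpos
    obtain ⟨z', -, hz'⟩ := (hh 0 1 (by omega) (by omega)).exists_between
    have hpos' := hh.pos_subset (show 1 ≤ 2 * R + 1 by omega) (by omega) hpos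
    obtain ⟨u, hu, huz, hu'⟩ := hz' p1 (hk1 0 (by omega)) b hpos'
    obtain ⟨v, hv, hvz, hv'⟩ := hz' p2 (hk2 0 (by omega)) b hpos'
    have := hh.le_dist (show 1 ≤ 2 * R + 1 by omega) (by omega) hu.2 hpos
    push_cast at this
    have t1 := dist_triangle4 p1 u v p2
    have t2 := dist_triangle_right u v z'
    have t3 := hh.le_dist (show 1 ≤ 2 * R + 1 by omega) (by omega) hv.2 hpos
    push_cast at t3
    rw [dist_comm b p2] at hb
    rw [dist_comm v p2] at t1
    linarith
  have hbp : b' ∈ (h (n - 2 * R - 3)).pos := by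
    apply hh.mem_pos_of_not_mem_neg (j := n - 2 * R - 2) (by omega) (by omega)
    intro hneg
    obtain ⟨z', -, hz'⟩ := (hh (n - 2) (n - 1) (by omega) (by omega)).exists_between
    have hneg' := hh.neg_subset (show n - 2 * R - 2 ≤ n - 2 by omega) (by omega) hneg
    obtain ⟨u, hu, huz, hu'⟩ := hz' b' hneg' p3 (hk3 (n - 1) (by omega))
    obtain ⟨v, hv, hvz, hv'⟩ := hz' b' hneg' p4 (hk4 (n - 1) (by omega))
    have := hh.le_dist (show n - 2 * R - 2 ≤ n - 2 by omega) (by omega) hneg hu.1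
    rw [Nat.cast_sub (by omega), Nat.cast_sub (by omega), Nat.cast_sub (by omega)] at this
    push_cast at this
    have t1 := dist_triangle4 p3 u v p4
    have t2 := dist_triangle_right u v z'
    have t3 := hh.le_dist (show n - 2 * R - 2 ≤ n - 2 by omega) (by omega) hneg hv.1
    rw [Nat.cast_sub (by omega), Nat.cast_sub (by omega), Nat.cast_sub (by omega)] at t3
    push_cast at t3
    rw [dist_comm p3 b'] at hb'
    rw [dist_comm p3 u] at t1
    linarith
  -- The remaining `n - 4 * R - 4` curtains separate `b` from `b'`, which are at most `2 * R'`
  -- apart.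
  have := hh.le_dist (show 2 * R + 2 ≤ n - 2 * R - 3 by omega) (by omega) hbn hbp
  rw [Nat.cast_sub (by omega), Nat.cast_sub (by omega)] at this
  push_cast at this
  have hn' : (4 * R + 2 * R' + 4 : ℝ) + 1 ≤ n := by exact_mod_cast hn
  linarith

end IsCurtainChain

end CurtainDual

namespace CurtainDual

open Curtain

theorem Wall.of_eq_of {S : Type*} {A B : Set S} (h : Wall.of A = Wall.of B) : A = B ∨ A = Bᶜ := by
  have : A ∈ (Wall.of B).1 := h ▸ Or.inl rfl
  exact this

/-! ### Halfspaces chosen by ultrafilters -/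

namespace WallUltrafilter

variable {S : Type*} {P : Set (Wall S)}

theorem half_eq_or_eq_compl (x : WallUltrafilter P) {k : P} {A : Set S} (hk : k.1 = Wall.of A) :
    x.half k = A ∨ x.half k = Aᶜ := by
  have := x.half_mem k
  rw [hk] at this
  exact this

theorem compl_mem {k : P} {A : Set S} (hA : A ∈ k.1.1) : Aᶜ ∈ k.1.1 := by
  obtain ⟨⟨_, B, rfl⟩, _⟩ := k
  rcases hA with rfl | rfl
  · exact Or.inr rfl
  · exact Or.inl (compl_compl _)

theorem eq_or_eq_compl_of_mem {k : P} {A B : Set S} (hA : A ∈ k.1.1) (hB : B ∈ k.1.1) :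
    A = B ∨ A = Bᶜ := by
  obtain ⟨⟨_, C, rfl⟩, _⟩ := k
  rcases hA with rfl | rfl <;> rcases hB with rfl | rfl <;> simp

theorem half_eq_compl_of_ne {x y : WallUltrafilter P} {k : P} (h : x.half k ≠ y.half k) :
    x.half k = (y.half k)ᶜ :=
  (eq_or_eq_compl_of_mem (x.half_mem k) (y.half_mem k)).resolve_left h

/-- Disjoint halfspaces would put one inside the complement of the other, and consistency would make
a halfspace equal to its own complement. -/
theorem inter_half_nonempty [Nonempty S] (x : WallUltrafilter P) (k l : P) :
    (x.half k ∩ x.half l).Nonempty := by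
  by_contra h
  rw [not_nonempty_iff_eq_empty, ← disjoint_iff_inter_eq_empty] at h
  exact ne_compl_self (x.consistent k l _ (compl_mem (x.half_mem l)) h.subset_compl_right)

theorem half_nonempty [Nonempty S] (x : WallUltrafilter P) (k : P) : (x.half k).Nonempty :=
  (x.inter_half_nonempty k k).mono inter_subset_left

end WallUltrafilter

variable {S : Type*} [MetricSpace S]

/-- The wall `{h⁻, h ∪ h⁺}`. -/
def Curtain.negWall (c : Curtain S) : curtainWalls S := ⟨Wall.of c.neg, c, Or.inl rfl⟩

/-- The wall `{h⁻ ∪ h, h⁺}`. -/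
def Curtain.posWall (c : Curtain S) : curtainWalls S :=
  ⟨Wall.of (c.neg ∪ c.body), c, Or.inr rfl⟩

namespace WallUltrafilter

/-- The ultrafilter `x` lies in the negative halfspace of the curtain `c`. -/
def Neg (x : WallUltrafilter (curtainWalls S)) (c : Curtain S) : Prop :=
  x.half c.negWall = c.neg

/-- The ultrafilter `x` lies in the positive halfspace of the curtain `c`. -/
def Pos (x : WallUltrafilter (curtainWalls S)) (c : Curtain S) : Prop :=
  x.half c.posWall = c.pos

variable {x y : WallUltrafilter (curtainWalls S)} {c d : Curtain S}

theorem neg_of_half_subset {k : curtainWalls S} (h : x.half k ⊆ c.neg) : x.Neg c :=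
  x.consistent _ _ _ (Or.inl rfl) h

theorem pos_of_half_subset {k : curtainWalls S} (h : x.half k ⊆ c.pos) : x.Pos c :=
  x.consistent _ _ _ (Or.inr c.compl_neg_union_body.symm) h

theorem Pos.reverse (h : x.Pos c) : x.Neg c.reverse :=
  neg_of_half_subset (k := c.posWall) (by rw [h, reverse_neg])

theorem Neg.reverse (h : x.Neg c) : x.Pos c.reverse :=
  pos_of_half_subset (k := c.negWall) (by rw [h, reverse_pos])

theorem Neg.half_negWall_ne (hx : x.Neg c) (hy : y.Pos c) :
    x.half c.negWall ≠ y.half c.negWall := by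
  have : y.half c.negWall = c.negᶜ := by
    refine y.consistent c.posWall _ _ (Or.inr rfl) ?_
    rw [hy, Curtain.compl_neg]
    exact subset_union_left
  rw [hx, this]
  have : Nonempty S := ⟨c.γ 0⟩
  exact ne_compl_self

theorem Neg.half_posWall (hx : x.Neg c) : x.half c.posWall = c.neg ∪ c.body :=
  x.consistent c.negWall _ _ (Or.inl rfl) (by rw [hx]; exact subset_union_left)

theorem Neg.exists_neg (hc : x.Neg c) (hd : x.Neg d) : ∃ p, p ∈ c.neg ∧ p ∈ d.neg := by
  have : Nonempty S := ⟨c.γ 0⟩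
  have := x.inter_half_nonempty c.negWall d.negWall
  rwa [hc, hd] at this

theorem Neg.exists_pos (hc : x.Neg c) (hd : x.Pos d) : ∃ p, p ∈ c.neg ∧ p ∈ d.pos := by
  have : Nonempty S := ⟨c.γ 0⟩
  have := x.inter_half_nonempty c.negWall d.posWall
  rwa [hc, hd] at this

theorem Pos.exists_pos (hc : x.Pos c) (hd : x.Pos d) : ∃ p, p ∈ c.pos ∧ p ∈ d.pos := by
  have : Nonempty S := ⟨c.γ 0⟩
  have := x.inter_half_nonempty c.posWall d.posWall
  rwa [hc, hd] at this

end WallUltrafilter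

open WallUltrafilter

/-! ### Sizes of chains in a set of walls -/

/-- The supremum of the cardinalities of the elements of `𝒞_R` that consist of walls in `W`. -/
noncomputable def chainSize (R : ℕ) (W : Set (curtainWalls S)) : ℕ∞ :=
  ⨆ c ∈ {c ∈ ballSystem S R | ∀ k ∈ c, k ∈ W}, c.encard

/-- The walls that separate `x` from `y`. -/
def sep (x y : WallUltrafilter (curtainWalls S)) : Set (curtainWalls S) :=
  {k | x.half k ≠ y.half k}

theorem wallDist_eq_chainSize (R : ℕ) (x y : WallUltrafilter (curtainWalls S)) :
    wallDist (ballSystem S R) x y = chainSize R (sep x y) := rfl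

theorem sep_comm (x y : WallUltrafilter (curtainWalls S)) : sep x y = sep y x := by
  ext k
  exact ne_comm

theorem encard_le_chainSize {R : ℕ} {c W : Set (curtainWalls S)} (hc : c ∈ ballSystem S R)
    (hW : c ⊆ W) : c.encard ≤ chainSize R W :=
  le_iSup₂_of_le (f := fun (c : Set (curtainWalls S))
    (_ : c ∈ {c ∈ ballSystem S R | ∀ k ∈ c, k ∈ W}) => c.encard) c ⟨hc, fun _ hk => hW hk⟩ le_rfl

theorem chainSize_mono {R : ℕ} {W W' : Set (curtainWalls S)} (h : W ⊆ W') :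
    chainSize R W ≤ chainSize R W' :=
  iSup₂_le fun _ hc => encard_le_chainSize hc.1 fun _ hk => h (hc.2 _ hk)

theorem chainSize_le_add {R : ℕ} {W W₁ W₂ : Set (curtainWalls S)} (h : W ⊆ W₁ ∪ W₂) :
    chainSize R W ≤ chainSize R W₁ + chainSize R W₂ := by
  refine iSup₂_le fun c hc => ?_
  have hsub : c ⊆ (c ∩ W₁) ∪ (c ∩ W₂) := fun k hk => by
    rcases h (hc.2 k hk) with h' | h'
    · exact Or.inl ⟨hk, h'⟩
    · exact Or.inr ⟨hk, h'⟩
  refine (encard_le_encard hsub).trans ((encard_union_le _ _).trans (add_le_add ?_ ?_))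
  · exact encard_le_chainSize (ballSystem_subset hc.1 inter_subset_left) inter_subset_right
  · exact encard_le_chainSize (ballSystem_subset hc.1 inter_subset_left) inter_subset_right

/-- Walls are unordered, so two coincidences must be excluded: equal negative sides contradict the
point between the curtains, and complementary ones contradict nesting. -/
theorem IsCurtainChain.injOn_negWall [GeodesicSpace S] {R n : ℕ} {h : ℕ → Curtain S}
    (hh : IsCurtainChain R n h) : InjOn (fun i => (h i).negWall) (Iio n) := by
  have key : ∀ i j, i < j → j < n → (h i).negWall ≠ (h j).negWall := by
    intro i j hij hj he
    rcases Wall.of_eq_of (congrArg Subtype.val he) with h' | h'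
    · obtain ⟨z, hz, -⟩ := (hh i j hij hj).exists_between
      exact (h i).not_mem_pos_of_mem_neg (h' ▸ hz.2) hz.1
    · obtain ⟨p, hp⟩ := (h i).neg_nonempty
      have h1 := (hh i j hij hj).before.neg_subset hp
      rw [h'] at hp
      exact hp h1
  intro i hi j hj he
  rcases lt_trichotomy i j with hij | hij | hij
  · exact absurd he (key i j hij hj)
  · exact hij
  · exact absurd he.symm (key j i hij hi)

theorem IsCurtainChain.le_chainSize [GeodesicSpace S] {R n : ℕ} {h : ℕ → Curtain S}
    (hh : IsCurtainChain R n h) {W : Set (curtainWalls S)} (hW : ∀ i < n, (h i).negWall ∈ W) :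
    (n : ℕ∞) ≤ chainSize R W := by
  have hcard : ((fun i => (h i).negWall) '' Iio n).encard = n := by
    rw [hh.injOn_negWall.encard_image]
    simp [Set.encard_eq_coe_toFinset_card]
  rw [← hcard]
  refine encard_le_chainSize ?_ (by rintro _ ⟨i, hi, rfl⟩; exact hW i hi)
  refine ⟨{j : ℤ | 0 ≤ j ∧ j < n}, fun j => h j.1.toNat, fun j => (h j.1.toNat).neg,
    fun i => Or.inl rfl, ?_, ?_, ?_⟩
  · rintro ⟨i, hi⟩ ⟨j, hj⟩ hij
    have hij : i < j := hij
    exact hh.neg_subset (by simp only; omega) (by have := hj.2; have := hj.1; simp only; omega)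
  · rintro ⟨i, hi⟩ ⟨j, hj⟩ hij
    have hij : i < j := hij
    have := hj.2
    have := hi.1
    exact hh _ _ (by simp only; omega) (by simp only; omega)
  · ext k
    constructor
    · rintro ⟨_, ⟨i, hi, rfl⟩, rfl⟩
      exact ⟨⟨i, by simp, by simpa using hi⟩, by simp [negWall]⟩
    · rintro ⟨⟨j, hj⟩, rfl⟩
      have := hj.2
      have := hj.1
      exact ⟨_, ⟨j.toNat, by simp only [mem_Iio]; omega, rfl⟩, rfl⟩

theorem chainSize_mono_left [GeodesicSpace S] {R R' : ℕ} (hR : R ≤ R')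
    (W : Set (curtainWalls S)) : chainSize R W ≤ chainSize R' W :=
  iSup₂_le fun _ hc => by
    refine encard_le_chainSize ?_ hc.2
    obtain ⟨J, h, m, hm, hch, hsep, hr⟩ := hc.1
    exact ⟨J, h, m, hm, hch, fun i j hij => (hsep i j hij).mono hR, hr⟩

/-- Converse to `IsCurtainChain.le_chainSize`, before orientation: a chain of walls may use, for
each curtain, either of its two walls, recorded by `m`. -/
theorem exists_chain_of_le_chainSize {R n : ℕ} (hn : 1 ≤ n) {W : Set (curtainWalls S)}
    (hW : (n : ℕ∞) ≤ chainSize R W) : ∃ (h : ℕ → Curtain S) (m : ℕ → Set S)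
      (k : ℕ → curtainWalls S), IsCurtainChain R n h ∧ ∀ i < n,
        (m i = (h i).neg ∨ m i = (h i).neg ∪ (h i).body) ∧ k i ∈ W ∧ (k i).1 = Wall.of (m i) := by
  classical
  obtain ⟨n, rfl⟩ : ∃ n', n = n' + 1 := ⟨n - 1, by omega⟩
  have hlt : (n : ℕ∞) < chainSize R W := lt_of_lt_of_le (by exact_mod_cast Nat.lt_succ_self n) hW
  obtain ⟨c, hlt⟩ := lt_iSup_iff.1 hlt
  obtain ⟨⟨⟨J, h, m, hm, -, hsep, hr⟩, hcW⟩, hlt⟩ := lt_iSup_iff.1 hlt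
  obtain ⟨c', hc', hcard⟩ := exists_subset_encard_eq (Order.add_one_le_of_lt hlt)
  have hidx : ∀ k : c', ∃ i : J, Wall.of (m i) = k.1.1 := by
    rintro ⟨k, hk⟩
    have : k.1 ∈ range fun i => Wall.of (m i) := hr ▸ ⟨k, hc' hk, rfl⟩
    exact this
  choose σ hσ using hidx
  have hσinj : Function.Injective σ := by
    intro k k' hkk
    apply Subtype.ext
    apply Subtype.ext
    rw [← hσ, ← hσ, hkk]
  have hfin : c'.Finite := by
    rw [← encard_lt_top_iff, hcard]
    exact_mod_cast ENat.natCast_lt_top _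
  have := hfin.fintype
  set F : Finset J := Finset.univ.image σ with hF
  have hFcard : F.card = n + 1 := by
    rw [hF, Finset.card_image_of_injective _ hσinj, Finset.card_univ]
    have : (Fintype.card c' : ℕ∞) = c'.encard := by
      rw [← Set.toFinset_card, Set.encard_eq_coe_toFinset_card]
    rw [hcard] at this
    exact_mod_cast this
  have hmem : ∀ i : Fin (n + 1), ∃ k : c', σ k = F.orderEmbOfFin hFcard i := by
    intro i
    have := Finset.orderEmbOfFin_mem F hFcard i
    obtain ⟨k, -, hk⟩ := Finset.mem_image.1 this
    exact ⟨k, hk⟩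
  choose κ hκ using hmem
  -- Indices past the end wrap around; their values are irrelevant.
  refine ⟨fun i => h (F.orderEmbOfFin hFcard (Fin.ofNat (n + 1) i)),
    fun i => m (F.orderEmbOfFin hFcard (Fin.ofNat (n + 1) i)),
    fun i => (κ (Fin.ofNat (n + 1) i)).1, ?_, ?_⟩
  · intro i j hij hj
    refine hsep _ _ ((F.orderEmbOfFin hFcard).strictMono ?_)
    rw [Fin.lt_def, Fin.val_ofNat, Fin.val_ofNat, Nat.mod_eq_of_lt hj,
      Nat.mod_eq_of_lt (hij.trans hj)]
    exact hij
  · intro i hi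
    refine ⟨hm _, hcW _ (hc' (κ _).2), ?_⟩
    simp only
    rw [← hκ, hσ]

/-- An oriented chain of curtains extracted from a chain of walls that separate `x` from `y`. -/
theorem exists_separating_chain [GeodesicSpace S] {R n : ℕ} (hn : 1 ≤ n)
    (x y : WallUltrafilter (curtainWalls S)) {W : Set (curtainWalls S)} (hsep : W ⊆ sep x y)
    (hW : ((n + 2 : ℕ) : ℕ∞) ≤ chainSize R W) : ∃ h : ℕ → Curtain S, IsCurtainChain R n h ∧
      (∀ z, W ⊆ sep z y → ∀ i < n, z.Neg (h i)) ∧ (∀ z, W ⊆ sep z x → ∀ i < n, z.Pos (h i)) := by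
  obtain ⟨h, m, k, hch, hmk⟩ := exists_chain_of_le_chainSize (by omega) hW
  have hm : ∀ i < n + 2, m i = (h i).neg ∨ m i = (h i).neg ∪ (h i).body := fun i hi => (hmk i hi).1
  have hkW : ∀ i < n + 2, k i ∈ W := fun i hi => (hmk i hi).2.1
  have hkm : ∀ i < n + 2, (k i).1 = Wall.of (m i) := fun i hi => (hmk i hi).2.2
  -- The halfspace `m i` may or may not contain the curtain itself, so strict sides are known only
  -- for neighbouring curtains. This costs the first and the last curtain of the chain.
  have hmn : ∀ i j, i < j → j < n + 2 → m i ⊆ (h j).neg := by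
    intro i j hij hj
    have hb := (hch i j hij hj).before
    rcases hm i (hij.trans hj) with h' | h' <;> rw [h']
    · exact hb.neg_subset
    · exact union_subset hb.neg_subset hb.body_subset
  have hmp : ∀ i j, i < j → j < n + 2 → (m j)ᶜ ⊆ (h i).pos := by
    intro i j hij hj p hp
    refine hch.mem_pos_of_not_mem_neg hij hj fun h' => hp ?_
    rcases hm j hj with h'' | h'' <;> rw [h'']
    · exact h'
    · exact Or.inl h'
  -- Once `u` chooses `m 0`, consistency makes it choose every `m i`, and `v` every complement. Any
  -- `z` that differs from `v` on all of `W` agrees there with `u`, so one chain serves all points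
  -- on the same side.
  have key : ∀ u v : WallUltrafilter (curtainWalls S), W ⊆ sep u v → u.half (k 0) = m 0 →
      (∀ z, W ⊆ sep z v → ∀ i < n, z.Neg (h (1 + i))) ∧
        (∀ z, W ⊆ sep z u → ∀ i < n, z.Pos (h (1 + i))) := by
    intro u v huv hu0
    have hu : ∀ i < n + 2, u.half (k i) = m i := by
      intro i hi
      rcases Nat.eq_zero_or_pos i with rfl | hi0
      · exact hu0
      · refine u.consistent (k 0) (k i) (m i) (by rw [hkm i hi]; exact Or.inl rfl) ?_
        rw [hu0]
        refine (hmn 0 i hi0 hi).trans ?_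
        rcases hm i hi with h'' | h'' <;> rw [h'']
        exact subset_union_left
    have hv : ∀ i < n + 2, v.half (k i) = (m i)ᶜ := by
      intro i hi
      rw [← hu i hi]
      exact half_eq_compl_of_ne (Ne.symm (huv (hkW i hi)))
    refine ⟨fun z hz i hi => ?_, fun z hz i hi => ?_⟩
    · refine neg_of_half_subset (k := k i) ?_
      rw [half_eq_compl_of_ne (hz (hkW i (by omega))), hv i (by omega), compl_compl]
      exact hmn i _ (by omega) (by omega)
    · refine pos_of_half_subset (k := k (i + 2)) ?_
      rw [half_eq_compl_of_ne (hz (hkW (i + 2) (by omega))), hu (i + 2) (by omega)]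
      exact hmp _ _ (by omega) (by omega)
  have hch' := hch.shift 1 (m := n) (by omega)
  -- If `x` chooses the complement of `m 0`, then `x` and `y` are exchanged and the chain is
  -- reversed.
  rcases x.half_eq_or_eq_compl (hkm 0 (by omega)) with h0 | h0
  · exact ⟨_, hch', key x y hsep h0⟩
  · have hsep' : W ⊆ sep y x := by rwa [sep_comm]
    have h0' : y.half (k 0) = m 0 := by
      rw [half_eq_compl_of_ne (hsep' (hkW 0 (by omega))), h0, compl_compl]
    obtain ⟨h1, h2⟩ := key y x hsep' h0'
    exact ⟨_, hch'.reverse, fun z hz i hi => (h2 z hz _ (by omega)).reverse,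
      fun z hz i hi => (h1 z hz _ (by omega)).reverse⟩

/-- The curtain `h n` is sacrificed as a buffer: the ball between `h i` and `h n` separates `h i`
from every `k j`, whereas no ball is known between `h n` and `k 0`. -/
theorem IsCurtainChain.append [GeodesicSpace S] {R n m : ℕ} {h k : ℕ → Curtain S}
    (hh : IsCurtainChain R (n + 1) h) (hk : IsCurtainChain R m k) (hb : Before (h n) (k 0)) :
    IsCurtainChain R (n + m) (fun i => if i < n then h i else k (i - n)) := by
  intro i j hij hj
  simp only
  split_ifs with h1 h2 h2
  · exact hh i j hij (by omega)
  · refine (hh i n h1 (by omega)).trans_before ?_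
    rcases Nat.eq_zero_or_pos (j - n) with h0 | h0
    · rwa [h0]
    · exact hb.trans (hk 0 (j - n) h0 (by omega)).before
  · omega
  · exact hk _ _ (by omega) (by omega)

/-- The walls that separate `x` from both `y` and `z`. -/
def sepBoth (x y z : WallUltrafilter (curtainWalls S)) : Set (curtainWalls S) :=
  sep x y ∩ sep x z

theorem ENat.add_le_of_forall_nat {a b d : ℕ∞}
    (h : ∀ n m : ℕ, (n : ℕ∞) ≤ a → (m : ℕ∞) ≤ b → ((n + m : ℕ) : ℕ∞) ≤ d) : a + b ≤ d := by
  induction d using ENat.recTopCoe with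
  | top => exact le_top
  | coe d =>
    have ha : a ≠ ⊤ := by
      rintro rfl
      have := h (d + 1) 0 le_top (by simp)
      norm_cast at this
      omega
    have hb : b ≠ ⊤ := by
      rintro rfl
      have := h 0 (d + 1) (by simp) le_top
      norm_cast at this
      omega
    lift a to ℕ using ha
    lift b to ℕ using hb
    exact_mod_cast h a b le_rfl le_rfl

/-- Chains that separate `x` from `{y, z}` and `{x, z}` from `y` can be glued. -/
theorem chainSize_sepBoth_add_le [GeodesicSpace S] (R : ℕ)
    (x y z : WallUltrafilter (curtainWalls S)) :
    chainSize R (sepBoth x y z) + chainSize R (sepBoth y x z) ≤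
      chainSize R (sep x y) + ((6 * R + 12 : ℕ) : ℕ∞) := by
  refine ENat.add_le_of_forall_nat fun n m hn hm => ?_
  have hn' : (n : ℕ∞) ≤ chainSize R (sep x y) := hn.trans (chainSize_mono inter_subset_left)
  have hm' : (m : ℕ∞) ≤ chainSize R (sep x y) :=
    hm.trans (chainSize_mono (by rw [sep_comm x y]; exact inter_subset_left))
  -- If one chain is short, the other alone gives the bound. Otherwise each chain loses two walls to
  -- orientation, `h` keeps three spare curtains, and `k` keeps enough to violate the crossing bound
  -- with `R' = R`.
  rcases lt_or_ge n 5 with hn5 | hn5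
  · rw [Nat.add_comm, Nat.cast_add]
    exact add_le_add hm' (by exact_mod_cast (by omega))
  rcases lt_or_ge m (6 * R + 8) with hmR | hmR
  · rw [Nat.cast_add]
    exact add_le_add hn' (by exact_mod_cast (by omega))
  obtain ⟨n, rfl⟩ : ∃ n', n = n' + 5 := ⟨n - 5, by omega⟩
  obtain ⟨m, rfl⟩ : ∃ m', m = m' + (6 * R + 8) := ⟨m - (6 * R + 8), by omega⟩
  obtain ⟨h, hh, hhn, hhp⟩ := exists_separating_chain (n := n + 3) (by omega) x y
    (W := sepBoth x y z) inter_subset_left (by exact_mod_cast hn)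
  obtain ⟨k, hk, hkn, hkp⟩ := exists_separating_chain (n := m + (6 * R + 6)) (by omega) x y
    (W := sepBoth y x z) (by rw [sep_comm x y]; exact inter_subset_left) (by exact_mod_cast hm)
  have hhx := hhn x inter_subset_left
  have hhy := hhp y (by rw [sep_comm y x]; exact inter_subset_left)
  have hhz := hhp z (by rw [sep_comm z x]; exact inter_subset_right)
  have hkx := hkn x (by rw [sep_comm x y]; exact inter_subset_left)
  have hkz := hkn z (by rw [sep_comm z y]; exact inter_subset_right)
  have hky := hkp y inter_subset_left
  -- The ultrafilters `x`, `z`, `y` inhabit three of the quadrants formed by the last two curtains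
  -- of `h` and the first `6 * R + 5` curtains of `k`. The fourth quadrant must be empty, which says
  -- that the chains are nested from there on.
  have hempty : ∀ p, p ∈ (h (n + 1)).neg → p ∉ (k (6 * R + 4)).pos := by
    intro p hp hp'
    have hk' := hk.mono (m := 6 * R + 5) (by omega)
    have hkneg : ∀ p, p ∈ (k 0).neg → ∀ i < 6 * R + 5, p ∈ (k i).neg :=
      fun p hp i hi => hk'.neg_subset (Nat.zero_le i) hi hp
    have hkpos : ∀ p, p ∈ (k (6 * R + 4)).pos → ∀ i < 6 * R + 5, p ∈ (k i).pos :=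
      fun p hp i hi => hk'.pos_subset (by omega) (by omega) hp
    obtain ⟨p1, hp1, hp1'⟩ := (hhx (n + 1) (by omega)).exists_neg (hkx 0 (by omega))
    obtain ⟨p2, hp2', hp2⟩ := (hkz 0 (by omega)).exists_pos (hhz (n + 2) (by omega))
    obtain ⟨p4, hp4, hp4'⟩ := (hhy (n + 2) (by omega)).exists_pos (hky (6 * R + 4) (by omega))
    have := hk'.le_of_quadrants (hh (n + 1) (n + 2) (by omega) (by omega))
      ⟨p1, hp1, hkneg _ hp1'⟩ ⟨p2, hp2, hkneg _ hp2'⟩ ⟨p, hp, hkpos _ hp'⟩ ⟨p4, hp4, hkpos _ hp4'⟩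
    omega
  have hb : Before (h n) (k (6 * R + 5)) := by
    refine Before.mk' (fun p hp => ?_) (fun p hp => ?_)
    · exact hk.mem_neg_of_not_mem_pos (i := 6 * R + 4) (by omega) (by omega)
        (hempty p ((hh n (n + 1) (by omega) (by omega)).1 hp))
    · refine hh.mem_pos_of_not_mem_neg (j := n + 1) (by omega) (by omega) fun hp' => ?_
      exact hempty p hp' ((hk (6 * R + 4) (6 * R + 5) (by omega) (by omega)).2.1 hp)
  have hch := (hh.mono (m := n + 1) (by omega)).append
    (hk.shift (6 * R + 5) (m := m + 1) (by omega)) hb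
  have hle := hch.le_chainSize (W := sep x y) (fun i hi => by
    split_ifs with h1
    · exact (hhx i (by omega)).half_negWall_ne (hhy i (by omega))
    · exact (hkx _ (by omega)).half_negWall_ne (hky _ (by omega)))
  refine le_trans ?_ (add_le_add_left hle _)
  exact_mod_cast (by omega)

/-- The walls that separate `{x, w}` from `{y, z}`. -/
def sepPair (x w y z : WallUltrafilter (curtainWalls S)) : Set (curtainWalls S) :=
  {k | k ∈ sep x y ∧ k ∈ sep x z ∧ k ∈ sep w y}

/-- Long chains cannot cross. -/
theorem chainSize_sepPair_le [GeodesicSpace S] {R R' : ℕ}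
    {x y z w : WallUltrafilter (curtainWalls S)} (h4 : (4 : ℕ) ≤ chainSize R (sepPair x w y z)) :
    chainSize R' (sepPair x y w z) ≤ ((4 * R' + 2 * R + 6 : ℕ) : ℕ∞) := by
  by_contra! hlt
  have hle := Order.add_one_le_of_lt hlt
  obtain ⟨h, hh, hhn, hhp⟩ := exists_separating_chain (n := 2) (by omega) x y
    (W := sepPair x w y z) (fun k hk => hk.1) h4
  obtain ⟨k, hk, hkn, hkp⟩ := exists_separating_chain (n := 4 * R' + 2 * R + 5) (by omega) x w
    (W := sepPair x y w z) (fun k hk => hk.1) (by exact_mod_cast hle)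
  have hhx := hhn x (fun k hk => hk.1) 0 (by omega)
  have hhw := hhn w (fun k hk => hk.2.2) 0 (by omega)
  have hhy := hhp y (fun k hk => hk.1.symm) 1 (by omega)
  have hhz := hhp z (fun k hk => hk.2.1.symm) 1 (by omega)
  have hkx := hkn x (fun k hk => hk.1) 0 (by omega)
  have hky := hkn y (fun k hk => hk.2.2) 0 (by omega)
  have hkw := hkp w (fun k hk => hk.1.symm) (4 * R' + 2 * R + 4) (by omega)
  have hkz := hkp z (fun k hk => hk.2.1.symm) (4 * R' + 2 * R + 4) (by omega)
  have hkneg : ∀ p, p ∈ (k 0).neg → ∀ i < 4 * R' + 2 * R + 5, p ∈ (k i).neg :=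
    fun p hp i hi => hk.neg_subset (Nat.zero_le i) hi hp
  have hkpos : ∀ p, p ∈ (k (4 * R' + 2 * R + 4)).pos → ∀ i < 4 * R' + 2 * R + 5, p ∈ (k i).pos :=
    fun p hp i hi => hk.pos_subset (by omega) (by omega) hp
  -- Each of the four ultrafilters supplies a point of `S` in its own quadrant.
  obtain ⟨p1, hp1, hp1'⟩ := hhx.exists_neg hkx
  obtain ⟨p2, hp2', hp2⟩ := hky.exists_pos hhy
  obtain ⟨p3, hp3, hp3'⟩ := hhw.exists_pos hkw
  obtain ⟨p4, hp4, hp4'⟩ := hhz.exists_pos hkz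
  have := hk.le_of_quadrants (hh 0 1 (by omega) (by omega))
    ⟨p1, hp1, hkneg _ hp1'⟩ ⟨p2, hp2, hkneg _ hp2'⟩ ⟨p3, hp3, hkpos _ hp3'⟩ ⟨p4, hp4, hkpos _ hp4'⟩
  omega

end CurtainDual

namespace CurtainDual

open Curtain WallUltrafilter

/-! ### Rough geodesics in hyperbolic spaces -/

section rough

variable {Y : Type*} [MetricSpace Y]

theorem exists_rough_geodesic_of_approx {x y : Y} {γ : ℝ → Y} {k e : ℝ}
    (h : ∀ s ∈ Icc 0 (dist x y), ∀ t ∈ Icc 0 (dist x y), abs (dist (γ s) (γ t) - |s - t|) ≤ k)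
    (h0 : dist (γ 0) x ≤ e) (h1 : dist (γ (dist x y)) y ≤ e) :
    ∃ γ' : ℝ → Y, γ' 0 = x ∧ γ' (dist x y) = y ∧
      ∀ s ∈ Icc 0 (dist x y), ∀ t ∈ Icc 0 (dist x y),
        abs (dist (γ' s) (γ' t) - |s - t|) ≤ k + 2 * e := by
  classical
  set γ' : ℝ → Y := fun s => if s = 0 then x else if s = dist x y then y else γ s with hγ'
  have hclose : ∀ s, dist (γ' s) (γ s) ≤ e := by
    intro s
    simp only [hγ']
    split_ifs with hs hs'
    · rw [hs, dist_comm]; exact h0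
    · rw [hs', dist_comm]; exact h1
    · rw [dist_self]; exact dist_nonneg.trans h0
  refine ⟨γ', by simp [hγ'], ?_, fun s hs t ht => ?_⟩
  · by_cases hxy : dist x y = 0
    · simp only [hγ', if_pos hxy]
      exact dist_eq_zero.1 hxy
    · simp [hγ', hxy]
  · have h2 := abs_le.1 (h s hs t ht)
    have h3 := hclose s
    have h4 := hclose t
    have t1 := dist_triangle4 (γ' s) (γ s) (γ t) (γ' t)
    have t2 := dist_triangle4 (γ s) (γ' s) (γ' t) (γ t)
    rw [dist_comm (γ t) (γ' t)] at t1
    rw [dist_comm (γ s) (γ' s)] at t2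
    rw [abs_le]
    constructor <;> linarith [h2.1, h2.2]

/-- Parametrise by distance from `p 0`: at time `s` take the first `p n` with distance at least `s`.
Bounded steps make that distance almost `s`, and almost additivity makes distances between terms
almost equal to differences of distances from `p 0`. -/
theorem exists_rough_geodesic_of_sequence (p : ℕ → Y) (N : ℕ) {K : ℝ} (hK : 0 ≤ K)
    (hadd : ∀ i j, i ≤ j → j ≤ N → dist (p 0) (p i) + dist (p i) (p j) ≤ dist (p 0) (p j) + K)
    (hstep : ∀ i < N, dist (p i) (p (i + 1)) ≤ K) :
    ∃ γ : ℝ → Y, γ 0 = p 0 ∧ γ (dist (p 0) (p N)) = p N ∧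
      ∀ s ∈ Icc 0 (dist (p 0) (p N)), ∀ t ∈ Icc 0 (dist (p 0) (p N)),
        abs (dist (γ s) (γ t) - |s - t|) ≤ 5 * K := by
  classical
  have hn : ∀ s, ∃ n, s ∈ Icc 0 (dist (p 0) (p N)) →
      n ≤ N ∧ s ≤ dist (p 0) (p n) ∧ dist (p 0) (p n) ≤ s + K := by
    intro s
    by_cases hs : s ∈ Icc 0 (dist (p 0) (p N))
    · have hex : ∃ n, s ≤ dist (p 0) (p n) := ⟨N, hs.2⟩
      refine ⟨Nat.find hex, fun _ => ⟨Nat.find_min' hex hs.2, Nat.find_spec hex, ?_⟩⟩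
      rcases Nat.eq_zero_or_pos (Nat.find hex) with h0 | h0
      · rw [h0, dist_self]; linarith [hs.1]
      · obtain ⟨i, hi⟩ : ∃ i, Nat.find hex = i + 1 := ⟨Nat.find hex - 1, by omega⟩
        have h1 := Nat.find_min hex (m := i) (by omega)
        have h2 := Nat.find_min' hex hs.2
        have h3 := hstep i (by omega)
        rw [hi]
        push Not at h1
        linarith [dist_triangle (p 0) (p i) (p (i + 1))]
    · exact ⟨0, fun h => absurd h hs⟩
  choose n hn using hn
  have hdist : ∀ i j, i ≤ N → j ≤ N →
      abs (dist (p i) (p j) - |dist (p 0) (p i) - dist (p 0) (p j)|) ≤ K := by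
    have key : ∀ i j, i ≤ j → j ≤ N →
        abs (dist (p i) (p j) - |dist (p 0) (p i) - dist (p 0) (p j)|) ≤ K := by
      intro i j hij hj
      have h1 := hadd i j hij hj
      have h2 := abs_dist_sub_le (p i) (p j) (p 0)
      rw [dist_comm (p i) (p 0), dist_comm (p j) (p 0)] at h2
      rw [abs_of_nonneg (by linarith)]
      linarith [neg_abs_le (dist (p 0) (p i) - dist (p 0) (p j))]
    intro i j hi hj
    rcases le_total i j with h | h
    · exact key i j h hj
    · rw [dist_comm (p i), abs_sub_comm (dist (p 0) (p i))]
      exact key j i h hi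
  have hD : (0 : ℝ) ≤ dist (p 0) (p N) := dist_nonneg
  have := exists_rough_geodesic_of_approx (x := p 0) (y := p N) (γ := fun s => p (n s))
    (k := 3 * K) (e := K) ?_ ?_ ?_
  · obtain ⟨γ, h1, h2, h3⟩ := this
    exact ⟨γ, h1, h2, fun s hs t ht => (h3 s hs t ht).trans (by linarith)⟩
  · intro s hs t ht
    obtain ⟨a1, a2, a3⟩ := hn s hs
    obtain ⟨b1, b2, b3⟩ := hn t ht
    have := abs_le.1 (hdist (n s) (n t) a1 b1)
    have h2 : |(|dist (p 0) (p (n s)) - dist (p 0) (p (n t))| - |s - t|)| ≤ 2 * K := by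
      refine (abs_abs_sub_abs_le_abs_sub _ _).trans ?_
      rw [abs_le]
      constructor <;> linarith
    have h2 := abs_le.1 h2
    rw [abs_le]
    constructor <;> linarith [this.1, this.2, h2.1, h2.2]
  · obtain ⟨a1, a2, a3⟩ := hn 0 ⟨le_rfl, hD⟩
    rw [dist_comm]
    linarith
  · obtain ⟨a1, a2, a3⟩ := hn _ ⟨hD, le_rfl⟩
    have := hadd _ _ a1 le_rfl
    linarith

/-- A hyperbolic space is roughly geodesic if a basepoint is joined to all points by rough
geodesics. -/
theorem isRoughlyGeodesic_of_basepoint (hY : IsFourPointHyperbolic Y) (o : Y) {k : ℝ}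
    (h : ∀ x : Y, ∃ γ : ℝ → Y, γ 0 = o ∧ γ (dist o x) = x ∧
      ∀ s ∈ Icc 0 (dist o x), ∀ t ∈ Icc 0 (dist o x), abs (dist (γ s) (γ t) - |s - t|) ≤ k) :
    IsRoughlyGeodesic Y := by
  obtain ⟨δ, hδ⟩ := hY
  choose c hc0 hc1 hc using h
  have hk : 0 ≤ k := (abs_nonneg _).trans (hc o 0 ⟨le_rfl, dist_nonneg⟩ 0 ⟨le_rfl, dist_nonneg⟩)
  have hδ0 : 0 ≤ δ := by
    have := hδ o o o o
    simpa using this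
  have hc2 : ∀ x, ∀ s ∈ Icc 0 (dist o x), ∀ t ∈ Icc 0 (dist o x), s ≤ t →
      dist (c x s) (c x t) ≤ t - s + k ∧ t - s - k ≤ dist (c x s) (c x t) := by
    intro x s hs t ht hst
    have := abs_le.1 (hc x s hs t ht)
    rw [abs_sub_comm s t, abs_of_nonneg (by linarith : 0 ≤ t - s)] at this
    constructor <;> linarith [this.1, this.2]
  set e : ℝ := 8 * k + 2 * δ with he
  suffices h : ∀ x y : Y, ∃ γ : ℝ → Y, dist (γ 0) x ≤ e ∧ dist (γ (dist x y)) y ≤ e ∧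
      ∀ s ∈ Icc 0 (dist x y), ∀ t ∈ Icc 0 (dist x y),
        abs (dist (γ s) (γ t) - |s - t|) ≤ 2 * k + e by
    refine ⟨2 * k + e + 2 * e, fun x y => ?_⟩
    obtain ⟨γ, h0, h1, h2⟩ := h x y
    exact exists_rough_geodesic_of_approx h2 h0 h1
  intro x y
  set a := dist o x with ha
  set b := dist o y with hb
  set ℓ := dist x y with hl
  have ha0 : 0 ≤ a := dist_nonneg
  have hb0 : 0 ≤ b := dist_nonneg
  have hl0 : 0 ≤ ℓ := dist_nonneg
  have t1 : ℓ ≤ a + b := dist_triangle_left x y o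
  have t2 : a ≤ b + ℓ := by rw [ha, hb, hl, dist_comm x y]; exact dist_triangle o y x
  have t3 : b ≤ a + ℓ := dist_triangle o x y
  -- The Gromov product of `x` and `y` at `o`. The rough geodesics to `x` and to `y` are close at
  -- time `p`, so following one back from `x` to that time and then the other on to `y` gives the
  -- desired path.
  set p := (a + b - ℓ) / 2 with hp
  have hp0 : 0 ≤ p := by linarith
  have hpa : p ≤ a := by linarith
  have hpb : p ≤ b := by linarith
  have hmid : dist (c x p) (c y p) ≤ e := by
    have q1 := hc2 x 0 ⟨le_rfl, ha0⟩ p ⟨hp0, hpa⟩ hp0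
    have q2 := hc2 y 0 ⟨le_rfl, hb0⟩ p ⟨hp0, hpb⟩ hp0
    have q3 := hc2 x p ⟨hp0, hpa⟩ a ⟨ha0, le_rfl⟩ hpa
    have q4 := hc2 y p ⟨hp0, hpb⟩ b ⟨hb0, le_rfl⟩ hpb
    rw [hc0] at q1 q2
    rw [hc1] at q3 q4
    -- The first four-point inequality bounds the distance from `c x p` to `y`; the second uses that
    -- bound to compare `c x p` with `c y p`.
    have f1 := hδ (c x p) y o x
    have f2 := hδ (c x p) (c y p) o y
    rw [dist_comm (c x p) o, dist_comm y x, dist_comm y o, ← hl, ← ha, ← hb] at f1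
    rw [dist_comm (c x p) o, dist_comm (c y p) o, ← hb] at f2
    have m1 : dist (c x p) y + a ≤ δ + a + b - p + 2 * k := by
      refine f1.trans ?_
      have : max (dist o (c x p) + ℓ) (dist (c x p) x + b) ≤ a + b - p + 2 * k :=
        max_le (by linarith) (by linarith)
      linarith
    have m2 : max (dist o (c x p) + dist (c y p) y) (dist (c x p) y + dist o (c y p)) ≤
        b + δ + 4 * k := max_le (by linarith) (by linarith)
    linarith
  set γ : ℝ → Y := fun s => if s ≤ a - p then c x (a - s) else c y (b - ℓ + s) with hγ
  have hpℓ : a - p ≤ ℓ := by linarith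
  have hmix : ∀ s ∈ Icc 0 ℓ, ∀ t ∈ Icc 0 ℓ, s ≤ a - p → a - p ≤ t →
      |dist (c x (a - s)) (c y (b - ℓ + t)) - (t - s)| ≤ 2 * k + e := by
    intro s hs t ht hsp htp
    have u1 := hc2 x p ⟨hp0, hpa⟩ (a - s) ⟨by linarith, by linarith [hs.1]⟩ (by linarith)
    have v1 := hc2 y p ⟨hp0, hpb⟩ (b - ℓ + t) ⟨by linarith, by linarith [ht.2]⟩ (by linarith)
    have u2 := hc2 x (a - s) ⟨by linarith, by linarith [hs.1]⟩ a ⟨ha0, le_rfl⟩ (by linarith [hs.1])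
    have v2 := hc2 y (b - ℓ + t) ⟨by linarith, by linarith [ht.2]⟩ b ⟨hb0, le_rfl⟩
      (by linarith [ht.2])
    rw [hc1] at u2 v2
    have d1 := dist_triangle4 (c x (a - s)) (c x p) (c y p) (c y (b - ℓ + t))
    have d2 := dist_triangle4 x (c x (a - s)) (c y (b - ℓ + t)) y
    rw [dist_comm (c x (a - s)) (c x p)] at d1
    rw [dist_comm x (c x (a - s))] at d2
    rw [abs_le]
    constructor <;> linarith
  refine ⟨γ, ?_, ?_, ?_⟩
  · simp only [hγ, if_pos (show 0 ≤ a - p by linarith), sub_zero]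
    rw [hc1, dist_self]
    linarith
  · simp only [hγ]
    split_ifs with hlt
    · have := abs_le.1 (hmix ℓ ⟨hl0, le_rfl⟩ ℓ ⟨hl0, le_rfl⟩ hlt hpℓ)
      have hpb' : p = b := by linarith
      have hpl : a - ℓ = p := by linarith
      rw [hpl]
      have hyb : c y p = y := by rw [hpb']; exact hc1 y
      rw [hyb] at hmid
      exact hmid
    · rw [show b - ℓ + ℓ = b by ring, hc1, dist_self]
      linarith
  · have key : ∀ s ∈ Icc 0 ℓ, ∀ t ∈ Icc 0 ℓ, s ≤ t →
        |dist (γ s) (γ t) - (t - s)| ≤ 2 * k + e := by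
      intro s hs t ht hst
      simp only [hγ]
      split_ifs with h1 h2 h2
      · have := hc2 x (a - t) ⟨by linarith, by linarith [ht.1]⟩ (a - s)
          ⟨by linarith, by linarith [hs.1]⟩ (by linarith)
        rw [dist_comm, abs_le]
        constructor <;> linarith
      · exact hmix s hs t ht h1 (not_le.1 h2).le
      · linarith
      · have := hc2 y (b - ℓ + s) ⟨by linarith, by linarith [hs.2]⟩ (b - ℓ + t)
          ⟨by linarith, by linarith [ht.2]⟩ (by linarith)
        rw [abs_le]
        constructor <;> linarith
    intro s hs t ht
    rcases le_total s t with hst | hst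
    · rw [abs_sub_comm s t, abs_of_nonneg (by linarith : 0 ≤ t - s)]
      exact key s hs t ht hst
    · rw [dist_comm, abs_of_nonneg (by linarith : 0 ≤ s - t)]
      exact key t ht s hs hst

end rough

variable {S : Type*} [MetricSpace S]

/-! ### Graded sizes of sets of walls, and hyperbolicity -/

/-- The weighted sum `∑ λ_R R`. -/
noncomputable def Weights.total (w : Weights) : ℝ≥0 := ∑' R : ℕ+, w.lam R * ((R : ℕ) : ℝ≥0)

/-- The weighted sum of the sizes of chains in a set of walls. -/
noncomputable def gradedSize (w : Weights) (W : Set (curtainWalls S)) : ℝ≥0∞ :=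
  ∑' R : ℕ+, (w.lam R : ℝ≥0∞) * (chainSize R W : ℝ≥0∞)

theorem gradedEDist_eq_gradedSize (w : Weights) (x y : WallUltrafilter (curtainWalls S)) :
    gradedEDist (fun R => ballSystem S R) w.lam x y = gradedSize w (sep x y) := rfl

theorem gradedSize_mono (w : Weights) {W W' : Set (curtainWalls S)} (h : W ⊆ W') :
    gradedSize w W ≤ gradedSize w W' := by
  refine ENNReal.tsum_le_tsum fun R => ?_
  gcongr
  exact chainSize_mono h

theorem gradedSize_le_add (w : Weights) {W W₁ W₂ : Set (curtainWalls S)} (h : W ⊆ W₁ ∪ W₂) :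
    gradedSize w W ≤ gradedSize w W₁ + gradedSize w W₂ := by
  rw [gradedSize, gradedSize, gradedSize, ← ENNReal.tsum_add]
  refine ENNReal.tsum_le_tsum fun R => ?_
  rw [← mul_add, ← ENat.toENNReal_add]
  gcongr
  exact chainSize_le_add h

theorem tsum_lam_mul_natCast (w : Weights) (C : ℕ) :
    ∑' R : ℕ+, (w.lam R : ℝ≥0∞) * ((C * R : ℕ) : ℝ≥0∞) = C * w.total := by
  rw [Weights.total, ENNReal.coe_tsum w.summable, ← ENNReal.tsum_mul_left]
  congr 1
  ext R
  push_cast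
  ring

theorem gradedSize_le_of_chainSize_le (w : Weights) {W : Set (curtainWalls S)} (C : ℕ)
    (h : ∀ R : ℕ+, chainSize R W ≤ ((C * R : ℕ) : ℕ∞)) : gradedSize w W ≤ C * w.total := by
  rw [← tsum_lam_mul_natCast]
  refine ENNReal.tsum_le_tsum fun R => ?_
  gcongr
  simpa using ENat.toENNReal_le.2 (h R)

/-- Gluing at each scale costs `6 * R + 12 ≤ 18 * R`, which is summable against the weights. -/
theorem gradedSize_sepBoth_add_le [GeodesicSpace S] (w : Weights)
    (x y z : WallUltrafilter (curtainWalls S)) :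
    gradedSize w (sepBoth x y z) + gradedSize w (sepBoth y x z) ≤
      gradedSize w (sep x y) + 18 * w.total := by
  have := tsum_lam_mul_natCast w 18
  rw [Nat.cast_ofNat] at this
  rw [← this, gradedSize, gradedSize, gradedSize, ← ENNReal.tsum_add, ← ENNReal.tsum_add]
  refine ENNReal.tsum_le_tsum fun R => ?_
  rw [← mul_add, ← mul_add, ← ENat.toENNReal_add]
  gcongr
  have h1 := chainSize_sepBoth_add_le (R : ℕ) x y z
  have h2 : ((6 * R + 12 : ℕ) : ℕ∞) ≤ ((18 * R : ℕ) : ℕ∞) := by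
    have := R.pos
    exact Nat.cast_le.2 (by omega)
  simpa using ENat.toENNReal_le.2 (h1.trans (add_le_add_right h2 _))

theorem sep_subset_sepBoth_union (x y z : WallUltrafilter (curtainWalls S)) :
    sep x y ⊆ sepBoth x y z ∪ sepBoth y x z := by
  intro k hk
  by_cases h : x.half k = z.half k
  · exact Or.inr ⟨Ne.symm hk, fun h' => hk (h.trans h'.symm)⟩
  · exact Or.inl ⟨hk, h⟩

/-- A wall that separates `x` from `y` and `z` either separates `x` from `v` too or induces the
partition `{x, v} | {y, z}`; walls separating `x` from `z` and `v` behave similarly with `{x, y} |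
{v, z}`. Only one of these transverse partitions can be large. -/
theorem min_gradedSize_sepBoth_le [GeodesicSpace S] (w : Weights)
    (x y z v : WallUltrafilter (curtainWalls S)) :
    min (gradedSize w (sepBoth x y z)) (gradedSize w (sepBoth x z v)) ≤
      gradedSize w (sepBoth x y v) + 12 * w.total := by
  have h1 : sepBoth x y z ⊆ sepBoth x y v ∪ sepPair x v y z := by
    intro k hk
    by_cases h : x.half k = v.half k
    · exact Or.inr ⟨hk.1, hk.2, fun h' => hk.1 (h.trans h')⟩
    · exact Or.inl ⟨hk.1, h⟩
  have h2 : sepBoth x z v ⊆ sepBoth x y v ∪ sepPair x y v z := by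
    intro k hk
    by_cases h : x.half k = y.half k
    · exact Or.inr ⟨hk.2, hk.1, fun h' => hk.2 (h.trans h')⟩
    · exact Or.inl ⟨h, hk.2⟩
  have cross : ∀ R R' : ℕ+, R ≤ R' → ∀ y v : WallUltrafilter (curtainWalls S),
      ((12 * R : ℕ) : ℕ∞) < chainSize R (sepPair x v y z) →
      chainSize R' (sepPair x y v z) ≤ ((12 * R' : ℕ) : ℕ∞) := by
    intro R R' hR y v hlt
    have hR' : (R : ℕ) ≤ R' := hR
    have hpos := R.pos
    refine (chainSize_sepPair_le (R := R) (le_trans ?_ hlt.le)).trans ?_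
    · exact Nat.cast_le.2 (by omega)
    · exact Nat.cast_le.2 (by omega)
  -- The negligible partition must be the same at all scales, as the minimum is taken after
  -- summation. If both were large, at scales `R` and `R'`, the crossing bound would fail at the
  -- larger scale.
  have hdich : (∀ R : ℕ+, chainSize R (sepPair x v y z) ≤ ((12 * R : ℕ) : ℕ∞)) ∨
      (∀ R : ℕ+, chainSize R (sepPair x y v z) ≤ ((12 * R : ℕ) : ℕ∞)) := by
    by_contra! hcon
    obtain ⟨⟨R, hR⟩, R', hR'⟩ := hcon
    rcases le_total R R' with h | h
    · exact absurd (cross R R' h y v hR) (not_le.2 hR')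
    · exact absurd (cross R' R h v y hR') (not_le.2 hR)
  rcases hdich with h | h
  · refine (min_le_left _ _).trans ((gradedSize_le_add w h1).trans (add_le_add_right ?_ _))
    exact_mod_cast gradedSize_le_of_chainSize_le w 12 h
  · refine (min_le_right _ _).trans ((gradedSize_le_add w h2).trans (add_le_add_right ?_ _))
    exact_mod_cast gradedSize_le_of_chainSize_le w 12 h

/-! ### Overlaps as Gromov products, and the four-point condition -/

theorem dist_eq_gradedSize (w : Weights) (x y : GradedDual S w) :
    dist x y = (gradedSize w (sep x.1 y.1)).toReal := rfl

theorem gradedSize_sep_ne_top (w : Weights) (x y : GradedDual S w) :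
    gradedSize w (sep x.1 y.1) ≠ ⊤ := gradedEDist_ne_top w x y

/-- The graded number of walls that separate `x` from both `y` and `z`. -/
noncomputable def overlap {w : Weights} (x y z : GradedDual S w) : ℝ :=
  (gradedSize w (sepBoth x.1 y.1 z.1)).toReal

theorem gradedSize_sepBoth_ne_top (w : Weights) (x y z : GradedDual S w) :
    gradedSize w (sepBoth x.1 y.1 z.1) ≠ ⊤ :=
  ne_top_of_le_ne_top (gradedSize_sep_ne_top w x y) (gradedSize_mono w inter_subset_left)

theorem overlap_comm {w : Weights} (x y z : GradedDual S w) : overlap x y z = overlap x z y := by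
  rw [overlap, overlap, sepBoth, sepBoth, inter_comm]

theorem overlap_add_le [GeodesicSpace S] {w : Weights} (x y z : GradedDual S w) :
    overlap x y z + overlap y x z ≤ dist x y + 18 * w.total := by
  have h := gradedSize_sepBoth_add_le w x.1 y.1 z.1
  have hf := gradedSize_sep_ne_top w x y
  rw [overlap, overlap, ← ENNReal.toReal_add (gradedSize_sepBoth_ne_top w _ _ _)
    (gradedSize_sepBoth_ne_top w _ _ _)]
  have hc : (18 * w.total : ℝ≥0∞) ≠ ⊤ := ENNReal.mul_ne_top (by simp) (by simp)
  refine (ENNReal.toReal_mono (ENNReal.add_ne_top.2 ⟨hf, hc⟩) h).trans ?_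
  rw [ENNReal.toReal_add hf hc, dist_eq_gradedSize]
  simp

theorem dist_le_overlap_add {w : Weights} (x y z : GradedDual S w) :
    dist x y ≤ overlap x y z + overlap y x z := by
  rw [overlap, overlap, ← ENNReal.toReal_add (gradedSize_sepBoth_ne_top w _ _ _)
    (gradedSize_sepBoth_ne_top w _ _ _)]
  exact ENNReal.toReal_mono (ENNReal.add_ne_top.2
    ⟨gradedSize_sepBoth_ne_top w _ _ _, gradedSize_sepBoth_ne_top w _ _ _⟩)
    (gradedSize_le_add w (sep_subset_sepBoth_union _ _ _))

theorem min_overlap_le [GeodesicSpace S] {w : Weights} (x y z v : GradedDual S w) :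
    min (overlap x y z) (overlap x z v) ≤ overlap x y v + 12 * w.total := by
  have h := min_gradedSize_sepBoth_le w x.1 y.1 z.1 v.1
  have hf := gradedSize_sepBoth_ne_top w x y v
  have hc : (12 * w.total : ℝ≥0∞) ≠ ⊤ := ENNReal.mul_ne_top (by simp) (by simp)
  have h' := ENNReal.toReal_mono (ENNReal.add_ne_top.2 ⟨hf, hc⟩) h
  rw [ENNReal.toReal_add hf hc, ENNReal.toReal_min (gradedSize_sepBoth_ne_top w _ _ _)
    (gradedSize_sepBoth_ne_top w _ _ _)] at h'
  simpa [overlap] using h'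

theorem isFourPointHyperbolic_gradedDual [GeodesicSpace S] (w : Weights) :
    IsFourPointHyperbolic (GradedDual S w) := by
  -- Overlaps agree with Gromov products up to the errors 18 and 36 below, and Gromov's inequality
  -- for overlaps costs 12, doubled: 18 + 36 + 24 = 78.
  refine ⟨78 * w.total, fun y v x z => ?_⟩
  have gp1 : ∀ x y z : GradedDual S w,
      dist x y + dist x z - dist y z ≤ 2 * overlap x y z + 18 * w.total := by
    intro x y z
    have h1 := dist_le_overlap_add x y z
    have h2 := dist_le_overlap_add x z y
    have h3 := overlap_add_le y z x
    rw [overlap_comm x z y] at h2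
    rw [overlap_comm y z x, overlap_comm z y x] at h3
    linarith
  have gp2 : ∀ x y z : GradedDual S w,
      2 * overlap x y z ≤ dist x y + dist x z - dist y z + 36 * w.total := by
    intro x y z
    have h1 := overlap_add_le x y z
    have h2 := overlap_add_le x z y
    have h3 := dist_le_overlap_add y z x
    rw [overlap_comm x z y] at h2
    rw [overlap_comm y z x, overlap_comm z y x] at h3
    linarith
  have h := min_overlap_le x y z v
  have h1 := gp1 x y z
  have h2 := gp1 x z v
  have h3 := gp2 x y v
  rw [dist_comm y x, dist_comm v z, dist_comm v x]
  rcases min_le_iff.1 h with h | h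
  · have := le_max_right (dist x y + dist z v) (dist y z + dist x v)
    linarith
  · have := le_max_left (dist x y + dist z v) (dist y z + dist x v)
    linarith

end CurtainDual

namespace CurtainDual

open Curtain WallUltrafilter

/-! ### Gates -/

namespace WallUltrafilter

variable {S : Type*} {P : Set (Wall S)}

open Classical in
/-- The gate of `x` in a nonempty set `A ⊆ S`: flip those walls whose halfspace chosen by `x` is
disjoint from `A`. -/
noncomputable def gate (A : Set S) (hA : A.Nonempty) (x : WallUltrafilter P) :
    WallUltrafilter P where
  half k := if A ⊆ (x.half k)ᶜ then (x.half k)ᶜ else x.half k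
  half_mem k := by
    split_ifs
    · exact compl_mem (x.half_mem k)
    · exact x.half_mem k
  consistent k l B hB hsub := by
    by_cases hl : x.half l = B
    · have : ¬ A ⊆ (x.half l)ᶜ := by
        intro h
        split_ifs at hsub with h'
        · obtain ⟨a, ha⟩ := hA
          exact h ha (hl ▸ hsub (h' ha))
        · exact h' (h.trans (compl_subset_compl.2 (hl ▸ hsub)))
      rw [if_neg this, hl]
    · have hl' : (x.half l)ᶜ = B :=
        (eq_or_eq_compl_of_mem (compl_mem (x.half_mem l)) hB).resolve_right
          (fun h => hl (compl_injective h))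
      split_ifs at hsub with h'
      · rw [if_pos (by rw [hl']; exact h'.trans hsub), hl']
      · exact absurd (x.consistent k l B hB hsub) hl

theorem gate_half_of_subset {A : Set S} (hA : A.Nonempty) {x : WallUltrafilter P} {k : P}
    (h : A ⊆ (x.half k)ᶜ) : (x.gate A hA).half k = (x.half k)ᶜ := if_pos h

theorem gate_half_of_not_subset {A : Set S} (hA : A.Nonempty) {x : WallUltrafilter P} {k : P}
    (h : ¬ A ⊆ (x.half k)ᶜ) : (x.gate A hA).half k = x.half k := if_neg h

theorem principal_half_eq {s : S} {k : P} {A : Set S} (hA : A ∈ k.1.1) (hs : s ∈ A) :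
    (principal P s).half k = A := by
  refine (eq_or_eq_compl_of_mem ((principal P s).half_mem k) hA).resolve_right fun h => ?_
  have := mem_principal_half P s k
  rw [h] at this
  exact this hs

/-- Every wall that separates `x` from `y` separates `z` from exactly one of them. -/
def Between (x z y : WallUltrafilter P) : Prop :=
  ∀ k, z.half k = x.half k ∨ z.half k = y.half k

theorem Between.symm {x z y : WallUltrafilter P} (h : Between x z y) : Between y z x :=
  fun k => (h k).symm

/-- A wall flipped for `A` ends up on the side containing `A`, hence `s`; a wall not flipped for `A`
is not flipped for the larger set `B` either. -/
theorem between_principal_gate {A B : Set S} (hA : A.Nonempty) (hB : B.Nonempty) (hAB : A ⊆ B)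
    {s : S} (hs : s ∈ A) (x : WallUltrafilter P) :
    Between (principal P s) (x.gate A hA) (x.gate B hB) := by
  intro k
  by_cases h : A ⊆ (x.half k)ᶜ
  · left
    rw [gate_half_of_subset hA h, principal_half_eq (compl_mem (x.half_mem k)) (h hs)]
  · right
    rw [gate_half_of_not_subset hA h, gate_half_of_not_subset hB fun h' => h (hAB.trans h')]

theorem between_principal_gate_self {A : Set S} (hA : A.Nonempty) {s : S} (hs : s ∈ A)
    (x : WallUltrafilter P) : Between (principal P s) (x.gate A hA) x := by
  intro k
  by_cases h : A ⊆ (x.half k)ᶜ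
  · left
    rw [gate_half_of_subset hA h, principal_half_eq (compl_mem (x.half_mem k)) (h hs)]
  · right
    rw [gate_half_of_not_subset hA h]

theorem gate_singleton (s : S) (x : WallUltrafilter P) :
    x.gate {s} (singleton_nonempty s) = principal P s := by
  ext1
  funext k
  by_cases h : s ∈ x.half k
  · rw [gate_half_of_not_subset _ (by simpa using h), principal_half_eq (x.half_mem k) h]
  · rw [gate_half_of_subset _ (by simpa using h),
      principal_half_eq (compl_mem (x.half_mem k)) h]

end WallUltrafilter

variable {S : Type*} [MetricSpace S]

theorem WallUltrafilter.Between.sep_subset {x y z : WallUltrafilter (curtainWalls S)}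
    (h : Between x z y) : sep x z ⊆ sepBoth x y z := by
  intro k hk
  refine ⟨?_, hk⟩
  rcases h k with h' | h'
  · exact absurd h'.symm hk
  · intro he
    exact hk (he.trans h'.symm)

/-- Walls that separate `x` from an intermediate `z` also separate `x` from `y`, so `dist x z ≤
overlap x y z`, and likewise from `y`; the gluing estimate bounds the sum of the two overlaps. -/
theorem dist_add_dist_le_of_between [GeodesicSpace S] {w : Weights} {x y z : GradedDual S w}
    (h : Between x.1 z.1 y.1) : dist x z + dist z y ≤ dist x y + 18 * w.total := by
  refine le_trans (add_le_add ?_ ?_) (overlap_add_le x y z)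
  · exact ENNReal.toReal_mono (gradedSize_sepBoth_ne_top w _ _ _)
      (gradedSize_mono w h.sep_subset)
  · rw [dist_comm]
    exact ENNReal.toReal_mono (gradedSize_sepBoth_ne_top w _ _ _)
      (gradedSize_mono w h.symm.sep_subset)

theorem closedBall_natCast_nonempty (t : S) (n : ℕ) : (closedBall t (n : ℝ)).Nonempty :=
  nonempty_closedBall.2 n.cast_nonneg

/-- The gate of `x` in a closed ball, as a point of the graded dual. -/
noncomputable def GradedDual.gateBall [GeodesicSpace S] {w : Weights} (t : S) (n : ℕ)
    (x : GradedDual S w) : GradedDual S w :=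
  ⟨x.1.gate (closedBall t n) (closedBall_natCast_nonempty t n), fun s => by
    refine (gradedEDist_triangle w _ x.1 _).trans_lt (ENNReal.add_lt_top.2 ⟨x.2 s, ?_⟩)
    refine lt_of_le_of_lt ?_ (x.2 t)
    rw [gradedEDist_eq_gradedSize, gradedEDist_eq_gradedSize, sep_comm (principal _ t)]
    have := (between_principal_gate_self (closedBall_natCast_nonempty t n)
      (mem_closedBall_self n.cast_nonneg : t ∈ closedBall t n) x.1).symm
    exact gradedSize_mono w (this.sep_subset.trans inter_subset_left)⟩

namespace GradedDual

variable [GeodesicSpace S] {w : Weights}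

theorem gateBall_zero (t : S) (x : GradedDual S w) : gateBall t 0 x = toGradedDual w t := by
  apply Subtype.ext
  change x.1.gate (closedBall t (0 : ℕ)) (closedBall_natCast_nonempty t 0) = principal _ t
  rw [← gate_singleton t x.1]
  simp only [Nat.cast_zero, closedBall_zero]

/-- Five separating walls would give three curtains that the larger ball crosses completely and the
smaller ball barely enters, although the radii differ by 1. -/
theorem chainSize_sep_gate_succ_le (R : ℕ) (t : S) (n : ℕ) (x : GradedDual S w) :
    chainSize R (sep (gateBall t n x).1 (gateBall t (n + 1) x).1) ≤ (4 : ℕ) := by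
  by_contra! hlt
  have hle := Order.add_one_le_of_lt hlt
  have hsub : closedBall t (n : ℝ) ⊆ closedBall t ((n + 1 : ℕ) : ℝ) :=
    closedBall_subset_closedBall (by push_cast; linarith)
  have hn1 := closedBall_natCast_nonempty t n
  have hn2 := closedBall_natCast_nonempty t (n + 1)
  obtain ⟨h, hh, hhn, hhp⟩ := exists_separating_chain (n := 3) (by omega) _ _ subset_rfl
    (by exact_mod_cast hle)
  have hneg := hhn _ subset_rfl
  have hpos := hhp _ (by rw [sep_comm])
  have hsubset : ∀ i < 3, closedBall t (n : ℝ) ⊆ (h i).neg ∪ (h i).body ∧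
      ∃ p ∈ closedBall t ((n + 1 : ℕ) : ℝ), p ∈ (h i).pos := by
    intro i hi
    have h1 : (x.1.gate (closedBall t (n : ℝ)) hn1).half (h i).posWall = (h i).neg ∪ (h i).body :=
      (hneg i hi).half_posWall
    have h2 : (x.1.gate (closedBall t ((n + 1 : ℕ) : ℝ)) hn2).half (h i).posWall = (h i).pos :=
      hpos i hi
    have hne : (h i).neg ∪ (h i).body ≠ (h i).pos := by
      rw [← Curtain.compl_neg_union_body]
      have : Nonempty S := ⟨t⟩
      exact ne_compl_self
    -- If the larger ball missed the halfspace chosen by `x`, both gates would flip the wall and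
    -- agree. So the larger ball meets that halfspace, and the smaller one misses it.
    by_cases hb : closedBall t ((n + 1 : ℕ) : ℝ) ⊆ (x.1.half (h i).posWall)ᶜ
    · rw [gate_half_of_subset hn2 hb] at h2
      rw [gate_half_of_subset hn1 (hsub.trans hb)] at h1
      exact absurd (h1.symm.trans h2) hne
    · rw [gate_half_of_not_subset hn2 hb] at h2
      obtain ⟨p, hp, hp'⟩ := not_subset.1 hb
      rw [notMem_compl_iff, h2] at hp'
      refine ⟨?_, p, hp, hp'⟩
      by_cases hb' : closedBall t (n : ℝ) ⊆ (x.1.half (h i).posWall)ᶜ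
      · rwa [h2, ← Curtain.compl_neg_union_body, compl_compl] at hb'
      · rw [gate_half_of_not_subset hn1 hb'] at h1
        exact absurd (h1.symm.trans h2) hne
  obtain ⟨-, p, hp, hp'⟩ := hsubset 2 (by omega)
  obtain ⟨h0, -⟩ := hsubset 0 (by omega)
  obtain ⟨β, ℓ, hβ, rfl, rfl⟩ := GeodesicSpace.exists_geodesic t p
  rw [mem_closedBall, dist_comm, hβ.dist_endpoints] at hp
  push_cast at hp
  have hmin0 : 0 ≤ min ℓ n := le_min hβ.1 n.cast_nonneg
  -- This point of the geodesic from `t` to `p` lies in the smaller ball and is within 1 of `p`, yet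
  -- `h 1` and `h 2` separate it from `p`.
  have hu : β (min ℓ n) ∈ (h 1).neg := by
    have := h0 (show β (min ℓ n) ∈ closedBall (β 0) n by
      rw [mem_closedBall, dist_comm, hβ.dist_eq le_rfl hmin0 (min_le_left _ _), sub_zero]
      exact min_le_right _ _)
    rcases this with h' | h'
    · exact hh.neg_subset (by omega) (by omega) h'
    · exact (hh 0 1 (by omega) (by omega)).1 h'
  have h1 := hh.le_dist (show 1 ≤ 2 by omega) (by omega) hu hp'
  rw [hβ.dist_eq hmin0 (min_le_left _ _) le_rfl] at h1
  have : ℓ - 1 ≤ min ℓ n := le_min (by linarith) (by linarith)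
  push_cast at h1
  linarith

theorem dist_gateBall_succ_le (t : S) (n : ℕ) (x : GradedDual S w) :
    dist (gateBall t n x) (gateBall t (n + 1) x) ≤ 4 * w.total := by
  rw [dist_eq_gradedSize]
  have : gradedSize w (sep (gateBall t n x).1 (gateBall t (n + 1) x).1) ≤ (4 : ℕ) * w.total := by
    refine gradedSize_le_of_chainSize_le w 4 fun R => (chainSize_sep_gate_succ_le _ _ _ _).trans ?_
    have := R.pos
    exact Nat.cast_le.2 (by omega)
  have := ENNReal.toReal_mono (ENNReal.mul_ne_top (by simp) (by simp)) this
  simpa using this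

end GradedDual

theorem exists_subset_of_le_chainSize {R n : ℕ} {W : Set (curtainWalls S)}
    (hW : (n : ℕ∞) ≤ chainSize R W) : ∃ c ∈ ballSystem S R, c ⊆ W ∧ c.encard = n := by
  rcases Nat.eq_zero_or_pos n with rfl | hn
  · refine ⟨∅, ⟨∅, fun i => i.2.elim, fun i => i.2.elim, fun i => i.2.elim, fun i => i.2.elim,
      fun i => i.2.elim, ?_⟩, by simp, by simp⟩
    simp only [image_empty, range_eq_empty]
  · obtain ⟨n, rfl⟩ : ∃ n', n = n' + 1 := ⟨n - 1, by omega⟩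
    have hlt : (n : ℕ∞) < chainSize R W :=
      lt_of_lt_of_le (by exact_mod_cast Nat.lt_succ_self n) hW
    obtain ⟨c, hlt⟩ := lt_iSup_iff.1 hlt
    obtain ⟨⟨hc, hcW⟩, hlt⟩ := lt_iSup_iff.1 hlt
    obtain ⟨c', hc', hcard⟩ := exists_subset_encard_eq (Order.add_one_le_of_lt hlt)
    exact ⟨c', ballSystem_subset hc hc', fun k hk => hcW k (hc' hk), by rw [hcard]; simp⟩

namespace GradedDual

variable [GeodesicSpace S] {w : Weights}

-- The size is finite since `λ_R > 0`, so it is realised by a finite chain. Each of its walls is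
-- eventually unflipped, because large balls meet the nonempty halfspace chosen by `x`.
open Filter in
theorem eventually_chainSize_le (R : ℕ+) (t : S) (n : ℕ) (x : GradedDual S w) :
    ∀ᶠ m in atTop, chainSize R (sep (gateBall t n x).1 x.1) ≤
      chainSize R (sep (gateBall t n x).1 (gateBall t m x).1) := by
  have hfin : chainSize R (sep (gateBall t n x).1 x.1) ≠ ⊤ := by
    intro h
    have := ENNReal.ne_top_of_tsum_ne_top (gradedSize_sep_ne_top w (gateBall t n x) x) R
    rw [h, ENat.toENNReal_top, ENNReal.mul_top (by simpa using (w.lam_pos R).ne')] at this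
    exact this rfl
  obtain ⟨N, hN⟩ := ENat.ne_top_iff_exists.1 hfin
  obtain ⟨c, hc, hcW, hcard⟩ := exists_subset_of_le_chainSize hN.le
  have hcfin : c.Finite := by
    rw [← encard_lt_top_iff, hcard]
    exact ENat.natCast_lt_top _
  have hev : ∀ k ∈ c, ∀ᶠ m : ℕ in atTop, (gateBall t m x).1.half k = x.1.half k := by
    intro k _
    have : Nonempty S := ⟨t⟩
    obtain ⟨p, hp⟩ := x.1.half_nonempty k
    obtain ⟨M, hM⟩ := exists_nat_ge (dist p t)
    filter_upwards [eventually_ge_atTop M] with m hm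
    refine gate_half_of_not_subset (closedBall_natCast_nonempty t m) fun h =>
      h (mem_closedBall.2 (hM.trans ?_)) hp
    exact_mod_cast hm
  filter_upwards [(eventually_all_finite hcfin).2 hev] with m hm
  rw [← hN, ← hcard]
  refine encard_le_chainSize hc fun k hk => ?_
  change _ ≠ _
  rw [hm k hk]
  exact hcW hk

theorem between_principal_gateBall (t : S) {n m : ℕ} (hnm : n ≤ m) (x : GradedDual S w) :
    Between (toGradedDual w t).1 (gateBall t n x).1 (gateBall t m x).1 :=
  between_principal_gate (closedBall_natCast_nonempty t n) (closedBall_natCast_nonempty t m)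
    (closedBall_subset_closedBall (by exact_mod_cast hnm))
    (mem_closedBall_self n.cast_nonneg) x.1

theorem between_principal_gateBall_self (t : S) (n : ℕ) (x : GradedDual S w) :
    Between (toGradedDual w t).1 (gateBall t n x).1 x.1 :=
  between_principal_gate_self (closedBall_natCast_nonempty t n)
    (mem_closedBall_self n.cast_nonneg) x.1

-- Distances of gates from the basepoint are bounded. At an index where they are within 1 of their
-- supremum, a gate far from `x` would also be far from a later gate, and almost additivity would
-- push that gate beyond the supremum.
open Filter in
theorem exists_dist_gateBall_le (t : S) (x : GradedDual S w) :
    ∃ n, dist (gateBall t n x) x ≤ 18 * w.total + 2 := by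
  by_contra! hfar
  set F : ℕ → ℝ := fun n => dist (toGradedDual w t) (gateBall t n x) with hF
  have hbdd : BddAbove (range F) := by
    refine ⟨dist (toGradedDual w t) x + 18 * w.total, ?_⟩
    rintro _ ⟨n, rfl⟩
    have := dist_add_dist_le_of_between (between_principal_gateBall_self t n x)
    have h0 : 0 ≤ dist (gateBall t n x) x := dist_nonneg
    simp only [hF]
    linarith
  obtain ⟨_, ⟨n, rfl⟩, hn⟩ := exists_lt_of_lt_csSup (range_nonempty F)
    (show sSup (range F) - 1 < sSup (range F) by linarith)
  have hlt := hfar n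
  rw [dist_eq_gradedSize, ← ENNReal.ofReal_lt_iff_lt_toReal (by positivity)
    (gradedSize_sep_ne_top w _ _), gradedSize, ENNReal.tsum_eq_iSup_sum] at hlt
  -- A finite partial sum already exceeds the bound, and one index `m` serves finitely many scales.
  obtain ⟨s, hs⟩ := lt_iSup_iff.1 hlt
  have hev : ∀ᶠ m in atTop, n ≤ m ∧ ∀ R ∈ s, chainSize R (sep (gateBall t n x).1 x.1) ≤
      chainSize R (sep (gateBall t n x).1 (gateBall t m x).1) :=
    (eventually_ge_atTop n).and
      ((eventually_all_finset s).2 fun R _ => eventually_chainSize_le R t n x)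
  obtain ⟨m, hnm, hm⟩ := hev.exists
  have hd : 18 * w.total + 2 < dist (gateBall t n x) (gateBall t m x) := by
    rw [dist_eq_gradedSize, ← ENNReal.ofReal_lt_iff_lt_toReal (by positivity)
      (gradedSize_sep_ne_top w _ _)]
    refine hs.trans_le (le_trans (Finset.sum_le_sum fun R hR => ?_) (ENNReal.sum_le_tsum s))
    gcongr
    exact hm R hR
  have h1 := dist_add_dist_le_of_between (between_principal_gateBall t hnm x)
  have h2 : F m ≤ sSup (range F) := le_csSup hbdd ⟨m, rfl⟩
  simp only [hF] at h2 hn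
  linarith

theorem exists_rough_geodesic_toGradedDual (t : S) (x : GradedDual S w) :
    ∃ γ : ℝ → GradedDual S w, γ 0 = toGradedDual w t ∧ γ (dist (toGradedDual w t) x) = x ∧
      ∀ a ∈ Icc 0 (dist (toGradedDual w t) x), ∀ b ∈ Icc 0 (dist (toGradedDual w t) x),
        abs (dist (γ a) (γ b) - |a - b|) ≤ 5 * (18 * w.total + 2) := by
  obtain ⟨N, hN⟩ := exists_dist_gateBall_le t x
  have ht0 : (0 : ℝ) ≤ w.total := w.total.coe_nonneg
  set p : ℕ → GradedDual S w := fun i => if i ≤ N then gateBall t i x else x with hp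
  have hp0 : p 0 = toGradedDual w t := by simp [hp, gateBall_zero]
  have hpN : p (N + 1) = x := by simp [hp]
  have := exists_rough_geodesic_of_sequence p (N + 1) (K := 18 * w.total + 2) (by positivity)
    ?_ ?_
  · rwa [hp0, hpN] at this
  · intro i j hij hj
    rw [hp0]
    suffices h : Between (toGradedDual w t).1 (p i).1 (p j).1 by
      linarith [dist_add_dist_le_of_between h]
    simp only [hp]
    split_ifs with h1 h2
    · exact between_principal_gateBall t hij x
    · exact between_principal_gateBall_self t i x
    · omega
    · exact fun k => Or.inr rfl
  · intro i hi
    simp only [hp]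
    split_ifs with h1 h2
    · linarith [dist_gateBall_succ_le t i x]
    · obtain rfl : i = N := by omega
      exact hN
    · omega
    · omega

end GradedDual

theorem isRoughlyGeodesic_gradedDual [GeodesicSpace S] (w : Weights) :
    IsRoughlyGeodesic (GradedDual S w) := by
  rcases isEmpty_or_nonempty S with hS | ⟨⟨t⟩⟩
  · refine ⟨0, fun x y => ?_⟩
    have : x = y := by
      apply Subtype.ext
      ext1
      funext ⟨k, c, _⟩
      exact hS.elim (c.γ 0)
    subst this
    refine ⟨fun _ => x, rfl, rfl, fun s hs t ht => ?_⟩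
    rw [dist_self, Icc_self, mem_singleton_iff] at hs ht
    simp [hs, ht]
  · exact isRoughlyGeodesic_of_basepoint (isFourPointHyperbolic_gradedDual w)
      (toGradedDual w t) (fun x => GradedDual.exists_rough_geodesic_toGradedDual t x)

end CurtainDual

namespace CurtainDual

open Curtain WallUltrafilter

variable {S : Type*} [MetricSpace S]

/-! ### The action of the isometry group -/

theorem closestPoints_image (g : S ≃ᵢ S) (A : Set S) (x : S) :
    closestPoints (g '' A) (g x) = g '' closestPoints A x := by
  ext p
  constructor
  · rintro ⟨⟨a, ha, rfl⟩, h⟩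
    refine ⟨a, ⟨ha, fun p' hp' => ?_⟩, rfl⟩
    have := h (g p') ⟨p', hp', rfl⟩
    rwa [g.dist_eq, g.dist_eq] at this
  · rintro ⟨a, ⟨ha, h⟩, rfl⟩
    refine ⟨⟨a, ha, rfl⟩, ?_⟩
    rintro _ ⟨p', hp', rfl⟩
    rw [g.dist_eq, g.dist_eq]
    exact h p' hp'

theorem IsStronglyContracting.image (g : S ≃ᵢ S) {A : Set S} {D : ℝ}
    (hA : IsStronglyContracting D A) : IsStronglyContracting D (g '' A) := by
  intro x r hd
  have hball : ball x r = g '' ball (g.symm x) r := by rw [g.image_ball]; simp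
  have hunion : (⋃ y ∈ ball x r, closestPoints (g '' A) y) =
      g '' ⋃ y ∈ ball (g.symm x) r, closestPoints A y := by
    rw [hball, biUnion_image, image_iUnion₂]
    simp only [closestPoints_image]
  rw [hball, disjoint_image_iff g.injective] at hd
  rw [hunion, g.isometry.ediam_image]
  exact hA _ _ hd

theorem IsGeodesicSegment.map (g : S ≃ᵢ S) {γ : ℝ → S} {ℓ : ℝ} (h : IsGeodesicSegment γ ℓ) :
    IsGeodesicSegment (g ∘ γ) ℓ :=
  ⟨h.1, fun s hs t ht => by rw [Function.comp, Function.comp, g.dist_eq, h.2 s hs t ht]⟩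

namespace Curtain

/-- The image of a curtain under an isometry. -/
def map (g : S ≃ᵢ S) (c : Curtain S) : Curtain S where
  D := c.D
  one_le_D := c.one_le_D
  γ := g ∘ c.γ
  geodesic := c.geodesic.map g
  contracting := by
    rw [image_comp]
    exact c.contracting.image g
  a := c.a
  a_pos := c.a_pos
  a_lt := c.a_lt

theorem map_axis (g : S ≃ᵢ S) (c : Curtain S) : (c.map g).axis = g '' c.axis :=
  image_comp g c.γ _

theorem map_neg (g : S ≃ᵢ S) (c : Curtain S) : (c.map g).neg = g '' c.neg := by
  ext x
  obtain ⟨x, rfl⟩ := g.surjective x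
  rw [g.injective.mem_set_image]
  change (_ ∩ (g ∘ c.γ) '' _).Nonempty ↔ _
  rw [map_axis, closestPoints_image, image_comp, ← image_inter g.injective, image_nonempty]
  rfl

theorem map_pos (g : S ≃ᵢ S) (c : Curtain S) : (c.map g).pos = g '' c.pos := by
  ext x
  obtain ⟨x, rfl⟩ := g.surjective x
  rw [g.injective.mem_set_image]
  change (_ ∩ (g ∘ c.γ) '' _).Nonempty ↔ _
  rw [map_axis, closestPoints_image, image_comp, ← image_inter g.injective, image_nonempty]
  rfl

theorem map_body (g : S ≃ᵢ S) (c : Curtain S) : (c.map g).body = g '' c.body := by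
  ext x
  obtain ⟨x, rfl⟩ := g.surjective x
  rw [g.injective.mem_set_image]
  change _ ⊆ (g ∘ c.γ) '' _ ↔ _
  rw [map_axis, closestPoints_image, image_comp, image_subset_image_iff g.injective]
  rfl

theorem BallSeparated.map (g : S ≃ᵢ S) {R : ℕ} {h k : Curtain S} (hs : BallSeparated R h k) :
    BallSeparated R (h.map g) (k.map g) := by
  obtain ⟨h1, h2, z, r, hr0, hr, hb, h3⟩ := hs
  refine ⟨?_, ?_, g z, r, hr0, hr, ?_, fun β ℓ hβ h0 hℓ => ?_⟩
  · rw [map_body, map_neg]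
    exact image_mono h1
  · rw [map_body, map_pos]
    exact image_mono h2
  · rw [map_pos, map_neg, ← image_inter g.injective, ← g.image_closedBall]
    exact image_mono hb
  · rw [map_neg] at h0
    rw [map_pos] at hℓ
    obtain ⟨p, hp, hp'⟩ := h0
    obtain ⟨q, hq, hq'⟩ := hℓ
    obtain ⟨t, ht, hz⟩ := h3 (g.symm ∘ β) ℓ (hβ.map g.symm)
      (by rw [Function.comp, ← hp', g.symm_apply_apply]; exact hp)
      (by rw [Function.comp, ← hq', g.symm_apply_apply]; exact hq)
    refine ⟨t, ht, ?_⟩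
    rw [mem_closedBall, ← g.symm.dist_eq, g.symm_apply_apply]
    exact hz

end Curtain

/-- The image of a wall under an isometry. -/
def Wall.map (g : S ≃ᵢ S) (k : Wall S) : Wall S :=
  ⟨image g '' k.1, by
    obtain ⟨_, A, rfl⟩ := k
    exact ⟨g '' A, by rw [image_pair, image_compl_eq g.bijective]⟩⟩

theorem Wall.map_of (g : S ≃ᵢ S) (A : Set S) : Wall.map g (Wall.of A) = Wall.of (g '' A) := by
  apply Subtype.ext
  change image g '' {A, Aᶜ} = {g '' A, (g '' A)ᶜ}
  rw [image_pair, image_compl_eq g.bijective]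

/-- The action of isometries on the walls induced by curtains. -/
def mapWall (g : S ≃ᵢ S) (k : curtainWalls S) : curtainWalls S :=
  ⟨Wall.map g k.1, by
    obtain ⟨k, c, rfl | rfl⟩ := k
    · exact ⟨c.map g, Or.inl (by rw [Wall.map_of, Curtain.map_neg])⟩
    · exact ⟨c.map g, Or.inr (by rw [Wall.map_of, Curtain.map_neg, map_body, image_union])⟩⟩

theorem mapWall_mul (g g' : S ≃ᵢ S) (k : curtainWalls S) :
    mapWall (g * g') k = mapWall g (mapWall g' k) := by
  apply Subtype.ext
  apply Subtype.ext
  change image (g * g') '' k.1.1 = image g '' (image g' '' k.1.1)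
  rw [image_image]
  simp only [image_image]
  rfl

theorem mapWall_one (k : curtainWalls S) : mapWall 1 k = k := by
  apply Subtype.ext
  apply Subtype.ext
  change image (1 : S ≃ᵢ S) '' k.1.1 = k.1.1
  simp

theorem mapWall_inv_apply (g : S ≃ᵢ S) (k : curtainWalls S) : mapWall g⁻¹ (mapWall g k) = k := by
  rw [← mapWall_mul, inv_mul_cancel, mapWall_one]

theorem mapWall_apply_inv (g : S ≃ᵢ S) (k : curtainWalls S) : mapWall g (mapWall g⁻¹ k) = k := by
  rw [← mapWall_mul, mul_inv_cancel, mapWall_one]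

theorem image_mapWall_mem_ballSystem (g : S ≃ᵢ S) {R : ℕ} {c : Set (curtainWalls S)}
    (hc : c ∈ ballSystem S R) : mapWall g '' c ∈ ballSystem S R := by
  obtain ⟨J, h, m, hm, hch, hsep, hr⟩ := hc
  refine ⟨J, fun i => (h i).map g, fun i => g '' m i, fun i => ?_,
    fun i j hij => image_mono (hch i j hij), fun i j hij => (hsep i j hij).map g, ?_⟩
  · rw [Curtain.map_neg, map_body, ← image_union]
    exact (hm i).imp (congrArg _) (congrArg _)
  · have : (Subtype.val '' (mapWall g '' c)) = Wall.map g '' (Subtype.val '' c) := by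
      rw [image_image, image_image]
      rfl
    rw [this, hr, ← range_comp]
    congr 1
    funext i
    exact Wall.map_of g (m i)

namespace WallUltrafilter

/-- The action of isometries on ultrafilters. -/
def map (g : S ≃ᵢ S) (x : WallUltrafilter (curtainWalls S)) :
    WallUltrafilter (curtainWalls S) where
  half k := g '' x.half (mapWall g⁻¹ k)
  half_mem k := by
    obtain ⟨k, rfl⟩ : ∃ k', k = mapWall g k' := ⟨_, (mapWall_apply_inv g k).symm⟩
    rw [mapWall_inv_apply]
    exact mem_image_of_mem (image g) (x.half_mem k)
  consistent k l A hA hsub := by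
    obtain ⟨l, rfl⟩ : ∃ l', l = mapWall g l' := ⟨_, (mapWall_apply_inv g l).symm⟩
    obtain ⟨A, hA, rfl⟩ := hA
    rw [image_subset_image_iff g.injective] at hsub
    rw [mapWall_inv_apply, x.consistent _ l A hA hsub]

theorem map_half_mapWall (g : S ≃ᵢ S) (x : WallUltrafilter (curtainWalls S))
    (k : curtainWalls S) : (x.map g).half (mapWall g k) = g '' x.half k := by
  change g '' x.half (mapWall g⁻¹ (mapWall g k)) = _
  rw [mapWall_inv_apply]

theorem ext_mapWall (g : S ≃ᵢ S) {x y : WallUltrafilter (curtainWalls S)}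
    (h : ∀ k, x.half (mapWall g k) = y.half (mapWall g k)) : x = y := by
  ext1
  funext k
  rw [← mapWall_apply_inv g k]
  exact h _

theorem map_mul (g g' : S ≃ᵢ S) (x : WallUltrafilter (curtainWalls S)) :
    x.map (g * g') = (x.map g').map g := by
  refine ext_mapWall (g * g') fun k => ?_
  rw [map_half_mapWall, mapWall_mul, map_half_mapWall, map_half_mapWall, image_image]
  rfl

theorem map_one (x : WallUltrafilter (curtainWalls S)) : x.map 1 = x := by
  refine ext_mapWall 1 fun k => ?_
  rw [map_half_mapWall, mapWall_one]
  simp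

theorem map_principal (g : S ≃ᵢ S) (s : S) :
    (principal (curtainWalls S) s).map g = principal _ (g s) := by
  refine ext_mapWall g fun k => ?_
  rw [map_half_mapWall]
  exact (principal_half_eq (mem_image_of_mem (image g) (half_mem _ k))
    (mem_image_of_mem g (mem_principal_half _ s k))).symm

theorem chainSize_sep_le_map (g : S ≃ᵢ S) (R : ℕ) (x y : WallUltrafilter (curtainWalls S)) :
    chainSize R (sep x y) ≤ chainSize R (sep (x.map g) (y.map g)) := by
  refine iSup₂_le fun c hc => ?_
  have hinj : Function.Injective (mapWall g) :=
    Function.LeftInverse.injective (g := mapWall g⁻¹) (mapWall_inv_apply g)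
  rw [← hinj.encard_image]
  refine encard_le_chainSize (image_mapWall_mem_ballSystem g hc.1) ?_
  rintro _ ⟨k, hk, rfl⟩
  change _ ≠ _
  rw [map_half_mapWall, map_half_mapWall, g.injective.image_injective.ne_iff]
  exact hc.2 k hk

/-- Images of separating chains are separating chains, which gives one inequality; the inverse
isometry gives the other. -/
theorem gradedEDist_map (g : S ≃ᵢ S) (w : Weights) (x y : WallUltrafilter (curtainWalls S)) :
    gradedEDist (fun R => ballSystem S R) w.lam (x.map g) (y.map g) =
      gradedEDist (fun R => ballSystem S R) w.lam x y := by
  have key : ∀ (g : S ≃ᵢ S) (x y : WallUltrafilter (curtainWalls S)),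
      gradedEDist (fun R => ballSystem S R) w.lam x y ≤
        gradedEDist (fun R => ballSystem S R) w.lam (x.map g) (y.map g) := by
    intro g x y
    refine ENNReal.tsum_le_tsum fun R => ?_
    gcongr
    exact chainSize_sep_le_map g R x y
  refine le_antisymm ?_ (key g x y)
  have := key g⁻¹ (x.map g) (y.map g)
  rwa [← map_mul, ← map_mul, inv_mul_cancel, map_one, map_one] at this

end WallUltrafilter

namespace GradedDual

/-- The action of isometries on the graded dual. -/
def map {w : Weights} (g : S ≃ᵢ S) (x : GradedDual S w) : GradedDual S w :=
  ⟨x.1.map g, fun s => by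
    obtain ⟨s, rfl⟩ := g.surjective s
    rw [← map_principal, gradedEDist_map]
    exact x.2 s⟩

theorem map_mul {w : Weights} (g g' : S ≃ᵢ S) (x : GradedDual S w) :
    x.map (g * g') = (x.map g').map g :=
  Subtype.ext (WallUltrafilter.map_mul g g' x.1)

theorem map_one {w : Weights} (x : GradedDual S w) : x.map 1 = x :=
  Subtype.ext (WallUltrafilter.map_one x.1)

/-- The isometric action of `Isom S` on the graded dual. -/
noncomputable def isometryAction (w : Weights) : (S ≃ᵢ S) →* (GradedDual S w ≃ᵢ GradedDual S w) :=
  MonoidHom.mk' (fun g =>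
    { toFun := map g
      invFun := map g⁻¹
      left_inv := fun x => by rw [← map_mul, inv_mul_cancel, map_one]
      right_inv := fun x => by rw [← map_mul, mul_inv_cancel, map_one]
      isometry_toFun := Isometry.of_dist_eq fun x y =>
        congrArg ENNReal.toReal (gradedEDist_map g w x.1 y.1) })
    fun g g' => by
      ext1 x
      exact map_mul g g' x

end GradedDual

/-! ### The natural map is coarsely Lipschitz -/

theorem chainSize_sep_principal_le [GeodesicSpace S] (R : ℕ) (s t : S) :
    (chainSize R (sep (principal _ s) (principal _ t)) : ℝ≥0∞) ≤
      ENNReal.ofReal (2 * dist s t + 4) := by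
  have h1 := ENat.toENNReal_le.2 (wallDist_principal_le R s t)
  rw [wallDist_eq_chainSize] at h1
  refine h1.trans ?_
  rw [ENat.toENNReal_coe, ← ENNReal.ofReal_natCast]
  refine ENNReal.ofReal_le_ofReal ?_
  push_cast
  linarith [Nat.floor_le (dist_nonneg (x := s) (y := t))]

theorem Weights.summable_lam (w : Weights) : Summable w.lam := by
  refine NNReal.summable_of_le (fun R => ?_) w.summable
  have : (1 : ℝ≥0) ≤ ((R : ℕ) : ℝ≥0) := by exact_mod_cast R.pos
  exact le_mul_of_one_le_right zero_le this

/-- The linear bound on chains is the same at every scale, so only summability of the weights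
themselves is needed. -/
theorem dist_toGradedDual_le [GeodesicSpace S] (w : Weights) (s t : S) :
    dist (toGradedDual w s) (toGradedDual w t) ≤ (∑' R, w.lam R : ℝ≥0) * (2 * dist s t + 4) := by
  have h : gradedSize w (sep (principal _ s) (principal _ t)) ≤
      (∑' R, w.lam R : ℝ≥0) * ENNReal.ofReal (2 * dist s t + 4) := by
    rw [ENNReal.coe_tsum w.summable_lam, ← ENNReal.tsum_mul_right]
    refine ENNReal.tsum_le_tsum fun R => ?_
    gcongr
    exact chainSize_sep_principal_le R s t
  have h' := ENNReal.toReal_mono (ENNReal.mul_ne_top (by simp) (by simp)) h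
  rw [ENNReal.toReal_mul, ENNReal.toReal_ofReal (by positivity)] at h'
  exact h'

end CurtainDual

namespace CurtainDual

open Curtain WallUltrafilter

variable {S : Type*} [MetricSpace S]

/-! ### Projections to strongly contracting sets -/

theorem infDist_eq_of_mem_closestPoints {A : Set S} {x p : S} (hp : p ∈ closestPoints A x) :
    infDist x A = dist x p :=
  le_antisymm (infDist_le_dist_of_mem hp.1) ((le_infDist ⟨p, hp.1⟩).2 fun _ h => hp.2 _ h)

namespace IsStronglyContracting

variable {A : Set S} {D : ℝ}

/-- Along a geodesic far from a contracting set, projections move slowly. -/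
theorem dist_le_of_far (hA : IsStronglyContracting D A)
    (hne : ∀ x, (closestPoints A x).Nonempty) {β : ℝ → S} {ℓ u v : ℝ}
    (hβ : IsGeodesicSegment β ℓ) (hu : 0 ≤ u) (huv : u ≤ v) (hv : v ≤ ℓ)
    (hfar : ∀ s ∈ Ico u v, 4 * D < infDist (β s) A) {p q : S}
    (hp : p ∈ closestPoints A (β u)) (hq : q ∈ closestPoints A (β v)) :
    dist p q ≤ (v - u) / 4 + D := by
  have hD := hA.pos (β 0)
  have step : ∀ u v : ℝ, 0 ≤ u → u ≤ v → v ≤ ℓ → (∀ s ∈ Ico u v, 4 * D < infDist (β s) A) →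
      ∀ p q, p ∈ closestPoints A (β u) → q ∈ closestPoints A (β v) → v - u < 4 * D →
      dist p q ≤ D := by
    intro u v hu huv hv hfar p q hp hq hlt
    rcases huv.eq_or_lt with rfl | huv'
    -- Here `hfar` is vacuous, but two closest points of the same point still have to be compared.
    · by_cases h0 : dist (β u) p = 0
      · have : β u = p := dist_eq_zero.1 h0
        rw [this] at hq
        rw [closestPoints_self hp.1] at hq
        rw [hq, dist_self]
        exact hD.le
      · exact (hA.dist_lt hp hq (by rw [dist_self]; positivity)).le
    · refine (hA.dist_lt hp hq ?_).le
      have := hfar u ⟨le_rfl, huv'⟩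
      rw [infDist_eq_of_mem_closestPoints hp] at this
      rw [hβ.dist_eq hu huv hv]
      linarith
  have key : ∀ n : ℕ, ∀ v q, u ≤ v → v ≤ ℓ → (∀ s ∈ Ico u v, 4 * D < infDist (β s) A) →
      q ∈ closestPoints A (β v) → v - u < 4 * D * (n + 1) → dist p q ≤ (n + 1) * D := by
    intro n
    induction n with
    | zero =>
      intro v q huv hv hfar hq hlt
      simpa using step u v hu huv hv hfar p q hp hq (by simpa using hlt)
    | succ n ih =>
      intro v q huv hv hfar hq hlt
      push_cast at hlt ⊢
      have hn : (0 : ℝ) < n + 1 + 1 := by positivity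
      -- Equal steps keep every step strictly shorter than `4 * D`, as the contraction estimate
      -- requires.
      set d := (v - u) / (n + 1 + 1) with hd
      have hd0 : 0 ≤ d := div_nonneg (by linarith) hn.le
      have hd1 : d < 4 * D := by rw [hd, div_lt_iff₀ hn]; exact hlt
      have hdv : d * (n + 1 + 1) = v - u := div_mul_cancel₀ _ hn.ne'
      have hdn : 0 ≤ d * (n + 1) := by positivity
      have hdlt : d * (n + 1) < 4 * D * (n + 1) := by gcongr
      obtain ⟨r, hr⟩ := hne (β (v - d))
      have h1 := ih (v - d) r (by linarith) (by linarith)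
        (fun s hs => hfar s ⟨hs.1, by linarith [hs.2]⟩) hr (by linarith)
      have h2 := step (v - d) v (by linarith) (by linarith) hv
        (fun s hs => hfar s ⟨by linarith [hs.1], hs.2⟩) r q hr hq (by linarith)
      linarith [dist_triangle p r q]
  have h1 := key ⌊(v - u) / (4 * D)⌋₊ v q huv hv hfar hq (by
    have := Nat.lt_floor_add_one ((v - u) / (4 * D))
    rwa [div_lt_iff₀ (by positivity), mul_comm] at this)
  have h2 := Nat.floor_le (a := (v - u) / (4 * D)) (div_nonneg (by linarith) (by positivity))
  rw [le_div_iff₀ (by positivity)] at h2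
  linarith

/-- A geodesic whose endpoints project far apart passes close to the projection of its starting
point. -/
theorem exists_dist_le (hA : IsStronglyContracting D A)
    (hne : ∀ x, (closestPoints A x).Nonempty) {β : ℝ → S} {ℓ : ℝ} (hβ : IsGeodesicSegment β ℓ)
    {p q : S} (hp : p ∈ closestPoints A (β 0)) (hq : q ∈ closestPoints A (β ℓ))
    (hpq : 5 * D ≤ dist p q) : ∃ s ∈ Icc 0 ℓ, dist (β s) p ≤ 9 * D := by
  have hD := hA.pos (β 0)
  have hℓ := hβ.1
  set H := dist (β 0) p with hH
  set H' := dist (β ℓ) q with hH'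
  have hH0 : 0 ≤ H := dist_nonneg
  have hend := hβ.dist_endpoints
  have htri : ℓ ≤ H + dist p q + H' := by
    have := dist_triangle4 (β 0) p q (β ℓ)
    rw [dist_comm q] at this
    linarith
  -- Either the first point within `4 * D` of `A` is the one sought, or the whole geodesic is far
  -- from `A`. In the second case projections move at quarter speed, so `dist p q ≤ 3 * D + (dist p
  -- q + 2 * D) / 4`, contrary to `5 * D ≤ dist p q`.
  by_cases hV : ∃ s ∈ Icc 0 ℓ, infDist (β s) A ≤ 4 * D
  · have hcont : ContinuousOn (fun s => infDist (β s) A) (Icc 0 ℓ) :=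
      (continuous_infDist_pt A).comp_continuousOn hβ.continuousOn
    have hclosed : IsCompact {s | s ∈ Icc 0 ℓ ∧ infDist (β s) A ≤ 4 * D} :=
      isCompact_Icc.of_isClosed_subset
        (hcont.preimage_isClosed_of_isClosed isClosed_Icc isClosed_Iic)
        (fun s hs => hs.1)
    obtain ⟨s₀, ⟨hs₀, hle⟩, hmin⟩ := hclosed.exists_isLeast hV
    obtain ⟨r, hr⟩ := hne (β s₀)
    rw [infDist_eq_of_mem_closestPoints hr] at hle
    have hfar : ∀ s, 0 ≤ s → s < s₀ → 4 * D < infDist (β s) A := by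
      intro s hs0 hs
      by_contra! hcon
      have := hmin ⟨⟨hs0, hs.le.trans hs₀.2⟩, hcon⟩
      linarith
    refine ⟨s₀, hs₀, ?_⟩
    rcases lt_or_ge s₀ H with hlt | hge
    · have := hA.dist_lt hp hr (by rw [hβ.dist_eq le_rfl hs₀.1 hs₀.2]; linarith)
      linarith [dist_triangle_right (β s₀) p r]
    · rcases hH0.eq_or_lt with h0 | hpos
      · have hpβ : β 0 = p := dist_eq_zero.1 h0.symm
        rcases hs₀.1.eq_or_lt with he | hlt0
        · rw [← he, ← hH]
          linarith
        · have := hfar 0 le_rfl hlt0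
          rw [infDist_eq_of_mem_closestPoints hp] at this
          linarith
      -- Until just before time `H` projections stay within `D` of `p`; from there to `s₀` they move
      -- at quarter speed, while `s₀` exceeds `H` by at most `dist p r + 4 * D`. The two bounds
      -- close up.
      · set η := min D H with hη
        have hη0 : 0 < η := lt_min hD hpos
        have hηD : η ≤ D := min_le_left _ _
        have hηH : η ≤ H := min_le_right _ _
        obtain ⟨r', hr'⟩ := hne (β (H - η))
        have h1 := hA.dist_lt hp hr'
          (by rw [hβ.dist_eq le_rfl (by linarith) (by linarith [hs₀.2])]; linarith)
        have h2 := hA.dist_le_of_far hne hβ (u := H - η) (v := s₀) (by linarith) (by linarith)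
          hs₀.2 (fun s hs => hfar s (by linarith [hs.1]) hs.2) hr' hr
        have h3 := dist_triangle p r' r
        have h4 := dist_triangle4 (β 0) p r (β s₀)
        rw [hβ.dist_eq le_rfl hs₀.1 hs₀.2, dist_comm r (β s₀)] at h4
        have h5 := dist_triangle_right (β s₀) p r
        linarith
  · push Not at hV
    exfalso
    have hH4 : 4 * D < H := by
      have := hV 0 ⟨le_rfl, hℓ⟩
      rwa [infDist_eq_of_mem_closestPoints hp] at this
    have hHℓ : H ≤ ℓ := by
      by_contra! hlt
      have := hA.dist_lt hp hq (by rw [hend]; exact hlt)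
      linarith
    have hH4' : 4 * D < H' := by
      have := hV ℓ ⟨hℓ, le_rfl⟩
      rwa [infDist_eq_of_mem_closestPoints hq] at this
    have hHℓ' : H' ≤ ℓ := by
      by_contra! hlt
      have := hA.dist_lt hq hp (by rw [dist_comm, hend]; exact hlt)
      rw [dist_comm] at this
      linarith
    obtain ⟨r, hr⟩ := hne (β (H - D))
    have h1 := hA.dist_lt hp hr
      (by rw [hβ.dist_eq le_rfl (by linarith) (by linarith)]; linarith)
    rcases le_or_gt (ℓ - H' + D) (H - D) with hle | hlt
    · have h2 := hA.dist_lt hq hr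
        (by rw [dist_comm, hβ.dist_eq (by linarith) (by linarith) le_rfl]; linarith)
      linarith [dist_triangle_right p q r]
    · obtain ⟨r', hr'⟩ := hne (β (ℓ - H' + D))
      have h2 := hA.dist_lt hq hr'
        (by rw [dist_comm, hβ.dist_eq (by linarith) (by linarith) le_rfl]; linarith)
      have h3 := hA.dist_le_of_far hne hβ (u := H - D) (v := ℓ - H' + D) (by linarith)
        hlt.le (by linarith) (fun s hs => hV s ⟨by linarith [hs.1], by linarith [hs.2]⟩) hr hr'
      have h4 := dist_triangle4 p r r' q
      rw [dist_comm r' q] at h4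
      linarith

variable [GeodesicSpace S]

theorem exists_between_dist_le (hA : IsStronglyContracting D A)
    (hne : ∀ x, (closestPoints A x).Nonempty) {x y p q : S}
    (hp : p ∈ closestPoints A x) (hq : q ∈ closestPoints A y) (hpq : 5 * D ≤ dist p q) :
    ∃ z, dist x z + dist z y = dist x y ∧ dist z p ≤ 9 * D := by
  obtain ⟨β, ℓ, hβ, rfl, rfl⟩ := GeodesicSpace.exists_geodesic x y
  obtain ⟨s, hs, hsp⟩ := hA.exists_dist_le hne hβ hp hq hpq
  refine ⟨β s, ?_, hsp⟩
  rw [hβ.dist_eq le_rfl hs.1 hs.2, hβ.dist_eq hs.1 hs.2 le_rfl, hβ.dist_endpoints]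
  ring

theorem dist_add_dist_le (hA : IsStronglyContracting D A)
    (hne : ∀ x, (closestPoints A x).Nonempty) {x y p q : S}
    (hp : p ∈ closestPoints A x) (hq : q ∈ closestPoints A y) (hpq : 5 * D ≤ dist p q) :
    dist x p + dist p y ≤ dist x y + 18 * D := by
  obtain ⟨z, hz, hzp⟩ := hA.exists_between_dist_le hne hp hq hpq
  have h1 := dist_triangle x z p
  have h2 := dist_triangle_left p y z
  linarith

theorem dist_add_dist_add_dist_le (hA : IsStronglyContracting D A)
    (hne : ∀ x, (closestPoints A x).Nonempty) {x y p q : S}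
    (hp : p ∈ closestPoints A x) (hq : q ∈ closestPoints A y) (hpq : 5 * D ≤ dist p q) :
    dist x p + dist p q + dist y q ≤ dist x y + 36 * D := by
  have h1 := hA.dist_add_dist_le hne hp hq hpq
  have h2 := hA.dist_add_dist_le hne hq (y := p) (q := p) (by rw [closestPoints_self hp.1]; rfl)
    (by rwa [dist_comm])
  rw [dist_comm q p, dist_comm y p] at h2
  linarith

/-- Geodesics with endpoints in a contracting set stay close to it. -/
theorem dist_le_of_between (hA : IsStronglyContracting D A)
    (hne : ∀ x, (closestPoints A x).Nonempty) {a b z p : S} (ha : a ∈ A) (hb : b ∈ A)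
    (hz : dist a z + dist z b = dist a b) (hp : p ∈ closestPoints A z) : dist z p ≤ 18 * D := by
  have hD := hA.pos a
  have hpa := hp.2 a ha
  have hpb := hp.2 b hb
  have hab := dist_triangle a p b
  rw [dist_comm a z] at hz
  have key : ∀ c ∈ A, dist p c < 5 * D ∨ dist z p + dist p c ≤ dist z c + 18 * D := by
    intro c hc
    rcases lt_or_ge (dist p c) (5 * D) with h | h
    · exact Or.inl h
    · exact Or.inr (hA.dist_add_dist_le hne hp (q := c) (by rw [closestPoints_self hc]; rfl) h)
  rw [dist_comm a p] at hab
  rcases key a ha with h1 | h1 <;> rcases key b hb with h2 | h2 <;> linarith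

end IsStronglyContracting

/-! ### Quasigeodesics and geodesics that track them -/

/-- A coarse intermediate value theorem for an arbitrary predicate, by moving in steps of length at
most 1. It replaces continuity of projections and of quasigeodesics. -/
theorem exists_crossing {Q : ℝ → Prop} {u v : ℝ} (huv : u ≤ v) (hu : Q u) (hv : ¬ Q v) :
    ∃ s ∈ Icc u v, ∃ t ∈ Icc u v, s ≤ t ∧ t - s ≤ 1 ∧ Q s ∧ ¬ Q t := by
  by_contra! hcon
  have key : ∀ n : ℕ, ∀ s ∈ Icc u v, s - u ≤ n → Q s := by
    intro n
    induction n with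
    | zero =>
      intro s hs hsn
      have : s = u := le_antisymm (by simpa using hsn) hs.1
      rwa [this]
    | succ n ih =>
      intro s hs hsn
      push_cast at hsn
      have hm : max u (s - 1) ∈ Icc u v :=
        ⟨le_max_left _ _, max_le huv (by linarith [hs.2])⟩
      refine hcon _ hm s hs (max_le hs.1 (by linarith)) (by linarith [le_max_right u (s - 1)])
        (ih _ hm ?_)
      rcases max_choice u (s - 1) with h | h <;> rw [h]
      · simp
      · linarith
  obtain ⟨n, hn⟩ := exists_nat_ge (v - u)
  exact hv (key n v ⟨huv, le_rfl⟩ hn)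

theorem IsQIEmbeddingOn.abs_sub_le {q : ℝ} (hq : 1 ≤ q) {I : Set ℝ} {α : ℝ → S}
    (hα : IsQIEmbeddingOn q I α) {s t : ℝ} (hs : s ∈ I) (ht : t ∈ I) :
    |s - t| ≤ q * (dist (α s) (α t) + q) := by
  have := (hα s hs t ht).1
  rw [sub_le_iff_le_add, div_le_iff₀ (by linarith)] at this
  linarith

section tracking

variable {q N M : ℝ} {I : Set ℝ} {α β : ℝ → S}

/-- The constant to which connectedness of a geodesic in the `N`-neighbourhood of a
`q`-quasigeodesic forces it to approach points of the quasigeodesic. -/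
def trackingConst (q N : ℝ) : ℝ := q * (q * (2 * N + 1 + q)) + q + N

theorem dist_le_trackingConst (hq : 1 ≤ q) (hα : IsQIEmbeddingOn q I α) {x y : S} {i k l : ℝ}
    (hi : i ∈ I) (hk : k ∈ I) (hl : l ∈ I) (hxy : dist x y ≤ 1) (hx : dist x (α k) ≤ N)
    (hy : dist y (α l) ≤ N) (hikl : i ∈ uIcc k l) : dist x (α i) ≤ trackingConst q N := by
  have h1 := hα.abs_sub_le hq hk hl
  have h2 : dist (α k) (α l) ≤ 2 * N + 1 := by
    have := dist_triangle4 (α k) x y (α l)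
    rw [dist_comm (α k) x] at this
    linarith
  have h3 : |k - i| ≤ |k - l| := by
    rw [abs_sub_comm k i, abs_sub_comm k l]
    exact abs_sub_left_of_mem_uIcc hikl
  have h4 := (hα k hk i hi).2
  have h5 : q * (dist (α k) (α l) + q) ≤ q * (2 * N + 1 + q) := by gcongr
  have h6 : q * |k - i| ≤ q * (q * (2 * N + 1 + q)) := by
    gcongr
    linarith
  have := dist_triangle x (α k) (α i)
  rw [trackingConst]
  linarith

/-- The parameters of nearby points of `α` must pass from one side of `i` to the other within a step
of length 1 along `β`; both of these parameters are then close to `i`. -/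
theorem exists_dist_le_trackingConst (hq : 1 ≤ q) (hα : IsQIEmbeddingOn q I α) {ℓ u v : ℝ}
    (hβ : IsGeodesicSegment β ℓ) (hu : 0 ≤ u) (huv : u ≤ v) (hv : v ≤ ℓ)
    (hN : ∀ s ∈ Icc u v, ∃ k ∈ I, dist (β s) (α k) ≤ N) {i k l : ℝ} (hi : i ∈ I) (hk : k ∈ I)
    (hl : l ∈ I) (hku : dist (β u) (α k) ≤ N) (hlv : dist (β v) (α l) ≤ N)
    (hikl : i ∈ uIcc k l) : ∃ s ∈ Icc u v, dist (β s) (α i) ≤ trackingConst q N := by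
  have hself : ∀ x : S, dist x x ≤ 1 := fun x => by rw [dist_self]; exact zero_le_one
  have key : ∀ Q : ℝ → Prop, (∀ a b, Q a → ¬ Q b → i ∈ uIcc a b) → Q k → ¬ Q l →
      ∃ s ∈ Icc u v, dist (β s) (α i) ≤ trackingConst q N := by
    intro Q hQ hQk hQl
    choose! κ hκI hκ using hN
    have hu' : u ∈ Icc u v := ⟨le_rfl, huv⟩
    have hv' : v ∈ Icc u v := ⟨huv, le_rfl⟩
    by_cases h1 : Q (κ u)
    · by_cases h2 : Q (κ v)
      · exact ⟨v, hv', dist_le_trackingConst hq hα hi (hκI v hv') hl (hself _) (hκ v hv') hlv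
          (hQ _ _ h2 hQl)⟩
      · obtain ⟨s, hs, t, ht, hst, hst', hs1, ht1⟩ :=
          exists_crossing (Q := fun s => Q (κ s)) huv h1 h2
        refine ⟨s, hs, dist_le_trackingConst hq hα hi (hκI s hs) (hκI t ht) ?_ (hκ s hs) (hκ t ht)
          (hQ _ _ hs1 ht1)⟩
        rw [hβ.dist_eq (hu.trans hs.1) hst (ht.2.trans hv)]
        exact hst'
    · exact ⟨u, hu', dist_le_trackingConst hq hα hi hk (hκI u hu') (hself _) hku (hκ u hu')
        (hQ _ _ hQk h1)⟩
  by_cases hil : l = i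
  · subst hil
    exact ⟨v, ⟨huv, le_rfl⟩, dist_le_trackingConst hq hα hi hi hi (hself _) hlv hlv (by simp)⟩
  · rcases mem_uIcc.1 hikl with ⟨h1, h2⟩ | ⟨h1, h2⟩
    · exact key (fun a => a ≤ i) (fun a b ha hb => mem_uIcc.2 (Or.inl ⟨ha, (not_le.1 hb).le⟩)) h1
        (fun h => hil (le_antisymm h h2))
    · exact key (fun a => i ≤ a) (fun a b ha hb => mem_uIcc.2 (Or.inr ⟨(not_le.1 hb).le, ha⟩)) h2
        (fun h => hil (le_antisymm h1 h))

end tracking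

namespace IsQuasigeodesic

variable {q D : ℝ} {I : Set ℝ} {α : ℝ → S}

theorem exists_dist_le_of_between [GeodesicSpace S] (hα : IsQuasigeodesic q I α)
    (hA : IsStronglyContracting D (α '' I)) {i j : ℝ} (hi : i ∈ I) (hj : j ∈ I) {z : S}
    (hz : dist (α i) z + dist z (α j) = dist (α i) (α j)) :
    ∃ k ∈ I, dist z (α k) ≤ 18 * D := by
  obtain ⟨p, hp⟩ := hα.closest z
  have := hA.dist_le_of_between hα.closest (mem_image_of_mem α hi) (mem_image_of_mem α hj) hz hp
  obtain ⟨k, hk, rfl⟩ := hp.1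
  exact ⟨k, hk, this⟩

/-- A strongly contracting quasigeodesic is an unparametrised rough geodesic. -/
theorem dist_add_dist_le [GeodesicSpace S] (hq : 1 ≤ q) (hα : IsQuasigeodesic q I α)
    (hA : IsStronglyContracting D (α '' I)) {i j k : ℝ} (hi : i ∈ I) (hj : j ∈ I) (hk : k ∈ I)
    (hijk : j ∈ uIcc i k) : dist (α i) (α j) + dist (α j) (α k) ≤
      dist (α i) (α k) + 2 * trackingConst q (18 * D) := by
  have hD := hA.pos (α i)
  obtain ⟨β, ℓ, hβ, h0, hℓ⟩ := GeodesicSpace.exists_geodesic (α i) (α k)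
  have hbet : ∀ s ∈ Icc 0 ℓ, dist (α i) (β s) + dist (β s) (α k) = dist (α i) (α k) := by
    intro s hs
    rw [← h0, ← hℓ, hβ.dist_eq le_rfl hs.1 hs.2, hβ.dist_eq hs.1 hs.2 le_rfl, hβ.dist_endpoints]
    ring
  obtain ⟨s, hs, hsj⟩ := exists_dist_le_trackingConst hq hα.qi hβ le_rfl hβ.1 le_rfl
    (fun s hs => hα.exists_dist_le_of_between hA hi hk (hbet s hs)) hj hi hk
    (by rw [h0, dist_self]; positivity) (by rw [hℓ, dist_self]; positivity) hijk
  have h1 := hbet s hs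
  have h2 := dist_triangle (α i) (β s) (α j)
  have h3 := dist_triangle_left (α j) (α k) (β s)
  linarith

end IsQuasigeodesic

end CurtainDual

/-! ### Geodesics tracked by a strongly contracting quasigeodesic -/

namespace CurtainDual

open Curtain WallUltrafilter

variable {S : Type*} [MetricSpace S]

/-- A geodesic segment `σ` in a neighbourhood of a strongly contracting quasigeodesic `α`; the point
`α (κ s)` is close to `σ s`. -/
structure IsTrackedBy (q D : ℝ) (I : Set ℝ) (α σ : ℝ → S) (L : ℝ) (κ : ℝ → ℝ) : Prop where
  one_le : 1 ≤ q
  quasigeodesic : IsQuasigeodesic q I α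
  contracting : IsStronglyContracting D (α '' I)
  geodesic : IsGeodesicSegment σ L
  mem : ∀ s ∈ Icc 0 L, κ s ∈ I
  dist_le : ∀ s ∈ Icc 0 L, dist (σ s) (α (κ s)) ≤ 18 * D

namespace IsTrackedBy

variable {q D L : ℝ} {I : Set ℝ} {α σ : ℝ → S} {κ : ℝ → ℝ}

theorem const_pos (h : IsTrackedBy q D I α σ L κ) : 0 < D := h.contracting.pos (σ 0)

theorem trackingConst_nonneg (h : IsTrackedBy q D I α σ L κ) : 0 ≤ trackingConst q (18 * D) := by
  have := h.const_pos
  have := h.one_le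
  unfold trackingConst
  positivity

/-- Points far from `α` see its projection to `α` before any other point of `σ`. -/
theorem dist_add_dist_le [GeodesicSpace S] (h : IsTrackedBy q D I α σ L κ) {x p : S}
    (hp : p ∈ closestPoints (α '' I) x) {s : ℝ} (hs : s ∈ Icc 0 L) :
    dist x p + dist p (σ s) ≤ dist x (σ s) + 41 * D := by
  have hD := h.const_pos
  obtain ⟨r, hr⟩ := h.quasigeodesic.closest (σ s)
  have h1 := (hr.2 _ (mem_image_of_mem α (h.mem s hs))).trans (h.dist_le s hs)
  rcases lt_or_ge (dist p r) (5 * D) with hlt | hge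
  · have h2 := hp.2 r hr.1
    have h3 := dist_triangle x (σ s) r
    have h4 := dist_triangle_right p (σ s) r
    linarith
  · have := h.contracting.dist_add_dist_le h.quasigeodesic.closest hp hr hge
    linarith

theorem exists_dist_le [GeodesicSpace S] (h : IsTrackedBy q D I α σ L κ) {a b s t : ℝ}
    (ha : 0 ≤ a) (hb : b ≤ L) (hs : s ∈ Icc a b) (ht : t ∈ Icc a b) {i : ℝ} (hi : i ∈ I)
    (hist : i ∈ uIcc (κ s) (κ t)) :
    ∃ v ∈ Icc a b, dist (σ v) (α i) ≤ trackingConst q (18 * D) := by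
  have key : ∀ s ∈ Icc a b, ∀ t ∈ Icc a b, s ≤ t → i ∈ uIcc (κ s) (κ t) →
      ∃ v ∈ Icc a b, dist (σ v) (α i) ≤ trackingConst q (18 * D) := by
    intro s hs t ht hst hist
    have hs' : s ∈ Icc 0 L := ⟨ha.trans hs.1, hs.2.trans hb⟩
    have ht' : t ∈ Icc 0 L := ⟨ha.trans ht.1, ht.2.trans hb⟩
    obtain ⟨v, hv, hvi⟩ := exists_dist_le_trackingConst h.one_le h.quasigeodesic.qi h.geodesic
      hs'.1 hst ht'.2
      (fun v hv => ⟨κ v, h.mem v ⟨hs'.1.trans hv.1, hv.2.trans ht'.2⟩,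
        h.dist_le v ⟨hs'.1.trans hv.1, hv.2.trans ht'.2⟩⟩) hi (h.mem s hs') (h.mem t ht')
      (h.dist_le s hs') (h.dist_le t ht') hist
    exact ⟨v, ⟨hs.1.trans hv.1, hv.2.trans ht.2⟩, hvi⟩
  rcases le_total s t with hst | hst
  · exact key s hs t ht hst hist
  · exact key t ht s hs hst (by rwa [uIcc_comm])

/-- If `σ s` is almost closest to `α i` among the points of a subsegment of `σ`, then `σ s` lies
roughly between `α i` and all other points of the subsegment. -/
theorem mem_uIcc_or_dist_le [GeodesicSpace S] (h : IsTrackedBy q D I α σ L κ) {a b s t : ℝ}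
    (ha : 0 ≤ a) (hb : b ≤ L) (hs : s ∈ Icc a b) (ht : t ∈ Icc a b) {i : ℝ} (hi : i ∈ I)
    (hclose : ∀ v ∈ Icc a b, dist (α i) (σ s) ≤ dist (α i) (σ v) + 41 * D) :
    κ s ∈ uIcc i (κ t) ∨ dist (α i) (σ s) ≤ 113 * D + 2 * trackingConst q (18 * D) ∨
      dist (σ s) (σ t) ≤ 113 * D + 2 * trackingConst q (18 * D) := by
  have hD := h.const_pos
  have hM := h.trackingConst_nonneg
  have hs' : s ∈ Icc 0 L := ⟨ha.trans hs.1, hs.2.trans hb⟩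
  have ht' : t ∈ Icc 0 L := ⟨ha.trans ht.1, ht.2.trans hb⟩
  -- If `i` is in the middle, `σ` passes near `α i`, hence so does the almost closest `σ s`. If `κ
  -- t` is in the middle, `σ t` is nearly on the way to `σ s` but not much closer to `α i`, so the
  -- two are close.
  have hcases : κ s ∈ uIcc i (κ t) ∨ i ∈ uIcc (κ s) (κ t) ∨ κ t ∈ uIcc i (κ s) := by
    simp only [mem_uIcc]
    rcases le_total i (κ s) with h1 | h1 <;> rcases le_total i (κ t) with h2 | h2 <;>
      rcases le_total (κ s) (κ t) with h3 | h3 <;> tauto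
  rcases hcases with h1 | h1 | h1
  · exact Or.inl h1
  · obtain ⟨v, hv, hvi⟩ := h.exists_dist_le ha hb hs ht hi h1
    have := hclose v hv
    rw [dist_comm (α i) (σ v)] at this
    exact Or.inr (Or.inl (by linarith))
  · right; right
    have h2 := h.quasigeodesic.dist_add_dist_le h.one_le h.contracting hi (h.mem t ht')
      (h.mem s hs') h1
    have h3 := h.dist_le s hs'
    have h4 := h.dist_le t ht'
    have h5 := hclose t ht
    have h6 := dist_triangle (α i) (α (κ t)) (σ t)
    have h7 := dist_triangle (α i) (σ s) (α (κ s))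
    have h8 := dist_triangle4 (σ s) (α (κ s)) (α (κ t)) (σ t)
    rw [dist_comm (α (κ t)) (σ t)] at h6 h8
    rw [dist_comm (α (κ s)) (α (κ t))] at h8
    linarith

/-- Subsegments of a geodesic near a strongly contracting quasigeodesic are strongly
contracting. -/
theorem isStronglyContracting_image [GeodesicSpace S] (h : IsTrackedBy q D I α σ L κ) {a b : ℝ}
    (ha : 0 ≤ a) (hab : a ≤ b) (hb : b ≤ L) :
    IsStronglyContracting (2 * (465 * D + 10 * trackingConst q (18 * D)) + 1)
      (σ '' Icc a b) := by
  have hD := h.const_pos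
  have hM := h.trackingConst_nonneg
  set M := trackingConst q (18 * D) with hMdef
  refine isStronglyContracting_of_dist_le (by positivity)
    (closestPoints_nonempty (h.geodesic.isCompact_image ha hb) ⟨_, a, ⟨le_rfl, hab⟩, rfl⟩) ?_
  intro x y _ _ hp hp' hxy
  obtain ⟨s, hs, rfl⟩ := hp.1
  obtain ⟨t, ht, rfl⟩ := hp'.1
  obtain ⟨_, hex⟩ := h.quasigeodesic.closest x
  obtain ⟨_, hey⟩ := h.quasigeodesic.closest y
  obtain ⟨i, hi, rfl⟩ := hex.1
  obtain ⟨j, hj, rfl⟩ := hey.1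
  have hsub : ∀ v ∈ Icc a b, v ∈ Icc 0 L := fun v hv => ⟨ha.trans hv.1, hv.2.trans hb⟩
  have hclose : ∀ (z : S) (k r : ℝ), r ∈ Icc a b → α k ∈ closestPoints (α '' I) z →
      σ r ∈ closestPoints (σ '' Icc a b) z →
      ∀ v ∈ Icc a b, dist (α k) (σ r) ≤ dist (α k) (σ v) + 41 * D := by
    intro z k r hr hk hz v hv
    have h1 := h.dist_add_dist_le hk (hsub r hr)
    have h2 := hz.2 _ (mem_image_of_mem σ hv)
    have h3 := dist_triangle z (α k) (σ v)
    linarith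
  -- Contraction of `α` forces a path from `x` to `y` through `α i` and `α j` whenever these are far
  -- apart, while `dist x y < dist x (σ s)`. So `α j` is essentially no farther from `α i` than `σ
  -- s` is.
  have hee : dist (α i) (α j) ≤ dist (α i) (σ s) + 36 * D := by
    rcases lt_or_ge (dist (α i) (α j)) (5 * D) with hlt | hge
    · linarith [dist_nonneg (x := α i) (y := σ s)]
    · have h1 := h.contracting.dist_add_dist_add_dist_le h.quasigeodesic.closest hex hey hge
      linarith [dist_triangle x (α i) (σ s), dist_nonneg (x := y) (y := α j)]
  have ds := h.dist_le s (hsub s hs)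
  have dt := h.dist_le t (hsub t ht)
  have add : ∀ i j k : ℝ, i ∈ I → j ∈ I → k ∈ I → j ∈ uIcc i k →
      dist (α i) (α j) + dist (α j) (α k) ≤ dist (α i) (α k) + 2 * M :=
    fun i j k hi hj hk hijk =>
      h.quasigeodesic.dist_add_dist_le h.one_le h.contracting hi hj hk hijk
  have hκs := h.mem s (hsub s hs)
  have hκt := h.mem t (hsub t ht)
  have hst := dist_triangle4 (σ s) (α (κ s)) (α (κ t)) (σ t)
  rw [dist_comm (α (κ t)) (σ t)] at hst
  rcases h.mem_uIcc_or_dist_le ha hb hs ht hi (hclose x i s hs hex hp) with h1 | h1 | h1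
  · rcases h.mem_uIcc_or_dist_le ha hb ht hs hj (hclose y j t ht hey hp') with h2 | h2 | h2
    -- Either `i`, `κ s`, `κ t`, `j` are in order, so that `hee` leaves no room between `κ s` and `κ
    -- t`, or the two conditions force `κ s = κ t`.
    · have hcase : (κ s ∈ uIcc i j ∧ κ t ∈ uIcc (κ s) j) ∨ κ s = κ t := by
        simp only [mem_uIcc] at h1 h2 ⊢
        rcases h1 with h1 | h1 <;> rcases h2 with h2 | h2
        · exact Or.inr (le_antisymm h1.2 h2.2)
        · exact Or.inl ⟨Or.inl ⟨h1.1, h2.1.trans h2.2⟩, Or.inl h2⟩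
        · exact Or.inl ⟨Or.inr ⟨h2.1.trans h2.2, h1.2⟩, Or.inr h2⟩
        · exact Or.inr (le_antisymm h2.1 h1.1)
      rcases hcase with ⟨h3, h4⟩ | h3
      · have e1 := add i (κ s) j hi hκs hj h3
        have e2 := add (κ s) (κ t) j hκs hκt hj h4
        have e3 := dist_triangle_right (α i) (σ s) (α (κ s))
        linarith [dist_nonneg (x := α (κ t)) (y := α j)]
      · rw [h3, dist_self] at hst
        rw [h3] at ds
        linarith
    · have e1 := add i (κ s) (κ t) hi hκs hκt h1
      have e2 := dist_triangle4 (α i) (α j) (σ t) (α (κ t))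
      have e3 := dist_triangle_right (α i) (σ s) (α (κ s))
      linarith
    · rw [dist_comm (σ s)]
      linarith
  · rcases h.mem_uIcc_or_dist_le ha hb ht hs hj (hclose y j t ht hey hp') with h2 | h2 | h2
    · have e1 := add j (κ t) (κ s) hj hκt hκs h2
      have e2 := dist_triangle4 (α j) (α i) (σ s) (α (κ s))
      rw [dist_comm (α j) (α i)] at e2
      rw [dist_comm (α (κ s)) (α (κ t))] at hst
      linarith [dist_nonneg (x := α j) (y := α (κ t))]
    · have e2 := dist_triangle4 (σ s) (α i) (α j) (σ t)
      rw [dist_comm (σ s) (α i)] at e2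
      linarith
    · rw [dist_comm (σ s)]
      linarith
  · linarith

end IsTrackedBy

/-! ### Chains of curtains dual to a contracting geodesic -/

/-- Seen from `x`, distances to points of `σ` are additive through `σ u` up to `18 * D`, so the
closest point of a subsegment is nearly the truncation of `u` to it. -/
theorem closestPoints_subsegment {σ : ℝ → S} {L D : ℝ} [GeodesicSpace S]
    (hσ : IsGeodesicSegment σ L) (hc : IsStronglyContracting D (σ '' Icc 0 L)) {x : S}
    {u a b v : ℝ} (hu : u ∈ Icc 0 L) (hux : σ u ∈ closestPoints (σ '' Icc 0 L) x) (ha : 0 ≤ a)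
    (hb : b ≤ L) (hv : v ∈ Icc a b) (hvx : σ v ∈ closestPoints (σ '' Icc a b) x) :
    v ≤ max u a + 18 * D ∧ min u b - 18 * D ≤ v := by
  have hD := hc.pos x
  have hne := closestPoints_nonempty (hσ.isCompact_image le_rfl le_rfl)
    ⟨σ u, mem_image_of_mem σ hu⟩
  have key : ∀ s ∈ Icc 0 L, dist x (σ u) + |u - s| ≤ dist x (σ s) + 18 * D := by
    intro s hs
    rcases lt_or_ge (dist (σ u) (σ s)) (5 * D) with hlt | hge
    · rw [hσ.2 u hu s hs] at hlt
      linarith [hux.2 _ (mem_image_of_mem σ hs)]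
    · have := hc.dist_add_dist_le hne hux (q := σ s)
        (by rw [closestPoints_self (mem_image_of_mem σ hs)]; rfl) hge
      rwa [hσ.2 u hu s hs] at this
  have hv' : v ∈ Icc 0 L := ⟨ha.trans hv.1, hv.2.trans hb⟩
  have h1 := key v hv'
  have hab : a ≤ b := hv.1.trans hv.2
  have key2 : ∀ s ∈ Icc a b, |u - v| ≤ |u - s| + 18 * D := by
    intro s hs
    have h2 := hvx.2 _ (mem_image_of_mem σ hs)
    have h3 := dist_triangle x (σ u) (σ s)
    rw [hσ.2 u hu s ⟨ha.trans hs.1, hs.2.trans hb⟩] at h3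
    linarith
  rcases lt_or_ge u a with hua | hua
  · have := key2 a ⟨le_rfl, hab⟩
    rw [abs_sub_comm u v, abs_sub_comm u a, abs_of_nonneg (by linarith [hv.1]),
      abs_of_nonneg (by linarith)] at this
    rw [max_eq_right hua.le, min_eq_left (by linarith)]
    constructor <;> linarith [hv.1]
  · rcases lt_or_ge b u with hub | hub
    · have := key2 b ⟨hab, le_rfl⟩
      rw [abs_of_nonneg (by linarith [hv.2]), abs_of_nonneg (by linarith)] at this
      rw [max_eq_left hua, min_eq_right hub.le]
      constructor <;> linarith [hv.2]
    · have := abs_le.1 (key2 u ⟨hua, hub⟩)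
      rw [sub_self, abs_zero] at this
      rw [max_eq_left hua, min_eq_left hub]
      constructor <;> linarith [this.1, this.2]

/-- The curtain dual to a subsegment of a contracting geodesic, with its halfspaces located by
projections to the whole geodesic. -/
theorem exists_curtain_of_subsegment {σ : ℝ → S} {L D : ℝ} [GeodesicSpace S]
    (hσ : IsGeodesicSegment σ L) (hD : 1 ≤ D)
    (hc : ∀ a b, 0 ≤ a → a ≤ b → b ≤ L → IsStronglyContracting D (σ '' Icc a b))
    {l : ℝ} (hl : 0 ≤ l) (hlL : l + 2000 * D ≤ L) :
    ∃ c : Curtain S, ∀ x u, u ∈ Icc 0 L → σ u ∈ closestPoints (σ '' Icc 0 L) x →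
      (u < l + 400 * D → x ∈ c.neg) ∧ (l + 1600 * D < u → x ∈ c.pos) := by
  have himg : ∀ a b, (fun t => σ (l + t)) '' Icc a b = σ '' Icc (l + a) (l + b) := by
    intro a b
    rw [← image_image σ (fun t => l + t), image_const_add_Icc]
  have hgeo : IsGeodesicSegment (fun t => σ (l + t)) (20 * (100 * D)) := by
    have := hσ.subsegment hl (b := l + 2000 * D) (by linarith) hlL
    convert this using 1
    ring
  -- Enlarging the constant to `100 * D` makes the error `18 * D` small compared with the margin
  -- between the thresholds `400 * D`, `1600 * D` and the ends `500 * D`, `1500 * D` of the dual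
  -- subsegment.
  refine ⟨⟨100 * D, by linarith, fun t => σ (l + t), hgeo, ?_, 500 * D, by linarith, by linarith⟩,
    ?_⟩
  · rw [himg]
    exact (hc _ _ (by linarith) (by linarith) (by linarith)).mono (by linarith)
  · intro x u hu hux
    obtain ⟨p, hp⟩ := closestPoints_nonempty (hgeo.isCompact_image le_rfl le_rfl)
      ⟨_, 0, ⟨le_rfl, hgeo.1⟩, rfl⟩ x
    obtain ⟨v, hv, rfl⟩ := hp.1
    have hp' := hp
    rw [himg] at hp'
    have hloc := closestPoints_subsegment hσ (hc 0 L le_rfl hσ.1 le_rfl) hu hux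
      (a := l + 0) (b := l + 20 * (100 * D)) (v := l + v) (by linarith) (by linarith)
      ⟨by linarith [hv.1], by linarith [hv.2]⟩ hp'
    constructor
    · intro hul
      refine ⟨_, hp, v, ⟨hv.1, ?_⟩, rfl⟩
      have : max u (l + 0) < l + 400 * D := max_lt hul (by linarith)
      change v < 500 * D
      linarith [hloc.1]
    · intro hul
      refine ⟨_, hp, v, ⟨?_, hv.2⟩, rfl⟩
      have : l + 1600 * D < min u (l + 20 * (100 * D)) := lt_min hul (by linarith)
      change 500 * D + 10 * (100 * D) < v
      linarith [hloc.2]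

end CurtainDual

/-! ### Strongly contracting quasigeodesics embed in the dual -/

namespace CurtainDual

open Curtain WallUltrafilter

variable {S : Type*} [MetricSpace S]

/-- Projections to a strongly contracting set are coarsely continuous. -/
theorem IsStronglyContracting.dist_le_of_dist_le_one {A : Set S} {D : ℝ}
    (hA : IsStronglyContracting D A) {x y p q : S} (hp : p ∈ closestPoints A x)
    (hq : q ∈ closestPoints A y) (hxy : dist x y ≤ 1) : dist p q ≤ D + 4 := by
  have hD := hA.pos x
  rcases lt_or_ge (dist x y) (dist x p) with h | h
  · linarith [hA.dist_lt hp hq h]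
  · have h1 := hq.2 p hp.1
    have h2 := dist_triangle_left y p x
    have h3 := dist_triangle4 p x y q
    rw [dist_comm p x] at h3
    linarith

/-- A geodesic whose endpoints project to either side of a point of a contracting geodesic passes
close to that point. -/
theorem exists_dist_le_of_crossing [GeodesicSpace S] {σ β : ℝ → S} {u : S → ℝ} {D L ℓ c : ℝ}
    (hD : 1 ≤ D) (hσ : IsGeodesicSegment σ L) (hA : IsStronglyContracting D (σ '' Icc 0 L))
    (hu : ∀ x, u x ∈ Icc 0 L) (hux : ∀ x, σ (u x) ∈ closestPoints (σ '' Icc 0 L) x)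
    (hβ : IsGeodesicSegment β ℓ) (hc : c ∈ Icc 0 L) (h0 : u (β 0) ≤ c - 10 * D)
    (hℓ : c + 5 * D ≤ u (β ℓ)) : ∃ t ∈ Icc 0 ℓ, dist (β t) (σ c) ≤ 23 * D := by
  obtain ⟨s, hs, t, ht, hst, hst1, hsc, htc⟩ := exists_crossing (Q := fun t => u (β t) ≤ c) hβ.1
    (by linarith) (by linarith)
  have hne := closestPoints_nonempty (hσ.isCompact_image le_rfl le_rfl)
    ⟨_, mem_image_of_mem σ hc⟩
  have hjump := hA.dist_le_of_dist_le_one (hux (β s)) (hux (β t))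
    (by rw [hβ.dist_eq hs.1 hst ht.2]; exact hst1)
  rw [hσ.2 _ (hu _) _ (hu _)] at hjump
  have hjump := abs_le.1 hjump
  have htc := not_le.1 htc
  -- Towards both ends the geodesic passes within `9 * D` of the projection of `β s`. These two
  -- passages are at most `18 * D` apart with `β s` between them, so `β s` is close to its
  -- projection, and that is within `5 * D` of `σ c`.
  obtain ⟨z, hz, hzp⟩ := hA.exists_between_dist_le hne (hux (β s)) (hux (β 0)) (by
    rw [hσ.2 _ (hu _) _ (hu _), abs_of_nonneg] <;> linarith [hjump.1])
  obtain ⟨z', hz', hzp'⟩ := hA.exists_between_dist_le hne (hux (β s)) (hux (β ℓ)) (by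
    rw [hσ.2 _ (hu _) _ (hu _), abs_sub_comm, abs_of_nonneg] <;> linarith [hjump.1])
  have h1 := hβ.dist_eq le_rfl hs.1 hs.2
  have h2 := hβ.dist_eq hs.1 hs.2 le_rfl
  have h3 := hβ.dist_endpoints
  have h4 := dist_triangle4 (β 0) z z' (β ℓ)
  have h5 := dist_triangle_right z z' (σ (u (β s)))
  rw [dist_comm (β s) (β 0), dist_comm z (β 0)] at hz
  have h6 := dist_triangle (β s) z (σ (u (β s)))
  have h7 := dist_triangle (β s) z' (σ (u (β s)))
  refine ⟨s, hs, ?_⟩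
  have h8 := dist_triangle (β s) (σ (u (β s))) (σ c)
  rw [hσ.2 _ (hu _) _ hc, abs_sub_comm, abs_of_nonneg (by linarith)] at h8
  linarith [hjump.1]

theorem WallUltrafilter.neg_principal {s : S} {c : Curtain S} (h : s ∈ c.neg) :
    (principal (curtainWalls S) s).Neg c :=
  principal_half_eq (Or.inl rfl) h

theorem WallUltrafilter.pos_principal {s : S} {c : Curtain S} (h : s ∈ c.pos) :
    (principal (curtainWalls S) s).Pos c :=
  principal_half_eq (Or.inr c.compl_neg_union_body.symm) h

/-- A long strongly contracting geodesic is dual to a long chain of curtains. -/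
theorem natCast_le_chainSize_of_contracting [GeodesicSpace S] {σ : ℝ → S} {L D : ℝ}
    (hσ : IsGeodesicSegment σ L) (hD : 1 ≤ D)
    (hc : ∀ a b, 0 ≤ a → a ≤ b → b ≤ L → IsStronglyContracting D (σ '' Icc a b)) {n : ℕ}
    (hn : n * (3000 * D) ≤ L) :
    (n : ℕ∞) ≤ chainSize ⌈23 * D⌉₊ (sep (principal _ (σ 0)) (principal _ (σ L))) := by
  rcases Nat.eq_zero_or_pos n with rfl | hn0
  · simp
  have hL := hσ.1
  have hA := hc 0 L le_rfl hL le_rfl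
  have hu : ∀ x, ∃ u, u ∈ Icc 0 L ∧ σ u ∈ closestPoints (σ '' Icc 0 L) x := by
    intro x
    obtain ⟨p, hp⟩ := closestPoints_nonempty (hσ.isCompact_image le_rfl le_rfl)
      ⟨σ 0, mem_image_of_mem σ ⟨le_rfl, hL⟩⟩ x
    obtain ⟨v, hv, rfl⟩ := hp.1
    exact ⟨v, hv, hp⟩
  choose u hu hux using hu
  have huσ : ∀ s ∈ Icc 0 L, u (σ s) = s := by
    intro s hs
    have := hux (σ s)
    rw [closestPoints_self (mem_image_of_mem σ hs), mem_singleton_iff] at this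
    have h := hσ.2 _ (hu (σ s)) _ hs
    rw [this, dist_self, eq_comm, abs_eq_zero] at h
    linarith
  have hfit : ∀ i < n, (i : ℝ) * (3000 * D) + 3000 * D ≤ L := by
    intro i hi
    have : (i : ℝ) + 1 ≤ n := by exact_mod_cast hi
    have := mul_le_mul_of_nonneg_right this (show 0 ≤ 3000 * D by linarith)
    linarith
  have hcurt : ∀ i : ℕ, ∃ c : Curtain S, i < n →
      ∀ x, (u x < i * (3000 * D) + 400 * D → x ∈ c.neg) ∧
        (i * (3000 * D) + 1600 * D < u x → x ∈ c.pos) := by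
    intro i
    have key : ∀ i < n, ∃ c : Curtain S, ∀ x, (u x < i * (3000 * D) + 400 * D → x ∈ c.neg) ∧
        (i * (3000 * D) + 1600 * D < u x → x ∈ c.pos) := by
      intro i hi
      obtain ⟨c, hc⟩ := exists_curtain_of_subsegment hσ hD hc (l := i * (3000 * D))
        (by positivity) (by linarith [hfit i hi])
      exact ⟨c, fun x => hc x (u x) (hu x) (hux x)⟩
    by_cases hi : i < n
    · obtain ⟨c, hc⟩ := key i hi
      exact ⟨c, fun _ => hc⟩
    · obtain ⟨c, -⟩ := key 0 hn0
      exact ⟨c, fun h => absurd h hi⟩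
  choose h hh using hcurt
  have hneg : ∀ i < n, ∀ x ∈ (h i).neg, u x ≤ i * (3000 * D) + 1600 * D := by
    intro i hi x hx
    by_contra! hlt
    exact (h i).not_mem_pos_of_mem_neg hx ((hh i hi x).2 hlt)
  have hpos : ∀ i < n, ∀ x ∈ (h i).pos, i * (3000 * D) + 400 * D ≤ u x := by
    intro i hi x hx
    by_contra! hlt
    exact (h i).not_mem_pos_of_mem_neg ((hh i hi x).1 hlt) hx
  have hbody : ∀ i < n, ∀ x ∈ (h i).body,
      i * (3000 * D) + 400 * D ≤ u x ∧ u x ≤ i * (3000 * D) + 1600 * D := by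
    intro i hi x hx
    constructor
    · by_contra! hlt
      exact (h i).not_mem_neg hx ((hh i hi x).1 hlt)
    · by_contra! hlt
      exact (h i).not_mem_pos hx ((hh i hi x).2 hlt)
  have hR1 : 23 * D ≤ ⌈23 * D⌉₊ := Nat.le_ceil _
  have hR2 : (⌈23 * D⌉₊ : ℝ) < 23 * D + 1 := Nat.ceil_lt_add_one (by linarith)
  have hchain : IsCurtainChain ⌈23 * D⌉₊ n h := by
    intro i j hij hj
    have hi := hij.trans hj
    have hspace : (i : ℝ) * (3000 * D) + 3000 * D ≤ j * (3000 * D) := by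
      have : (i : ℝ) + 1 ≤ j := by exact_mod_cast hij
      have := mul_le_mul_of_nonneg_right this (show 0 ≤ 3000 * D by linarith)
      linarith
    have hfi := hfit i hi
    have hi0 : 0 ≤ (i : ℝ) * (3000 * D) := by positivity
    -- A point in the gap between the axis of the `i`-th curtain and the next, and far from both;
    -- the separating ball is centred at `σ c`.
    set c := i * (3000 * D) + 2500 * D with hcdef
    have hcL : c ∈ Icc 0 L := ⟨by linarith, by linarith⟩
    refine ⟨fun x hx => (hh j hj x).1 (by linarith [(hbody i hi x hx).2]),
      fun x hx => (hh i hi x).2 (by linarith [(hbody j hj x hx).1]),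
      σ c, ⌈23 * D⌉₊, Nat.cast_nonneg _, le_rfl, fun y hy => ?_, fun β ℓ hβ h0 hℓ => ?_⟩
    · have h1 := mem_closedBall.1 hy
      have h2 := (hux y).2 _ (mem_image_of_mem σ hcL)
      have h3 := dist_triangle_left (σ (u y)) (σ c) y
      rw [hσ.2 _ (hu y) _ hcL] at h3
      have h4 := abs_le.1 (h3.trans (add_le_add h2 le_rfl))
      exact ⟨(hh i hi y).2 (by linarith [h4.1]), (hh j hj y).1 (by linarith [h4.2])⟩
    · obtain ⟨t, ht, hts⟩ := exists_dist_le_of_crossing hD hσ hA hu hux hβ hcL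
        (by linarith [hneg i hi _ h0]) (by linarith [hpos j hj _ hℓ])
      exact ⟨t, ht, mem_closedBall.2 (hts.trans hR1)⟩
  refine hchain.le_chainSize fun i hi => ?_
  have hi0 : 0 ≤ (i : ℝ) * (3000 * D) := by positivity
  refine (neg_principal ((hh i hi _).1 ?_)).half_negWall_ne (pos_principal ((hh i hi _).2 ?_))
  · rw [huσ 0 ⟨le_rfl, hL⟩]
    linarith
  · rw [huσ L ⟨hL, le_rfl⟩]
    linarith [hfit i hi]

theorem lam_mul_le_dist [GeodesicSpace S] (w : Weights) {s t : S} {R : ℕ+} {n : ℕ}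
    (h : (n : ℕ∞) ≤ chainSize R (sep (principal _ s) (principal _ t))) :
    w.lam R * n ≤ dist (toGradedDual w s) (toGradedDual w t) := by
  have h1 : (w.lam R : ℝ≥0∞) * n ≤ gradedSize w (sep (toGradedDual w s).1 (toGradedDual w t).1) := by
    refine le_trans ?_ (ENNReal.le_tsum R)
    gcongr
    have := ENat.toENNReal_le.2 h
    rwa [ENat.toENNReal_coe] at this
  have h2 := ENNReal.toReal_mono (gradedSize_sep_ne_top w _ _) h1
  simpa [dist_eq_gradedSize] using h2

/-- Strongly contracting quasigeodesics are quasiisometrically embedded in the graded dual. -/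
theorem exists_isQIEmbeddingOn_toGradedDual [GeodesicSpace S] (w : Weights) (q D : ℝ)
    (hq : 1 ≤ q) : ∃ ν : ℝ, 1 ≤ ν ∧ ∀ (I : Set ℝ) (α : ℝ → S),
      IsQuasigeodesic q I α → IsStronglyContracting D (α '' I) →
        IsQIEmbeddingOn ν I (fun t => toGradedDual w (α t)) := by
  set D₁ := max D 1 with hD₁
  have hD₁1 : 1 ≤ D₁ := le_max_right _ _
  set M := trackingConst q (18 * D₁) with hM
  have hM0 : 0 ≤ M := by rw [hM, trackingConst]; positivity
  -- The uniform contraction constant of subsegments of tracked geodesics. It fixes the scale `R`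
  -- and the length `B` of geodesic used per curtain.
  set D₀ := 2 * (465 * D₁ + 10 * M) + 1 with hD₀
  have hD₀1 : 1 ≤ D₀ := by linarith
  set R : ℕ+ := ⟨⌈23 * D₀⌉₊, Nat.ceil_pos.2 (by linarith)⟩ with hR
  set lam : ℝ := ((w.lam R : ℝ≥0) : ℝ) with hlam
  have hlam0 : 0 < lam := w.lam_pos R
  set Λ : ℝ := ((∑' R, w.lam R : ℝ≥0) : ℝ) with hΛ
  have hΛ0 : 0 ≤ Λ := NNReal.coe_nonneg _
  set B := 3000 * D₀ with hB
  have hB0 : 0 < B := by linarith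
  set ν := 1 + B * q / lam + lam * (q / B + 1) + Λ * (2 * q + 4) with hν
  have p1 : 0 ≤ B * q / lam := by positivity
  have p2 : 0 ≤ lam * (q / B + 1) := by positivity
  have p3 : 0 ≤ Λ * (2 * q + 4) := by positivity
  refine ⟨ν, by linarith, fun I α hα hA s hs t ht => ⟨?_, ?_⟩⟩
  · obtain ⟨σ, L, hσ, h0, hL⟩ := GeodesicSpace.exists_geodesic (α s) (α t)
    have hA₁ := hA.mono (le_max_left D 1)
    have hex : ∀ v ∈ Icc 0 L, ∃ k ∈ I, dist (σ v) (α k) ≤ 18 * D₁ := by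
      intro v hv
      refine hα.exists_dist_le_of_between hA₁ hs ht ?_
      rw [← h0, ← hL, hσ.dist_eq le_rfl hv.1 hv.2, hσ.dist_eq hv.1 hv.2 le_rfl, hσ.dist_endpoints]
      ring
    choose! κ hκI hκ using hex
    have htr : IsTrackedBy q D₁ I α σ L κ := ⟨hq, hα, hA₁, hσ, hκI, hκ⟩
    have h1 := natCast_le_chainSize_of_contracting hσ hD₀1
      (fun a b ha hab hb => htr.isStronglyContracting_image ha hab hb) (n := ⌊L / B⌋₊) (by
        have := Nat.floor_le (div_nonneg hσ.1 hB0.le)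
        rwa [le_div_iff₀ hB0] at this)
    rw [h0, hL] at h1
    have h2 := lam_mul_le_dist w (R := R) h1
    have h3 := Nat.lt_floor_add_one (L / B)
    have h4 := (hα.qi s hs t ht).1
    rw [← h0, ← hL, hσ.dist_endpoints] at h4
    have h5 : |s - t| / ν ≤ lam * (|s - t| / q / B) := by
      rw [div_le_iff₀ (by linarith)]
      have : 1 ≤ lam * (1 / q / B) * ν := by
        have : lam * (1 / q / B) * (B * q / lam) = 1 := by
          field_simp
        calc (1 : ℝ) = lam * (1 / q / B) * (B * q / lam) := this.symm
          _ ≤ lam * (1 / q / B) * ν := by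
            gcongr
            linarith
      calc |s - t| = |s - t| * 1 := (mul_one _).symm
        _ ≤ |s - t| * (lam * (1 / q / B) * ν) := by gcongr
        _ = lam * (|s - t| / q / B) * ν := by ring
    have h6 : lam * (|s - t| / q / B) - lam * (q / B + 1) ≤ lam * ⌊L / B⌋₊ := by
      rw [← mul_sub]
      gcongr
      have : (|s - t| / q - q) / B ≤ L / B := by gcongr
      rw [sub_div] at this
      linarith
    linarith
  · have h1 := dist_toGradedDual_le w (α s) (α t)
    have h2 := (hα.qi s hs t ht).2
    have h3 : Λ * (2 * dist (α s) (α t) + 4) ≤ Λ * (2 * (q * |s - t| + q) + 4) := by gcongr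
    have h4 : Λ * (2 * (q * |s - t| + q) + 4) ≤ ν * |s - t| + ν := by
      have e1 : Λ * (2 * q) ≤ ν := by
        have : Λ * (2 * q) ≤ Λ * (2 * q + 4) := by gcongr; linarith
        linarith
      have e2 := mul_le_mul_of_nonneg_right e1 (abs_nonneg (s - t))
      have e3 : Λ * (2 * q + 4) ≤ ν := by linarith
      linarith
    linarith

end CurtainDual

namespace CurtainDual

open Curtain WallUltrafilter

variable {S : Type*} [MetricSpace S]

/-! ### Quasigeodesics crossing long chains of curtains -/

/-- A path with few steps that crosses many curtains crosses two of them in a single step. -/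
theorem IsCurtainChain.exists_step [GeodesicSpace S] {R n : ℕ} {h : ℕ → Curtain S}
    (hh : IsCurtainChain R n h) (m : ℕ) (f : ℕ → S) (a : ℕ) (ha : a + 2 * m < n)
    (h0 : f 0 ∈ (h a).neg) (hm : f m ∈ (h (a + 2 * m)).pos) :
    ∃ p < m, ∃ k, a ≤ k ∧ k + 1 ≤ a + 2 * m ∧ f p ∈ (h k).neg ∧ f (p + 1) ∈ (h (k + 1)).pos := by
  induction m generalizing f a with
  | zero => exact absurd hm ((h a).not_mem_pos_of_mem_neg h0)
  | succ m ih =>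
    -- Either the first step crosses two curtains, or it leaves `f 1` on the negative side of `h (a
    -- + 2)`, so that two curtains suffice for each step.
    by_cases h1 : f 1 ∈ (h (a + 1)).pos
    · exact ⟨0, by omega, a, le_rfl, by omega, h0, h1⟩
    · obtain ⟨p, hp, k, hk, hk', hpk, hpk'⟩ := ih (fun i => f (i + 1)) (a + 2) (by omega)
        (hh.mem_neg_of_not_mem_pos (by omega) (by omega) h1)
        (by rwa [show a + 2 + 2 * m = a + 2 * (m + 1) by omega])
      exact ⟨p + 1, by omega, k, by omega, by omega, hpk, hpk'⟩

/-- Two points whose projections to a path are separated by a chain of curtains much longer than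
the path are at least as far from each other as from the path. -/
theorem IsCurtainChain.dist_le_of_path [GeodesicSpace S] {R n m c : ℕ} {h : ℕ → Curtain S}
    (hh : IsCurtainChain R n h) {A : Set S} {f : ℕ → S} {T : ℝ} (hf : ∀ p ≤ m, f p ∈ A)
    (hstep : ∀ p < m, dist (f p) (f (p + 1)) ≤ T) (h0 : ∀ i < n, f 0 ∈ (h i).neg)
    (hm : ∀ i < n, f m ∈ (h i).pos) {x y : S} (hx : f 0 ∈ closestPoints A x)
    (hy : f m ∈ closestPoints A y) (hc : 2 * R + T ≤ c) (hn : 4 * c + 6 * m + 6 ≤ n) :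
    dist x (f 0) ≤ dist x y ∧ dist y (f m) ≤ dist x y := by
  -- Where one step of the path crosses two curtains, the separating ball is within `T` plus its
  -- radius of a point `w` of `A`. Every geodesic across these curtains then comes within `c` of
  -- `w`.
  have good : ∀ a, a + 2 * m < n → ∃ k, a ≤ k ∧ k + 1 ≤ a + 2 * m ∧ ∃ w ∈ A,
      ∀ s ∈ (h k).neg, ∀ t ∈ (h (k + 1)).pos, ∃ z ∈ (h k).pos ∩ (h (k + 1)).neg,
        dist z w ≤ c ∧ dist s z + dist z t = dist s t := by
    intro a ha
    obtain ⟨p, hp, k, hk, hk', hpk, hpk'⟩ := hh.exists_step m f a ha (h0 _ (by omega))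
      (hm _ (by omega))
    refine ⟨k, hk, hk', f p, hf p hp.le, fun s hs t ht => ?_⟩
    obtain ⟨o, -, ho⟩ := (hh k (k + 1) (by omega) (by omega)).exists_between
    obtain ⟨z, -, hzo, hz⟩ := ho _ hpk _ hpk'
    obtain ⟨z', hz', hzo', hsum⟩ := ho s hs t ht
    refine ⟨z', hz', ?_, hsum⟩
    have h1 := hstep p hp
    have h2 := dist_triangle_right z' z o
    have h3 := dist_triangle z' z (f p)
    rw [dist_comm z (f p)] at h3
    have h4 : 0 ≤ dist z (f (p + 1)) := dist_nonneg
    linarith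
  -- Three such places, with more than `c` curtains between them and at both ends. The outer two
  -- locate `x` and `y` with respect to the chain, and the middle one brings a geodesic from `x` to
  -- `y` near `A`.
  obtain ⟨k₁, hk₁, hk₁', w₁, hw₁, hz₁⟩ := good (c + 1) (by omega)
  obtain ⟨k₂, hk₂, hk₂', w₂, hw₂, hz₂⟩ := good (2 * c + 2 * m + 3) (by omega)
  obtain ⟨k₃, hk₃, hk₃', w₃, hw₃, hz₃⟩ := good (3 * c + 4 * m + 5) (by omega)
  -- Otherwise a geodesic from `f 0` to `x` comes within `c` of `w₁` after more than `c` curtains,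
  -- so `w₁` is closer to `x` than `f 0`. The argument for `y` is the same.
  have hxk : x ∈ (h (k₁ + 2)).neg := by
    refine hh.mem_neg_of_not_mem_pos (i := k₁ + 1) (by omega) (by omega) fun hpos => ?_
    obtain ⟨z, hz, hzw, hsum⟩ := hz₁ _ (h0 k₁ (by omega)) x hpos
    have h1 := hh.le_dist (Nat.zero_le k₁) (by omega) (h0 0 (by omega)) hz.1
    have h2 := hx.2 _ hw₁
    have h3 := dist_triangle x z w₁
    have h4 : (c : ℝ) + 1 ≤ k₁ := by exact_mod_cast hk₁
    rw [dist_comm (f 0) x, dist_comm z x] at hsum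
    push_cast at h1
    linarith
  have hyk : y ∈ (h (k₃ - 1)).pos := by
    refine hh.mem_pos_of_not_mem_neg (j := k₃) (by omega) (by omega) fun hneg => ?_
    obtain ⟨z, hz, hzw, hsum⟩ := hz₃ y hneg _ (hm (k₃ + 1) (by omega))
    have h1 := hh.le_dist (show k₃ + 1 ≤ n - 1 by omega) (by omega) hz.2 (hm (n - 1) (by omega))
    have h2 := hy.2 _ hw₃
    have h3 := dist_triangle y z w₃
    have h4 : (k₃ : ℝ) + 1 + c + 1 ≤ n := by exact_mod_cast (by omega)
    rw [Nat.cast_sub (by omega)] at h1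
    push_cast at h1
    linarith
  -- The detour of at most `c` from `z` to `w₂` is paid for by the at least `c` curtains on either
  -- side of `z`.
  obtain ⟨z, hz, hzw, hsum⟩ := hz₂ x (hh.neg_subset (by omega) (by omega) hxk) y
    (hh.pos_subset (by omega) (by omega) hyk)
  have h1 := hh.le_dist (show k₁ + 2 ≤ k₂ by omega) (by omega) hxk hz.1
  have h2 := hh.le_dist (show k₂ + 1 ≤ k₃ - 1 by omega) (by omega) hz.2 hyk
  have h3 := hx.2 _ hw₂
  have h4 := hy.2 _ hw₂
  have h5 := dist_triangle x z w₂
  have h6 := dist_triangle y z w₂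
  have h7 : (k₁ : ℝ) + 1 + c ≤ k₂ := by exact_mod_cast (by omega)
  have h8 : (k₂ : ℝ) + 1 + c ≤ k₃ := by exact_mod_cast (by omega)
  rw [Nat.cast_sub (by omega)] at h2
  push_cast at h1 h2
  rw [dist_comm y z] at h6
  constructor <;> linarith

theorem WallUltrafilter.mem_neg_of_principal {s : S} {c : Curtain S}
    (h : (principal (curtainWalls S) s).Neg c) : s ∈ c.neg := by
  have := mem_principal_half (curtainWalls S) s c.negWall
  rwa [h] at this

theorem WallUltrafilter.mem_pos_of_principal {s : S} {c : Curtain S}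
    (h : (principal (curtainWalls S) s).Pos c) : s ∈ c.pos := by
  have := mem_principal_half (curtainWalls S) s c.posWall
  rwa [h] at this

/-- Up to a small multiple of the distance in `S`, the distance in the graded dual is controlled by
chains of a single scale. -/
theorem exists_dist_toGradedDual_le_of_chainSize_le [GeodesicSpace S] (w : Weights) {ε : ℝ}
    (hε : 0 < ε) : ∃ R : ℕ, ∀ (s t : S) (N : ℕ),
      chainSize R (sep (principal _ s) (principal _ t)) ≤ N →
        dist (toGradedDual w s) (toGradedDual w t) ≤
          (∑' R, w.lam R : ℝ≥0) * N + ε * (2 * dist s t + 4) := by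
  have hsum : ∑' R, (w.lam R : ℝ≥0∞) ≠ ⊤ := ENNReal.tsum_coe_ne_top_iff_summable.2 w.summable_lam
  obtain ⟨F, hF⟩ := ((ENNReal.tendsto_tsum_compl_atTop_zero hsum).eventually_lt_const
    (ENNReal.ofReal_pos.2 hε)).exists
  -- The scales outside the finite set `F` have total weight less than `ε` and are bounded by
  -- distance in `S`; those in `F` are dominated by the largest of them.
  refine ⟨F.sup fun R => (R : ℕ), fun s t N hN => ?_⟩
  have h : gradedSize w (sep (principal _ s) (principal _ t)) ≤
      ((∑' R, w.lam R : ℝ≥0) : ℝ≥0∞) * N +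
        ENNReal.ofReal ε * ENNReal.ofReal (2 * dist s t + 4) := by
    rw [gradedSize, ← ENNReal.sum_add_tsum_compl F]
    refine add_le_add ?_ ?_
    · rw [ENNReal.coe_tsum w.summable_lam]
      refine le_trans ?_ (mul_le_mul_left (ENNReal.sum_le_tsum F) _)
      rw [Finset.sum_mul]
      refine Finset.sum_le_sum fun R hR => ?_
      gcongr
      have h1 := (chainSize_mono_left (Finset.le_sup (f := fun R : ℕ+ => (R : ℕ)) hR) _).trans hN
      have h2 := ENat.toENNReal_le.2 h1
      rwa [ENat.toENNReal_coe] at h2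
    · refine le_trans ?_ (mul_le_mul_left hF.le _)
      rw [← ENNReal.tsum_mul_right]
      refine ENNReal.tsum_le_tsum fun R => ?_
      gcongr
      exact chainSize_sep_principal_le _ s t
  have hfin : ((∑' R, w.lam R : ℝ≥0) : ℝ≥0∞) * N ≠ ⊤ := ENNReal.mul_ne_top (by simp) (by simp)
  have hfin' : ENNReal.ofReal ε * ENNReal.ofReal (2 * dist s t + 4) ≠ ⊤ :=
    ENNReal.mul_ne_top (by simp) (by simp)
  have h' := ENNReal.toReal_mono (ENNReal.add_ne_top.2 ⟨hfin, hfin'⟩) h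
  rw [ENNReal.toReal_add hfin hfin', ENNReal.toReal_mul, ENNReal.toReal_mul,
    ENNReal.toReal_ofReal hε.le, ENNReal.toReal_ofReal (by positivity)] at h'
  exact h'

/-- Quasigeodesics that are quasiisometrically embedded in the graded dual are strongly
contracting. -/
theorem exists_isStronglyContracting_of_isQIEmbeddingOn [GeodesicSpace S] (w : Weights) (q ν : ℝ)
    (hq : 1 ≤ q) (hν : 1 ≤ ν) : ∃ D : ℝ, ∀ (I : Set ℝ) (α : ℝ → S),
      IsQuasigeodesic q I α → IsQIEmbeddingOn ν I (fun t => toGradedDual w (α t)) →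
        IsStronglyContracting D (α '' I) := by
  -- With this `ε` the large scales account for at most half of the growth `δ / ν` of the distance
  -- in the dual, up to a constant.
  have hε : 0 < 1 / (4 * q * ν) := by positivity
  obtain ⟨R, hR⟩ := exists_dist_toGradedDual_le_of_chainSize_le (S := S) w hε
  set Λ : ℝ := ((∑' R, w.lam R : ℝ≥0) : ℝ) with hΛ
  have hΛ0 : 0 ≤ Λ := NNReal.coe_nonneg _
  -- The step length is such that the term `6 * m` in the bound on the chain accounts for at most a
  -- quarter of `δ / ν`, which leaves a quarter to bound `δ`.
  set T := 24 * Λ * ν + 1 with hT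
  have hT0 : 0 < T := by positivity
  set c := ⌈2 * R + (q * T + q)⌉₊ with hc
  have hcle : 2 * R + (q * T + q) ≤ c := Nat.le_ceil _
  set Δ := 4 * ν * (Λ * (4 * c + 20) + ν + 2) with hΔ
  have hΔ0 : 0 ≤ Δ := by positivity
  refine ⟨2 * (q * Δ + q) + 1, fun I α hα hφ => isStronglyContracting_of_dist_le (by positivity)
    hα.closest fun x y p p' hp hp' hxy => ?_⟩
  obtain ⟨i, hi, rfl⟩ := hp.1
  obtain ⟨j, hj, rfl⟩ := hp'.1
  suffices hδ : |i - j| ≤ Δ by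
    refine (hα.qi i hi j hj).2.trans ?_
    gcongr
  set δ := |i - j| with hδ
  have hδ0 : 0 ≤ δ := abs_nonneg _
  -- The number of steps of parameter length at most `T` from `i` to `j`; the added 1 keeps it
  -- positive if `δ = 0`.
  set m := ⌈δ / T⌉₊ + 1 with hm
  have hm1 : δ / T ≤ m := by
    rw [hm]
    push_cast
    linarith [Nat.le_ceil (δ / T)]
  have hm2 : (m : ℝ) ≤ δ / T + 2 := by
    rw [hm]
    push_cast
    linarith [Nat.ceil_lt_add_one (div_nonneg hδ0 hT0.le)]
  have hm0 : (0 : ℝ) < m := by rw [hm]; positivity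
  have hsize : chainSize R (sep (principal _ (α i)) (principal _ (α j))) ≤
      ((4 * c + 6 * m + 8 : ℕ) : ℕ∞) := by
    -- A longer chain would satisfy the hypotheses of `IsCurtainChain.dist_le_of_path` and
    -- contradict `dist x y < dist x (α i)`.
    by_contra! hlt
    obtain ⟨h, hh, hneg, hpos⟩ := exists_separating_chain (n := 4 * c + 6 * m + 6) (by omega)
      (principal _ (α i)) (principal _ (α j)) subset_rfl hlt.le
    set f : ℕ → S := fun p => α (i + p * ((j - i) / m)) with hf
    have hf0 : f 0 = α i := by simp [hf]
    have hfm : f m = α j := by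
      simp only [hf]
      rw [mul_div_cancel₀ _ hm0.ne']
      congr 1
      ring
    have hfI : ∀ p ≤ m, i + p * ((j - i) / m) ∈ I := by
      intro p hp
      refine hα.interval.uIcc_subset hi hj ?_
      have hpm : (p : ℝ) / m ∈ Icc (0 : ℝ) 1 :=
        ⟨by positivity, div_le_one_of_le₀ (by exact_mod_cast hp) hm0.le⟩
      rw [← segment_eq_uIcc, segment_eq_image']
      refine ⟨p / m, hpm, ?_⟩
      simp only [smul_eq_mul]
      ring
    have hfA : ∀ p ≤ m, f p ∈ α '' I := fun p hp => mem_image_of_mem α (hfI p hp)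
    have hstep : ∀ p < m, dist (f p) (f (p + 1)) ≤ q * T + q := by
      intro p hp
      refine (hα.qi _ (hfI p hp.le) _ (hfI (p + 1) hp)).2.trans ?_
      have : |i + p * ((j - i) / m) - (i + ((p + 1 : ℕ) : ℝ) * ((j - i) / m))| = δ / m := by
        rw [hδ, ← abs_of_pos hm0, ← abs_div, abs_of_pos hm0]
        congr 1
        push_cast
        ring
      rw [this]
      have : δ / m ≤ T := by
        rw [div_le_iff₀ hT0] at hm1
        rw [div_le_iff₀ hm0]
        linarith
      gcongr
    have := (hh.dist_le_of_path (A := α '' I) (f := f) (m := m) (c := c) (x := x) (y := y) hfA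
      hstep (fun k hk => by rw [hf0]; exact mem_neg_of_principal (hneg _ subset_rfl k hk))
      (fun k hk => by
        rw [hfm]
        exact mem_pos_of_principal (hpos _ (by rw [sep_comm]) k hk))
      (by rwa [hf0]) (by rwa [hfm]) hcle le_rfl).1
    rw [hf0] at this
    linarith
  have h1 := hR _ _ _ hsize
  have h2 := (hφ i hi j hj).1
  have h3 := (hα.qi i hi j hj).2
  have h4 : 1 / (4 * q * ν) * (2 * dist (α i) (α j) + 4) ≤ δ / (2 * ν) + 2 := by
    have e1 : 1 / (4 * q * ν) * (2 * dist (α i) (α j) + 4) ≤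
        1 / (4 * q * ν) * (2 * (q * δ + q) + 4) := by gcongr
    refine e1.trans ?_
    have e2 : 1 / (4 * q * ν) * (2 * (q * δ + q) + 4) =
        δ / (2 * ν) + (2 * q + 4) / (4 * q * ν) := by
      field_simp
      ring
    rw [e2]
    have e3 : (2 * q + 4) / (4 * q * ν) ≤ 2 := by
      rw [div_le_iff₀ (by positivity)]
      have : q * 1 ≤ q * ν := by gcongr
      linarith
    linarith
  have h5 : Λ * (6 * (δ / T)) ≤ δ / (4 * ν) := by
    rw [le_div_iff₀ (by positivity)]
    have : 24 * Λ * ν * (δ / T) ≤ T * (δ / T) := by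
      gcongr
      linarith
    rw [mul_div_cancel₀ _ hT0.ne'] at this
    linarith
  have h6 : Λ * ((4 * c + 6 * m + 8 : ℕ) : ℝ) ≤ Λ * (4 * c + 20) + δ / (4 * ν) := by
    have : Λ * ((4 * c + 6 * m + 8 : ℕ) : ℝ) ≤ Λ * (4 * c + 20 + 6 * (δ / T)) := by
      gcongr
      push_cast
      linarith
    linarith
  have h7 : δ / ν = δ / (4 * ν) + δ / (4 * ν) + δ / (2 * ν) := by
    field_simp
    ring
  have h8 : δ / (4 * ν) ≤ Λ * (4 * c + 20) + ν + 2 := by linarith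
  rw [div_le_iff₀ (by positivity)] at h8
  linarith

end CurtainDual

theorem mainTheorem1 {S : Type*} [MetricSpace S] [GeodesicSpace S] (w : Weights) :
    -- `X = GradedDual S w` is a roughly geodesic hyperbolic space
    (IsFourPointHyperbolic (GradedDual S w) ∧ IsRoughlyGeodesic (GradedDual S w)) ∧
    -- the natural action of `Isom S` on walls induces an isometric action on `X`, for which the
    -- natural map `S → X` is equivariant
    (∃ ρ : (S ≃ᵢ S) →* (GradedDual S w ≃ᵢ GradedDual S w),
      (∀ (g : S ≃ᵢ S) (h : curtainWalls S), ∃ h' : curtainWalls S,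
        h'.1.1 = image g '' h.1.1 ∧
          ∀ x : GradedDual S w, (ρ g x).1.half h' = g '' x.1.half h) ∧
      ∀ (g : S ≃ᵢ S) (s : S), toGradedDual w (g s) = ρ g (toGradedDual w s)) ∧
    -- the map `S → X` is coarsely Lipschitz
    (∃ K : ℝ, ∀ s t : S,
      dist (toGradedDual w s) (toGradedDual w t) ≤ K * dist s t + K) ∧
    -- strongly contracting quasigeodesics are quasiisometrically embedded in `X`
    (∀ q D : ℝ, 1 ≤ q → ∃ ν : ℝ, 1 ≤ ν ∧ ∀ (I : Set ℝ) (α : ℝ → S),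
      IsQuasigeodesic q I α → IsStronglyContracting D (α '' I) →
        IsQIEmbeddingOn ν I (fun t => toGradedDual w (α t))) ∧
    -- quasigeodesics that are quasiisometrically embedded in `X` are strongly contracting
    (∀ q ν : ℝ, 1 ≤ q → 1 ≤ ν → ∃ D : ℝ, ∀ (I : Set ℝ) (α : ℝ → S),
      IsQuasigeodesic q I α → IsQIEmbeddingOn ν I (fun t => toGradedDual w (α t)) →
        IsStronglyContracting D (α '' I)) := by
  refine ⟨⟨isFourPointHyperbolic_gradedDual w, isRoughlyGeodesic_gradedDual w⟩,
    ⟨GradedDual.isometryAction w, fun g h => ⟨mapWall g h, rfl, fun x => ?_⟩, fun g s => ?_⟩,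
    ⟨4 * (∑' R, w.lam R : ℝ≥0), fun s t => ?_⟩, exists_isQIEmbeddingOn_toGradedDual w,
    exists_isStronglyContracting_of_isQIEmbeddingOn w⟩
  · exact WallUltrafilter.map_half_mapWall g x.1 h
  · exact Subtype.ext (WallUltrafilter.map_principal g s).symm
  · refine (dist_toGradedDual_le w s t).trans ?_
    have h1 : (0 : ℝ) ≤ (∑' R, w.lam R : ℝ≥0) := NNReal.coe_nonneg _
    have h2 := mul_nonneg h1 (dist_nonneg (x := s) (y := t))
    linarith
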